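/- Let $P$ be either a hyperbolic $2$-sphere with three cone points removed, of cone angles $2\alpha_1,2\alpha_2,2\alpha_3$, all less than $2\pi$ (write $P=P_\alpha$), or a compact hyperbolic three-holed sphere with geodesic boundary components of lengths $2l_1,2l_2,2l_3$ (write $P=P_l$). Here a hyperbolic surface is one glued from finitely many convex geodesic polygons of $\mathbb H^2$ along their sides by orientation-preserving isometries, with total angle $2\pi$ at every interior vertex other than the cone points (which are vertices) and $\pi$ at every boundary vertex. Let $\gamma_k$ be a simple loop around the $k$-th cone point, respectively parallel to the $k$-th boundary component. Let $\rho:\pi_1(P)\to\mathrm{PSL}(2;\mathbb R)$ be the holonomy representation and $\mathrm{Ad}_\rho=\mathrm{Sym}^2\circ\rho:\pi_1(P)\to\mathrm{SL}(3;\mathbb C)$ (conjugate to the adjoint representation), where $$\mathrm{Sym}^2\begin{pmatrix}p&q\\ r&s\end{pmatrix}=\begin{pmatrix}p^2&2pq&q^2\\ pr&ps+qr&qs\\ r^2&2rs&s^2\end{pmatrix}.$$ Its transpose acts on the coefficient vectors $(x,y,z)^T$ of the binary quadratic forms $xX^2+yXY+zY^2$ and preserves the discriminant $y^2-4xz$.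 Let $\mathrm C_*(P;\mathrm{Ad}_\rho)=\mathbb C^3\otimes_\rho \mathrm C_*(\widetilde K;\mathbb Z)$, with the relation $v\otimes\gamma c=(\mathrm{Ad}_\rho(\gamma)^Tv)\otimes c$, where $K$ is the CW complex onto which $P$ collapses that is dual to the decomposition of $P$ into polygons: one $0$-cell for each polygon, one $1$-cell for each interior edge, one $2$-cell for each interior vertex that is not a cone point. Let $\mathrm H_*(P;\mathrm{Ad}_\rho)$ be its homology. For a basis $\mathbf h_*$ of the homology, and the standard bases $\mathbf c_k=\{e_r\otimes\sigma\}$ of $\mathrm C_k(P;\mathrm{Ad}_\rho)$, where $\sigma$ runs over the $k$-cells, $$\mathrm{Tor}(P,\mathbf h_*;\mathrm{Ad}_\rho)=\pm\prod_k[\mathbf b_k\sqcup\widetilde{\mathbf b}_{k-1}\sqcup\widetilde{\mathbf h}_k;\mathbf c_k]^{(-1)^{k+1}}\in\mathbb C^*/\{\pm1\},$$ where $\mathbf b_k$ is any basis of $\partial(\mathrm C_{k+1})$, tildes denote lifts to chains, and $[\,\cdot\,;\mathbf c_k]$ is the determinant of the transition matrix. In both cases, for every decomposition of $P$ into polygons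 as above: (1) $\mathrm H_k(P;\mathrm{Ad}_\rho)=0$ for $k\ne1$. (2) The vectors invariant under $\mathrm{Ad}_\rho([\gamma_k])^T$ form a line, spanned by a vector of discriminant $1$. For any nonzero invariant vectors $\mathbf I_k$ of $\mathrm{Ad}_\rho([\gamma_k])^T$, $k=1,2,3$, the classes $\mathbf I_1\otimes[\gamma_1],\mathbf I_2\otimes[\gamma_2],\mathbf I_3\otimes[\gamma_3]$ form a basis $\mathbf h_P$ of $\mathrm H_1(P;\mathrm{Ad}_\rho)\cong\mathbb C^3$. If moreover each $\mathbf I_k$ is normalized to have discriminant $1$ (which determines it up to sign), then: (3) $\displaystyle\mathrm{Tor}(P_\alpha,\mathbf h_P;\mathrm{Ad}_\rho)=\pm\frac{i}{16\sin\alpha_1\sin\alpha_2\sin\alpha_3}.$ (4) $\displaystyle\mathrm{Tor}(P_l,\mathbf h_P;\mathrm{Ad}_\rho)=\pm\frac{1}{16\sinh l_1\sinh l_2\sinh l_3}.$ -/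

import Mathlib

open scoped MatrixGroups UpperHalfPlane

noncomputable section

namespace PairOfPants

/-! ## Reidemeister torsion of a finite based chain complex

The complex is `… → C 2 → C 1 → C 0 → 0`, with `d k : C (k + 1) → C k`. -/

section Complex

variable {C : ℕ → Type} [∀ k, AddCommGroup (C k)] [∀ k, Module ℂ (C k)]

/-- The `k`-cycles; every `0`-chain is a cycle. -/
def cycles (d : ∀ k, C (k + 1) →ₗ[ℂ] C k) : ∀ k, Submodule ℂ (C k)
  | 0 => ⊤
  | k + 1 => LinearMap.ker (d k)

/-- The `k`-boundaries. -/
def boundaries (d : ∀ k, C (k + 1) →ₗ[ℂ] C k) (k : ℕ) : Submodule ℂ (C k) :=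
  LinearMap.range (d k)

/-- Homology: cycles modulo boundaries. -/
abbrev Homology (d : ∀ k, C (k + 1) →ₗ[ℂ] C k) (k : ℕ) : Type :=
  cycles d k ⧸ (boundaries d k).submoduleOf (cycles d k)

/-- The homology class of a cycle. -/
def homologyClass (d : ∀ k, C (k + 1) →ₗ[ℂ] C k) (k : ℕ) (z : C k) (hz : z ∈ cycles d k) :
    Homology d k :=
  Submodule.Quotient.mk ⟨z, hz⟩

/-- Index type of the chosen basis `b_k` of the space of `k`-boundaries. -/
abbrev BoundaryIndex (d : ∀ k, C (k + 1) →ₗ[ℂ] C k) (k : ℕ) : Type :=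
  Fin (Module.finrank ℂ (boundaries d k))

/-- Index type of the lifts to `C k` of the basis `b_{k-1}`; there are none for `k = 0`. -/
def LiftIndex (d : ∀ k, C (k + 1) →ₗ[ℂ] C k) : ℕ → Type
  | 0 => Empty
  | k + 1 => BoundaryIndex d k

/-- The auxiliary choices in the definition of the torsion: bases `b_k` of the boundaries, lifts
of the `b_k` to `C (k + 1)`, cycles representing the given basis `h_k` of the homology, and
an ordering of the resulting new basis of `C k`, as a bijection with the index set of the given
basis of `C k`. -/
structure TorsionChoice {η : ℕ → Type} (ι : ℕ → Type) (d : ∀ k, C (k + 1) →ₗ[ℂ] C k)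
    (h : ∀ k, Module.Basis (η k) ℂ (Homology d k)) where
  b : ∀ k, Module.Basis (BoundaryIndex d k) ℂ (boundaries d k)
  bLift : ∀ k, BoundaryIndex d k → C (k + 1)
  d_bLift : ∀ k i, d k (bLift k i) = b k i
  hLift : ∀ k, η k → C k
  hLift_mem : ∀ k i, hLift k i ∈ cycles d k
  class_hLift : ∀ k i, homologyClass d k (hLift k i) (hLift_mem k i) = h k i
  order : ∀ k, ι k ≃ (BoundaryIndex d k ⊕ LiftIndex d k) ⊕ η k

namespace TorsionChoice

variable {ι η : ℕ → Type} {d : ∀ k, C (k + 1) →ₗ[ℂ] C k}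
  {h : ∀ k, Module.Basis (η k) ℂ (Homology d k)}

/-- The lifts to `C k` of the basis `b_{k-1}`. -/
def lifts (T : TorsionChoice ι d h) : ∀ k, LiftIndex d k → C k
  | 0 => fun i => Empty.elim i
  | k + 1 => T.bLift k

/-- The new basis `b_k ⊔ b̃_{k-1} ⊔ h̃_k` of `C k`. -/
def newBasis (T : TorsionChoice ι d h) (k : ℕ) : ι k → C k :=
  Sum.elim (Sum.elim (fun i => (T.b k i : C k)) (T.lifts k)) (T.hLift k) ∘ T.order k

open Classical in
/-- `∏_{k ≤ n} [b_k ⊔ b̃_{k-1} ⊔ h̃_k ; c_k] ^ ((-1) ^ (k + 1))`. -/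
def value [∀ k, Fintype (ι k)] (T : TorsionChoice ι d h) (c : ∀ k, Module.Basis (ι k) ℂ (C k))
    (n : ℕ) : ℂ :=
  ∏ k ∈ Finset.range (n + 1), ((c k).det (T.newBasis k)) ^ ((-1 : ℤ) ^ (k + 1))

end TorsionChoice

/-- The Reidemeister torsion of a chain complex that vanishes in degrees above `n`, with bases
`c_k` of the chain spaces and `h_k` of the homology. It is defined up to sign; this is the set of
all its representatives, obtained from all possible choices. -/
def torsion {ι η : ℕ → Type} [∀ k, Fintype (ι k)] (n : ℕ) (d : ∀ k, C (k + 1) →ₗ[ℂ] C k)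
    (c : ∀ k, Module.Basis (ι k) ℂ (C k)) (h : ∀ k, Module.Basis (η k) ℂ (Homology d k)) :
    Set ℂ :=
  {t | ∃ T : TorsionChoice ι d h, t = T.value c n ∨ t = -T.value c n}

end Complex

/-! ## The representation `Sym²` -/

/-- The matrix of `Sym² A` in the basis `X², 2XY, Y²`. Its transpose acts on the coefficient
vectors of the quadratic forms `x X² + y XY + z Y²`, see `symSq_transpose_mulVec_formMul`. -/
def symSq (A : SL(2, ℝ)) : Matrix (Fin 3) (Fin 3) ℂ :=
  !![(A 0 0 : ℂ) ^ 2, 2 * (A 0 0 : ℂ) * (A 0 1 : ℂ), (A 0 1 : ℂ) ^ 2;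
     (A 0 0 : ℂ) * (A 1 0 : ℂ), (A 0 0 : ℂ) * (A 1 1 : ℂ) + (A 0 1 : ℂ) * (A 1 0 : ℂ),
       (A 0 1 : ℂ) * (A 1 1 : ℂ);
     (A 1 0 : ℂ) ^ 2, 2 * (A 1 0 : ℂ) * (A 1 1 : ℂ), (A 1 1 : ℂ) ^ 2]

/-- The coefficients of the quadratic form `(v₀ X + v₁ Y) (w₀ X + w₁ Y)`. -/
def formMul (v w : Fin 2 → ℂ) : Fin 3 → ℂ :=
  ![v 0 * w 0, v 0 * w 1 + v 1 * w 0, v 1 * w 1]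

theorem symSq_one : symSq 1 = 1 := by
  ext i j
  fin_cases i <;> fin_cases j <;> simp [symSq]

theorem symSq_neg (A : SL(2, ℝ)) : symSq (-A) = symSq A := by
  ext i j
  fin_cases i <;> fin_cases j <;> simp [symSq]

theorem symSq_mul (A B : SL(2, ℝ)) : symSq (A * B) = symSq A * symSq B := by
  ext i j
  fin_cases i <;> fin_cases j <;>
    simp [symSq, Matrix.mul_apply, Fin.sum_univ_succ] <;> ring

theorem symSq_transpose_mulVec_formMul (A : SL(2, ℝ)) (v w : Fin 2 → ℂ) :
    (symSq A).transpose.mulVec (formMul v w) =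
      formMul ((A.1.map Complex.ofReal).transpose.mulVec v)
        ((A.1.map Complex.ofReal).transpose.mulVec w) := by
  ext i
  fin_cases i <;>
    simp [symSq, formMul, Matrix.mulVec, dotProduct, Fin.sum_univ_succ] <;> ring

/-- The discriminant of the quadratic form `x X² + y XY + z Y²`. -/
def discr (v : Fin 3 → ℂ) : ℂ := v 1 ^ 2 - 4 * v 0 * v 2

/-! ## Tessellated spheres with three holes -/

/-- The sides of the polygons: two sides `(e, true)`, `(e, false)` for each interior edge `e`,
which are glued to each other, and one side for each boundary edge. Each polygon
is oriented, and its sides are oriented as its boundary, with the polygon on the left. -/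
abbrev Side (E B : Type) : Type := (E × Bool) ⊕ B

/-- The side glued to a given side; boundary sides are fixed. -/
def opp (E B : Type) : Equiv.Perm (Side E B) :=
  Equiv.sumCongr ((Equiv.refl E).prodCongr Equiv.boolNot) (Equiv.refl B)

/-- A finite family of polygons (indexed by `F`) with sides glued in pairs along interior edges
(indexed by `E`), the remaining sides being boundary edges (indexed by `B`), such that
the oriented surface obtained is a sphere in which some discs may have been removed.

`next` goes to the following side of the same polygon. The permutation `next ∘ opp` turns around
the starting vertex of an interior side and passes from a boundary side to the side following it,
so its orbits, the *circuits*, are the interior vertices and the boundary components.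
Three circuits are distinguished, and labelled by `Fin 3`; the other ones are labelled by `R`. -/
structure Tessellation (F E B R : Type) [Fintype F] [Fintype E] [Fintype B] [Fintype R] where
  next : Equiv.Perm (Side E B)
  face : Side E B → F
  face_surjective : Function.Surjective face
  face_eq_iff : ∀ s t, face s = face t ↔ next.SameCycle s t
  three_le : ∀ s, next s ≠ s ∧ next (next s) ≠ s
  circuit : Side E B → R ⊕ Fin 3
  circuit_eq_iff : ∀ s t, circuit s = circuit t ↔ (next * opp E B).SameCycle s t
  /-- a starting side for each circuit -/
  base : R ⊕ Fin 3 → Side E B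
  circuit_base : ∀ c, circuit (base c) = c
  connected : ∀ s t, Relation.EqvGen (fun x y => y = next x ∨ y = opp E B x) s t
  euler : Fintype.card F + (Fintype.card R + 3) = Fintype.card E + 2

/-- `u` lies strictly to the left of the oriented geodesic from `z` to `w`. -/
def LeftOf (z w u : ℍ) : Prop :=
  0 < Matrix.det !![1, z.re, Complex.normSq (z : ℂ);
                    1, w.re, Complex.normSq (w : ℂ);
                    1, u.re, Complex.normSq (u : ℂ)]

/-- The position of `w` in the conformal disc model centred at `z`, in which
the geodesics through `z` are diameters. -/
def toDisc (z w : ℍ) : ℂ := ((w : ℂ) - z) / ((w : ℂ) - (starRingEnd ℂ) (z : ℂ))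

/-- The angle at `z` between the geodesics from `z` to `w` and from `z` to `u`. -/
def hypAngle (z w u : ℍ) : ℝ := InnerProductGeometry.angle (toDisc z w) (toDisc z u)

/-- A surface glued from convex hyperbolic polygons: each polygon is placed in the hyperbolic
plane, positively oriented, `pos s` being the starting vertex of the side `s`, and the sides are
glued by orientation preserving isometries. The isometry `glue e` carries
the polygon containing `(e, false)` to the neighbour, across the side `(e, true)`, of the polygon
containing `(e, true)`. It is an isometry of the hyperbolic plane, that is, an element
of `PSL(2, ℝ)`, given by one of its two representatives in `SL(2, ℝ)`; `symSq` does not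
depend on which. -/
structure HyperbolicSurface (F E B R : Type) [Fintype F] [Fintype E] [Fintype B] [Fintype R]
    extends Tessellation F E B R where
  pos : Side E B → ℍ
  convex : ∀ s t, face t = face s → t ≠ s → t ≠ next s → LeftOf (pos s) (pos (next s)) (pos t)
  glue : E → SL(2, ℝ)
  glue_end : ∀ e,
    glue e • pos (next (Sum.inl (e, false))) = pos (Sum.inl (e, true))
  glue_start : ∀ e,
    glue e • pos (Sum.inl (e, false)) = pos (next (Sum.inl (e, true)))

namespace HyperbolicSurface

variable {F E B R : Type} [Fintype F] [Fintype E] [Fintype B] [Fintype R]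

/-! ### Angles, cone points, geodesic boundary -/

/-- The interior angle of a polygon at the starting vertex of the side `s`. -/
def cornerAngle (S : HyperbolicSurface F E B R) (s : Side E B) : ℝ :=
  hypAngle (S.pos s) (S.pos (S.next s)) (S.pos (S.next.symm s))

/-- Two sides start at the same vertex of the surface. -/
def SameVertex (S : HyperbolicSurface F E B R) : Side E B → Side E B → Prop :=
  Relation.EqvGen (fun s t => (∃ p : E × Bool, s = Sum.inl p) ∧ t = S.next (opp E B s))

open Classical in
/-- The total angle of the surface at the starting vertex of `s`. -/
def vertexAngle (S : HyperbolicSurface F E B R) (s : Side E B) : ℝ :=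
  ∑ t with S.SameVertex s t, S.cornerAngle t

/-- The surface is a hyperbolic sphere with three cone points of angles `2 α 0, 2 α 1, 2 α 2`. -/
structure IsConeSphere (S : HyperbolicSurface F E B R) (α : Fin 3 → ℝ) : Prop where
  closed : IsEmpty B
  smooth : ∀ s r, S.circuit s = Sum.inl r → S.vertexAngle s = 2 * Real.pi
  cone : ∀ s k, S.circuit s = Sum.inr k → S.vertexAngle s = 2 * α k

open Classical in
/-- The surface is a hyperbolic three-holed sphere with three geodesic boundary components,
of lengths `2 l 0, 2 l 1, 2 l 2`. -/
structure IsGeodesicPants (S : HyperbolicSurface F E B R) (l : Fin 3 → ℝ) : Prop where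
  boundary_circuit : ∀ b : B, ∃ k, S.circuit (Sum.inr b) = Sum.inr k
  exists_boundary : ∀ k, ∃ b : B, S.circuit (Sum.inr b) = Sum.inr k
  smooth : ∀ s r, S.circuit s = Sum.inl r → S.vertexAngle s = 2 * Real.pi
  geodesic : ∀ s k, S.circuit s = Sum.inr k → S.vertexAngle s = Real.pi
  length : ∀ k, ∑ b : B with S.circuit (Sum.inr b) = Sum.inr k,
    dist (S.pos (Sum.inr b)) (S.pos (S.next (Sum.inr b))) = 2 * l k

/-! ### Holonomy

A path in the surface that avoids the vertices is recorded by the list of the sides it crosses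
(boundary sides, which are never crossed, are allowed in the list and are ignored). -/

/-- The holonomy of crossing a side: it carries the polygon on the far side of `s` to
the neighbour, across `s`, of the polygon containing `s`. -/
def crossing (S : HyperbolicSurface F E B R) : Side E B → SL(2, ℝ)
  | Sum.inl (e, true) => S.glue e
  | Sum.inl (e, false) => (S.glue e)⁻¹
  | Sum.inr _ => 1

/-- The sides met by the loop around a circuit, from its starting side on. -/
def loop (S : HyperbolicSurface F E B R) (c : R ⊕ Fin 3) : List (Side E B) :=
  (List.range (Function.minimalPeriod (S.next * opp E B) (S.base c))).map
    (fun i => ((S.next * opp E B) ^ i) (S.base c))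

/-- The holonomy `ρ([γ_k])` of the simple loop `γ_k` around the `k`-th cone point, or parallel to
the `k`-th boundary component, based in the polygon of `base (inr k)` and computed in
the coordinates of this polygon. -/
def loopHolonomy (S : HyperbolicSurface F E B R) (k : Fin 3) : SL(2, ℝ) :=
  ((S.loop (Sum.inr k)).map S.crossing).prod

/-- `v` is invariant under `Ad_ρ([γ_k])ᵀ`. -/
def IsInvariant (S : HyperbolicSurface F E B R) (k : Fin 3) (v : Fin 3 → ℂ) : Prop :=
  (symSq (S.loopHolonomy k)).transpose.mulVec v = v

/-! ### The twisted chain complex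

The surface minus its three cone points, or the three-holed sphere, deformation retracts
(by collapses, after subdivision) to the CW complex dual to the tessellation: it has one `0`-cell
for each polygon, one `1`-cell for each interior edge, joining the polygons on the two sides
of the edge, and one `2`-cell for each nonsingular interior vertex, attached along the loop around
this vertex. The twisted chain complex `ℂ³ ⊗_ρ C_*` has the relation `v ⊗ γ c = ρ(γ)ᵀ v ⊗ c`.
The `0`-cells are lifted to the universal cover in such a way that the developing map carries
the lifted polygon to its given position; the edge `e` is lifted to start at the lift
of the polygon of `(e, true)`, thus it ends at the translate by `glue e` of the lift of
the polygon of `(e, false)`; the `2`-cell `r` is lifted so that its attaching loop starts at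
the lift of the polygon of `base (inl r)`. -/

/-- The cells of the dual complex, by dimension. -/
def Cell (F E R : Type) : ℕ → Type
  | 0 => F
  | 1 => E
  | 2 => R
  | _ + 3 => Empty

instance instFintypeCell : ∀ k, Fintype (Cell F E R k)
  | 0 => inferInstanceAs (Fintype F)
  | 1 => inferInstanceAs (Fintype E)
  | 2 => inferInstanceAs (Fintype R)
  | _ + 3 => inferInstanceAs (Fintype Empty)

/-- The twisted `k`-chains: `∑ v_σ ⊗ σ` is the function `σ ↦ v_σ`. -/
abbrev Chain (F E R : Type) (k : ℕ) : Type := Cell F E R k → Fin 3 → ℂ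

/-- The standard basis `e_r ⊗ σ` of the twisted chains. -/
def stdBasis (F E R : Type) [Fintype F] [Fintype E] [Fintype R] (k : ℕ) :
    Module.Basis (Σ _ : Cell F E R k, Fin 3) ℂ (Chain F E R k) :=
  Pi.basis (fun _ => Pi.basisFun ℂ (Fin 3))

/-- `v ↦ Ad(A)ᵀ v`. -/
def adT (A : SL(2, ℝ)) : (Fin 3 → ℂ) →ₗ[ℂ] (Fin 3 → ℂ) := (symSq A).transpose.mulVecLin

open Classical in
/-- `v ↦ v ⊗ ã_s`, where `ã_s` is the lift, starting at the lift of the polygon of `s`,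
of the `1`-cell that crosses the side `s`. -/
def sideChain (S : HyperbolicSurface F E B R) : Side E B → (Fin 3 → ℂ) →ₗ[ℂ] (E → Fin 3 → ℂ)
  | Sum.inl (e, true) => LinearMap.single ℂ (fun _ : E => Fin 3 → ℂ) e
  | Sum.inl (e, false) =>
      -(LinearMap.single ℂ (fun _ : E => Fin 3 → ℂ) e ∘ₗ adT (S.glue e)⁻¹)
  | Sum.inr _ => 0

/-- `v ↦ v ⊗ p̃`, where `p̃` is the lift of the path crossing the given sides. -/
def pathChain (S : HyperbolicSurface F E B R) :
    List (Side E B) → (Fin 3 → ℂ) →ₗ[ℂ] (E → Fin 3 → ℂ)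
  | [] => 0
  | s :: p => S.sideChain s + S.pathChain p ∘ₗ adT (S.crossing s)

open Classical in
/-- The boundary of twisted `1`-chains: end point minus starting point. -/
def boundaryOne (S : HyperbolicSurface F E B R) : (E → Fin 3 → ℂ) →ₗ[ℂ] (F → Fin 3 → ℂ) :=
  ∑ e : E,
    (LinearMap.single ℂ (fun _ : F => Fin 3 → ℂ) (S.face (Sum.inl (e, false))) ∘ₗ adT (S.glue e)
      - LinearMap.single ℂ (fun _ : F => Fin 3 → ℂ) (S.face (Sum.inl (e, true)))) ∘ₗ
    LinearMap.proj e

/-- The boundary of twisted `2`-chains: attaching loops. -/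
def boundaryTwo (S : HyperbolicSurface F E B R) : (R → Fin 3 → ℂ) →ₗ[ℂ] (E → Fin 3 → ℂ) :=
  ∑ r : R, S.pathChain (S.loop (Sum.inl r)) ∘ₗ LinearMap.proj r

/-- The boundary operator of the twisted chain complex. -/
def boundary (S : HyperbolicSurface F E B R) :
    ∀ k, Chain F E R (k + 1) →ₗ[ℂ] Chain F E R k
  | 0 => S.boundaryOne
  | 1 => S.boundaryTwo
  | _ + 2 => 0

/-- The chain `v ⊗ γ_k`. -/
def loopChain (S : HyperbolicSurface F E B R) (k : Fin 3) (v : Fin 3 → ℂ) : Chain F E R 1 :=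
  S.pathChain (S.loop (Sum.inr k)) v

end HyperbolicSurface

/-- Index sets of homology bases that live in degree `1` only and have three elements. -/
def PantsIndex : ℕ → Type
  | 1 => Fin 3
  | _ => Empty

/-- The basis `h` of the homology consists of the classes `I_k ⊗ [γ_k]`, in degree `1`. -/
def IsLoopBasis {F E B R : Type} [Fintype F] [Fintype E] [Fintype B] [Fintype R]
    (S : HyperbolicSurface F E B R) (I : Fin 3 → Fin 3 → ℂ)
    (h : ∀ k, Module.Basis (PantsIndex k) ℂ (Homology S.boundary k)) : Prop :=
  ∀ k : Fin 3, ∃ hz : S.loopChain k (I k) ∈ cycles S.boundary 1,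
    h 1 k = homologyClass S.boundary 1 (S.loopChain k (I k)) hz

end PairOfPants

end

set_option linter.unusedSectionVars false

noncomputable section

namespace PairOfPants

namespace HyperbolicSurface

open scoped Classical

/-! ## The adjoint action and chains of paths -/

/-! The torsion is a quotient of determinants in one well chosen basis of `C_1`. Three inputs
produce that basis: the topology of a sphere with holes, the vanishing of `H_0`, and the algebra of
quadratic forms fixed by elements of `SL(2, ℝ)`.

Topology. Glue the polygons along a spanning tree, which gives a disc whose boundary word is
trivial, and then glue the remaining edges one by one. Gluing an edge multiplies the permutation
whose cycles are the circuits by a transposition, so it splits one circuit or merges two. The Euler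
relation leaves no room for a merge (`IsCut.exists_insert`). Through every split the product of the
based circuit loops stays trivial, and the tree edges together with the chains of all loops but one
stay a basis of `C_1` with block determinant `±1`. The group `PathElt` carries holonomy and chain
together, so that identities between paths are identities between chains, as in Fox calculus. The
outcome is `nonempty_presentation`. Loops around ordinary vertices are the boundaries of the
`2`-cells. Modulo these, the three distinguished loops satisfy one relation `x_i x_j x_0 = 1`, and
`∂ (v ⊗ x) = (Ad - 1) v` at the base polygon.

Vanishing of `H_0`. A functional `L` that kills the `1`-boundaries is flat. Evaluating it on the
quadratic form that represents a point of the hyperbolic plane gives a function `f` on the surface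
with `f'' = f` along geodesics. At a vertex where `f` has a positive maximum, `f` decreases along
every side that starts there. Its derivative is a sinusoid in the direction, which cannot be
negative all the way round an angle of `2π`. Around a smaller cone angle, invariance under the
nontrivial rotation forces the derivative to vanish. On geodesic boundary `f` is a periodic
combination of `cosh` and `sinh`, hence zero. So `f ≤ 0` at every vertex, the same holds for `-f`,
and vanishing at the ends of two adjacent sides gives `L = 0` (`boundaryOne_surjective`).

Algebra. Telescoping frames along a circuit shows that the loop holonomies are rotations by cone
angles and translations by boundary lengths, with `tr² - 4` equal to `-4 sin² α` and `4 sinh² l`. In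
particular these are nonzero, so each invariant line is spanned by the form `fixedForm A`, of
discriminant `tr² - 4`. Two polynomial identities, `det3_deltaT` and `two_mul_det3_fixedForm`,
evaluate the remaining `3 × 3` determinants. With `D_k = tr² - 4` for the `k`-th loop, they give
`torsion² * 4 * D_0 * D_1 * D_2 = 1`. Nondegeneracy comes from `H_0 = 0`: a pairing that vanished
identically would define a nonzero functional on the coinvariants (`exists_pairing_ne`). The torsion
is independent of all choices up to sign because passing between adapted bases is block triangular
(`AdaptedBasis.det_eq`). -/

theorem adT_one : adT 1 = LinearMap.id := by
  simp [adT, symSq_one]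

theorem adT_mul (A B : SL(2, ℝ)) : adT (A * B) = adT B ∘ₗ adT A := by
  simp [adT, symSq_mul, Matrix.transpose_mul, Matrix.mulVecLin_mul]

theorem adT_mul_apply (A B : SL(2, ℝ)) (v : Fin 3 → ℂ) : adT (A * B) v = adT B (adT A v) := by
  rw [adT_mul]; rfl

@[simp] theorem adT_inv_adT (A : SL(2, ℝ)) (v : Fin 3 → ℂ) : adT A⁻¹ (adT A v) = v := by
  rw [← adT_mul_apply, mul_inv_cancel, adT_one]; rfl

@[simp] theorem adT_adT_inv (A : SL(2, ℝ)) (v : Fin 3 → ℂ) : adT A (adT A⁻¹ v) = v := by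
  rw [← adT_mul_apply, inv_mul_cancel, adT_one]; rfl

theorem det_symSq (A : SL(2, ℝ)) : (symSq A).det = 1 := by
  have h : (A 0 0 : ℂ) * A 1 1 - (A 0 1 : ℂ) * A 1 0 = 1 := by
    have := A.det_coe
    rw [Matrix.det_fin_two] at this
    exact_mod_cast this
  simp only [symSq, Matrix.det_fin_three, Matrix.of_apply, Matrix.cons_val', Matrix.cons_val_zero,
    Matrix.cons_val_one, Matrix.cons_val]
  linear_combination (((A 0 0 : ℂ) * A 1 1 - (A 0 1 : ℂ) * A 1 0) ^ 2
    + ((A 0 0 : ℂ) * A 1 1 - (A 0 1 : ℂ) * A 1 0) + 1) * h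

theorem det_adT (A : SL(2, ℝ)) : LinearMap.det (adT A) = 1 := by
  rw [adT, ← Matrix.toLin'_apply', LinearMap.det_toLin', Matrix.det_transpose, det_symSq]

/-- The data of a path in the surface that matter for twisted chains: its holonomy, and
the map sending a coefficient vector `v` to the chain `v ⊗ p̃`. -/
@[ext] structure PathElt (W : Type) [AddCommGroup W] [Module ℂ W] where
  hol : SL(2, ℝ)
  chain : (Fin 3 → ℂ) →ₗ[ℂ] W

namespace PathElt

variable {W : Type} [AddCommGroup W] [Module ℂ W]

/-- The product rule of Fox calculus: the second path is lifted from the end of the first, so its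
coefficient is first carried by the holonomy already travelled. This is a semidirect product law. -/
instance : Mul (PathElt W) := ⟨fun g h => ⟨g.hol * h.hol, g.chain + h.chain ∘ₗ adT g.hol⟩⟩
instance : One (PathElt W) := ⟨⟨1, 0⟩⟩
instance : Inv (PathElt W) := ⟨fun g => ⟨g.hol⁻¹, -(g.chain ∘ₗ adT g.hol⁻¹)⟩⟩

@[simp] theorem hol_mul (g h : PathElt W) : (g * h).hol = g.hol * h.hol := rfl
@[simp] theorem hol_one : (1 : PathElt W).hol = 1 := rfl
@[simp] theorem hol_inv (g : PathElt W) : (g⁻¹).hol = g.hol⁻¹ := rfl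
theorem chain_mul (g h : PathElt W) : (g * h).chain = g.chain + h.chain ∘ₗ adT g.hol := rfl
@[simp] theorem chain_one : (1 : PathElt W).chain = 0 := rfl
theorem chain_inv (g : PathElt W) : (g⁻¹).chain = -(g.chain ∘ₗ adT g.hol⁻¹) := rfl
theorem chain_mul_apply (g h : PathElt W) (v : Fin 3 → ℂ) :
    (g * h).chain v = g.chain v + h.chain (adT g.hol v) := rfl
theorem chain_inv_apply (g : PathElt W) (v : Fin 3 → ℂ) :
    (g⁻¹).chain v = -g.chain (adT g.hol⁻¹ v) := rfl

instance : Group (PathElt W) :=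
  Group.ofLeftAxioms
    (fun a b c => by
      refine PathElt.ext (by simp [mul_assoc]) (LinearMap.ext fun v => ?_)
      simp [chain_mul, adT_mul, add_assoc])
    (fun a => by
      refine PathElt.ext (by simp) (LinearMap.ext fun v => ?_)
      simp [chain_mul, adT_one])
    (fun a => by
      refine PathElt.ext (by simp) (LinearMap.ext fun v => ?_)
      simp [chain_mul, chain_inv])

theorem list_prod_hol (l : List (PathElt W)) : l.prod.hol = (l.map hol).prod := by
  induction l with
  | nil => rfl
  | cons a l ih => simp [ih]

/-- A path element acts on pairs of a coefficient vector and a chain; later paths act later. -/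
def act {W' : Type} [AddCommGroup W'] [Module ℂ W'] (π : W →ₗ[ℂ] W') :
    PathElt W →* (Module.End ℂ ((Fin 3 → ℂ) × W'))ᵐᵒᵖ where
  toFun g := MulOpposite.op
    ((adT g.hol ∘ₗ LinearMap.fst ℂ _ _).prod
      (LinearMap.snd ℂ _ _ + π ∘ₗ g.chain ∘ₗ LinearMap.fst ℂ _ _))
  map_one' := by
    apply MulOpposite.unop_injective
    refine LinearMap.ext fun x => ?_
    simp [adT_one]
  map_mul' g h := by
    apply MulOpposite.unop_injective
    refine LinearMap.ext fun x => ?_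
    simp [adT_mul, chain_mul, Module.End.mul_apply, add_assoc]

/-- `g` is the class of a path with boundary `ι₁ ⊗ holonomy - ι₀` under `d`. -/
def IsPath {W₀ : Type} [AddCommGroup W₀] [Module ℂ W₀] (d : W →ₗ[ℂ] W₀) (g : PathElt W)
    (i₀ i₁ : (Fin 3 → ℂ) →ₗ[ℂ] W₀) : Prop :=
  ∀ v, d (g.chain v) = i₁ (adT g.hol v) - i₀ v

section IsPath

variable {W₀ : Type} [AddCommGroup W₀] [Module ℂ W₀] {d : W →ₗ[ℂ] W₀} {g h : PathElt W}
  {i₀ i₁ i₂ : (Fin 3 → ℂ) →ₗ[ℂ] W₀}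

theorem isPath_one : IsPath d 1 i₀ i₀ := fun v => by simp [adT_one]

theorem IsPath.mul (hg : IsPath d g i₀ i₁) (hh : IsPath d h i₁ i₂) : IsPath d (g * h) i₀ i₂ :=
  fun v => by rw [chain_mul_apply, map_add, hg v, hh, hol_mul, adT_mul_apply]; abel

theorem IsPath.inv (hg : IsPath d g i₀ i₁) : IsPath d g⁻¹ i₁ i₀ :=
  fun v => by rw [chain_inv_apply, map_neg, hg]; simp

end IsPath

/-- The path elements whose chains vanish under `π`. -/
def supported {W' : Type} [AddCommGroup W'] [Module ℂ W'] (π : W →ₗ[ℂ] W') :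
    Subgroup (PathElt W) where
  carrier := {g | ∀ v, π (g.chain v) = 0}
  mul_mem' {g h} hg hh v := by rw [chain_mul_apply, map_add, hg, hh, add_zero]
  one_mem' v := by simp
  inv_mem' {g} hg v := by rw [chain_inv_apply, map_neg, hg, neg_zero]

theorem mem_supported {W' : Type} [AddCommGroup W'] [Module ℂ W'] {π : W →ₗ[ℂ] W'}
    {g : PathElt W} : g ∈ supported π ↔ ∀ v, π (g.chain v) = 0 := Iff.rfl

end PathElt

/-! ### Paths crossing the sides of the polygons -/

variable {F E B R : Type} [Fintype F] [Fintype E] [Fintype B] [Fintype R]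
  (S : HyperbolicSurface F E B R)

/-- The path crossing a side. -/
def letter (s : Side E B) : PathElt (E → Fin 3 → ℂ) := ⟨S.crossing s, S.sideChain s⟩

@[simp] theorem letter_hol (s : Side E B) : (S.letter s).hol = S.crossing s := rfl
@[simp] theorem letter_chain (s : Side E B) : (S.letter s).chain = S.sideChain s := rfl

@[simp] theorem opp_inl (e : E) (b : Bool) :
    opp E B (Sum.inl (e, b)) = Sum.inl (e, !b) := rfl
@[simp] theorem opp_inr (b : B) : opp E B (Sum.inr b) = Sum.inr b := rfl
@[simp] theorem opp_opp (s : Side E B) : opp E B (opp E B s) = s := by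
  rcases s with ⟨e, b⟩ | b <;> simp

theorem letter_inr (b : B) : S.letter (Sum.inr b) = 1 := rfl

theorem letter_opp (s : Side E B) : S.letter (opp E B s) = (S.letter s)⁻¹ := by
  rcases s with ⟨e, b⟩ | b
  · cases b
    · refine PathElt.ext (by simp [crossing]) (LinearMap.ext fun v => ?_)
      simp [PathElt.chain_inv, sideChain, crossing]
    · exact PathElt.ext (by simp [crossing]) (by simp [PathElt.chain_inv, sideChain, crossing])
  · simp [letter_inr]

theorem letter_prod_chain (l : List (Side E B)) :
    (l.map S.letter).prod.chain = S.pathChain l := by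
  induction l with
  | nil => rfl
  | cons s l ih => simp [PathElt.chain_mul, pathChain, ih]

theorem letter_prod_hol (l : List (Side E B)) :
    (l.map S.letter).prod.hol = (l.map S.crossing).prod := by
  rw [PathElt.list_prod_hol, List.map_map]; rfl

/-- The inclusion of the coefficients of a `0`-cell. -/
def faceIncl (F : Type) (f : F) : (Fin 3 → ℂ) →ₗ[ℂ] (F → Fin 3 → ℂ) :=
  LinearMap.single ℂ (fun _ : F => Fin 3 → ℂ) f

theorem boundaryOne_single (e : E) (v : Fin 3 → ℂ) :
    S.boundaryOne (LinearMap.single ℂ (fun _ : E => Fin 3 → ℂ) e v) =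
      faceIncl F (S.face (Sum.inl (e, false))) (adT (S.glue e) v)
        - faceIncl F (S.face (Sum.inl (e, true))) v := by
  rw [boundaryOne, LinearMap.sum_apply, Finset.sum_eq_single e]
  · simp [faceIncl]
  · intro b _ hb
    simp [Pi.single_eq_of_ne hb]
  · simp

theorem letter_isPath (s : Side E B) : (S.letter s).IsPath S.boundaryOne
    (faceIncl F (S.face s)) (faceIncl F (S.face (opp E B s))) := by
  have key : ∀ e : E, (S.letter (Sum.inl (e, true))).IsPath S.boundaryOne
      (faceIncl F (S.face (Sum.inl (e, true)))) (faceIncl F (S.face (Sum.inl (e, false)))) :=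
    fun e v => S.boundaryOne_single e v
  rcases s with ⟨e, b⟩ | b
  · cases b
    · have := (key e).inv
      rw [← S.letter_opp] at this
      exact this
    · exact key e
  · exact PathElt.isPath_one

/-! ## Determinants of maps given by columns -/

/-- The map with the given columns. -/
def ofCols {ι V W : Type} [Fintype ι] [AddCommGroup V] [Module ℂ V] [AddCommGroup W] [Module ℂ W]
    (col : ι → V →ₗ[ℂ] W) : (ι → V) →ₗ[ℂ] W :=
  ∑ i, col i ∘ₗ LinearMap.proj i

section ofCols

variable {ι V W : Type} [Fintype ι] [AddCommGroup V] [Module ℂ V] [AddCommGroup W] [Module ℂ W]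

theorem ofCols_apply (col : ι → V →ₗ[ℂ] W) (x : ι → V) : ofCols col x = ∑ i, col i (x i) := by
  simp [ofCols]

@[simp] theorem ofCols_single (col : ι → V →ₗ[ℂ] W) (i : ι) (v : V) :
    ofCols col (Pi.single i v) = col i v := by
  rw [ofCols_apply, Finset.sum_eq_single i]
  · simp
  · intro b _ hb
    simp [Pi.single_eq_of_ne hb]
  · simp

theorem ofCols_id : ofCols (fun i => LinearMap.single ℂ (fun _ : ι => V) i) = LinearMap.id := by
  refine LinearMap.pi_ext fun i v => ?_
  simp

theorem ofCols_update (col : ι → V →ₗ[ℂ] W) (i : ι) (c : V →ₗ[ℂ] W) :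
    ofCols (Function.update col i c) = ofCols col + (c - col i) ∘ₗ LinearMap.proj i := by
  refine LinearMap.pi_ext fun j v => ?_
  by_cases h : j = i
  · subst h; simp
  · simp [Function.update_of_ne h, Pi.single_eq_of_ne (Ne.symm h)]

/-- Sylvester's determinant identity. It reduces a change of one block column to a determinant on a
single block. -/
theorem det_one_add_comp_comm {U W : Type} [AddCommGroup U] [Module ℂ U] [Module.Finite ℂ U]
    [AddCommGroup W] [Module ℂ W] [Module.Finite ℂ W] (u : U →ₗ[ℂ] W) (p : W →ₗ[ℂ] U) :
    LinearMap.det (LinearMap.id + u ∘ₗ p) = LinearMap.det (LinearMap.id + p ∘ₗ u) := by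
  let b := Module.finBasis ℂ U
  let c := Module.finBasis ℂ W
  rw [← LinearMap.det_toMatrix c, ← LinearMap.det_toMatrix b, map_add, map_add,
    LinearMap.toMatrix_comp c b c, LinearMap.toMatrix_comp b c b, LinearMap.toMatrix_id,
    LinearMap.toMatrix_id, Matrix.det_one_add_mul_comm]

variable [Module.Finite ℂ V]

/-- Block expansion along row `i`: by `hrow` that row meets no other column, so only the diagonal
block of the new column contributes. -/
theorem det_ofCols_update (col : ι → V →ₗ[ℂ] (ι → V)) (i : ι) (c : V →ₗ[ℂ] (ι → V))
    (hi : col i = LinearMap.single ℂ (fun _ : ι => V) i)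
    (hrow : ∀ j, j ≠ i → ∀ v, col j v i = 0) :
    LinearMap.det (ofCols (Function.update col i c)) =
      LinearMap.det (LinearMap.proj i ∘ₗ c) * LinearMap.det (ofCols col) := by
  have hp : (LinearMap.proj i : (ι → V) →ₗ[ℂ] V) ∘ₗ ofCols col = LinearMap.proj i := by
    refine LinearMap.pi_ext fun j v => ?_
    by_cases h : j = i
    · subst h; simp [hi]
    · simp [hrow j h, Pi.single_eq_of_ne (Ne.symm h)]
  have h1 : ofCols (Function.update col i c) =
      (LinearMap.id + (c - col i) ∘ₗ LinearMap.proj i) ∘ₗ ofCols col := by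
    rw [ofCols_update, LinearMap.add_comp, LinearMap.comp_assoc, hp, LinearMap.id_comp]
  have h2 : LinearMap.id + (LinearMap.proj i : (ι → V) →ₗ[ℂ] V) ∘ₗ (c - col i)
      = LinearMap.proj i ∘ₗ c := by
    ext v : 1
    simp [hi]
  rw [h1, LinearMap.det_comp, det_one_add_comp_comm, h2]

/-- An elementary column operation with an endomorphism in place of a scalar. -/
theorem det_ofCols_update_add (col : ι → V →ₗ[ℂ] (ι → V)) {i j : ι} (hij : i ≠ j)
    (c : V →ₗ[ℂ] V) :
    LinearMap.det (ofCols (Function.update col j (col j + col i ∘ₗ c))) =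
      LinearMap.det (ofCols col) := by
  have h1 : ofCols (Function.update col j (col j + col i ∘ₗ c)) = ofCols col ∘ₗ
      (LinearMap.id + (LinearMap.single ℂ (fun _ : ι => V) i ∘ₗ c) ∘ₗ LinearMap.proj j) := by
    rw [ofCols_update]
    refine LinearMap.ext fun x => ?_
    simp
  have h2 : LinearMap.id + (LinearMap.proj j : (ι → V) →ₗ[ℂ] V) ∘ₗ
      (LinearMap.single ℂ (fun _ : ι => V) i ∘ₗ c) = LinearMap.id := by
    ext v : 1
    simp [Pi.single_eq_of_ne (Ne.symm hij)]
  rw [h1, LinearMap.det_comp, det_one_add_comp_comm, h2, LinearMap.det_id, mul_one]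

end ofCols

end HyperbolicSurface

end PairOfPants

end

noncomputable section

namespace PairOfPants

/-! ## Cycles of permutations as lists -/

section CycleLists

variable {α : Type} [DecidableEq α]

/-- `l` lists the elements of a cycle of `p` in cyclic order (if it has no duplicates). -/
def IsCyc (p : Equiv.Perm α) (l : List α) : Prop := l ≠ [] ∧ l.map p = l.rotate 1

theorem isCyc_cons {p : Equiv.Perm α} {s : α} {a : List α} :
    IsCyc p (s :: a) ↔ (s :: a).map p = a ++ [s] := by
  simp [IsCyc]

theorem IsCyc.append_comm {p : Equiv.Perm α} {u v : List α} (h : IsCyc p (u ++ v)) :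
    IsCyc p (v ++ u) := by
  refine ⟨by have := h.1; simp at this ⊢; tauto, ?_⟩
  have e : (u ++ v).rotate u.length = v ++ u := List.rotate_append_length_eq u v
  rw [← e, List.map_rotate, h.2, List.rotate_rotate, List.rotate_rotate, add_comm]

theorem mul_swap_apply_of_notMem {p : Equiv.Perm α} {s s' : α} {l : List α} (hs : s ∉ l)
    (hs' : s' ∉ l) : l.map (p * Equiv.swap s s') = l.map p := by
  refine List.map_congr_left fun x hx => ?_
  rw [Equiv.Perm.mul_apply, Equiv.swap_apply_of_ne_of_ne]
  · rintro rfl; exact hs hx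
  · rintro rfl; exact hs' hx

theorem IsCyc.mul_swap_of_notMem {p : Equiv.Perm α} {s s' : α} {l : List α} (h : IsCyc p l)
    (hs : s ∉ l) (hs' : s' ∉ l) : IsCyc (p * Equiv.swap s s') l :=
  ⟨h.1, (mul_swap_apply_of_notMem hs hs').trans h.2⟩

/-- A transposition of two elements of one cycle cuts the cycle at both. Geometrically, gluing two
sides of the same boundary circuit replaces it by two circuits. -/
theorem IsCyc.split {p : Equiv.Perm α} {s s' : α} {a b : List α}
    (h : IsCyc p (s :: a ++ s' :: b)) (hn : (s :: a ++ s' :: b).Nodup) :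
    IsCyc (p * Equiv.swap s s') (s' :: a) ∧ IsCyc (p * Equiv.swap s s') (s :: b) := by
  have hsa : s ∉ a ∧ s ∉ b ∧ s' ∉ a ∧ s' ∉ b := by
    simp [List.nodup_cons, List.nodup_append] at hn
    grind
  have h1 := isCyc_cons.1 h
  have h2 : (s :: a).map p ++ (s' :: b).map p = (a ++ [s']) ++ (b ++ [s]) := by
    simpa using h1
  obtain ⟨h3, h4⟩ := List.append_inj h2 (by simp)
  simp only [List.map_cons] at h3 h4
  constructor
  · rw [isCyc_cons, List.map_cons, mul_swap_apply_of_notMem hsa.1 hsa.2.2.1]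
    simpa using h3
  · rw [isCyc_cons, List.map_cons, mul_swap_apply_of_notMem hsa.2.1 hsa.2.2.2]
    simpa using h4

/-- The opposite case: a transposition of elements of different cycles exchanges their tails and
joins them. -/
theorem IsCyc.merge {p : Equiv.Perm α} {s s' : α} {a b : List α}
    (h : IsCyc p (s :: a)) (h' : IsCyc p (s' :: b)) (hn : ((s :: a) ++ s' :: b).Nodup) :
    IsCyc (p * Equiv.swap s s') (s :: b ++ s' :: a) := by
  have hsa : s ∉ a ∧ s ∉ b ∧ s' ∉ a ∧ s' ∉ b := by
    simp [List.nodup_cons, List.nodup_append] at hn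
    grind
  have h3 := isCyc_cons.1 h
  have h4 := isCyc_cons.1 h'
  simp only [List.map_cons] at h3 h4
  rw [List.cons_append, isCyc_cons, List.map_cons, List.map_append, List.map_cons,
    mul_swap_apply_of_notMem hsa.1 hsa.2.2.1, mul_swap_apply_of_notMem hsa.2.1 hsa.2.2.2]
  simp only [Equiv.Perm.mul_apply, Equiv.swap_apply_left, Equiv.swap_apply_right]
  rw [← List.cons_append, h4, h3]
  simp

theorem IsCyc.getElem_eq_pow {p : Equiv.Perm α} {s : α} {a : List α} (h : IsCyc p (s :: a)) :
    ∀ (i : ℕ) (hi : i < (s :: a).length), (s :: a)[i] = (p ^ i) s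
  | 0, _ => rfl
  | i + 1, hi => by
    have ih := h.getElem_eq_pow i (by omega)
    have h1 : ((s :: a).map p)[i]'(by simp at hi ⊢; omega) = (a ++ [s])[i]'(by simp at hi ⊢; omega) := by
      simp only [isCyc_cons.1 h]
    rw [List.getElem_map, ih] at h1
    rw [pow_succ', Equiv.Perm.mul_apply, h1, List.getElem_append_left (by simp at hi; omega)]
    rfl

theorem IsCyc.pow_length {p : Equiv.Perm α} {s : α} {a : List α} (h : IsCyc p (s :: a)) :
    (p ^ (s :: a).length) s = s := by
  have h0 := h.getElem_eq_pow a.length (by simp)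
  have h1 : ((s :: a).map p)[a.length]'(by simp) = (a ++ [s])[a.length]'(by simp) := by
    simp only [isCyc_cons.1 h]
  rw [List.getElem_map, h0] at h1
  rw [List.length_cons, pow_succ', Equiv.Perm.mul_apply, h1]
  simp

theorem IsCyc.exists_cons {p : Equiv.Perm α} {l : List α} (h : IsCyc p l) {s : α} (hs : s ∈ l) :
    ∃ u v, l = u ++ s :: v ∧ IsCyc p (s :: v ++ u) := by
  obtain ⟨u, v, rfl⟩ := List.append_of_mem hs
  exact ⟨u, v, rfl, h.append_comm⟩

theorem IsCyc.sameCycle {p : Equiv.Perm α} {l : List α} (h : IsCyc p l) {s t : α} (hs : s ∈ l)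
    (ht : t ∈ l) : p.SameCycle s t := by
  obtain ⟨u, v, rfl, hc⟩ := h.exists_cons hs
  have ht' : t ∈ s :: (v ++ u) := by simp at ht ⊢; tauto
  obtain ⟨i, hi, rfl⟩ := List.mem_iff_getElem.1 ht'
  rw [IsCyc.getElem_eq_pow (s := s) (a := v ++ u) hc i hi]
  exact ⟨i, by simp⟩

theorem IsCyc.mem_of_sameCycle {p : Equiv.Perm α} {l : List α} (h : IsCyc p l) {s t : α}
    (hs : s ∈ l) (hst : p.SameCycle s t) : t ∈ l := by
  have hmaps : ∀ x, x ∈ l ↔ p x ∈ l := by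
    intro x
    have : p x ∈ l.map p ↔ p x ∈ l := by rw [h.2, List.mem_rotate]
    rw [← this, List.mem_map_of_injective p.injective]
  obtain ⟨i, rfl⟩ := hst
  have hn : ∀ (n : ℕ) (x : α), x ∈ l ↔ (p ^ n) x ∈ l := by
    intro n
    induction n with
    | zero => simp
    | succ n ih => intro x; rw [pow_succ', Equiv.Perm.mul_apply, ← hmaps, ← ih]
  rcases i with n | n
  · simpa using (hn n s).1 hs
  · rw [hn (n + 1)]
    rw [← Equiv.Perm.mul_apply]
    simpa using hs

/-- Without repetitions the length of the list is the minimal period. This identifies abstract cycle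
lists with the explicit lists defining `loop`. -/
theorem IsCyc.eq_map_range {p : Equiv.Perm α} {s : α} {a : List α} (h : IsCyc p (s :: a))
    (hn : (s :: a).Nodup) :
    s :: a = (List.range (Function.minimalPeriod p s)).map (fun i => (p ^ i) s) := by
  have hper : Function.minimalPeriod p s = (s :: a).length := by
    apply le_antisymm
    · apply Function.IsPeriodicPt.minimalPeriod_le (by simp)
      have := h.pow_length
      rwa [← Equiv.Perm.iterate_eq_pow] at this
    · by_contra hlt
      push Not at hlt
      have hpos : 0 < Function.minimalPeriod p s :=
        Function.IsPeriodicPt.minimalPeriod_pos (n := (s :: a).length) (by simp)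
          (by have := h.pow_length; rwa [← Equiv.Perm.iterate_eq_pow] at this)
      have h1 := h.getElem_eq_pow _ hlt
      have h2 : (p ^ (Function.minimalPeriod p s)) s = s := by
        rw [← Equiv.Perm.iterate_eq_pow]
        exact Function.iterate_minimalPeriod
      rw [h2] at h1
      have := (hn.getElem_inj_iff (i := Function.minimalPeriod p s) (j := 0) (hi := hlt)
        (hj := by simp)).1 (by simpa using h1)
      omega
  apply List.ext_getElem
  · simp [hper]
  · intro i h1 h2
    rw [h.getElem_eq_pow i h1]
    simp

/-- The lists of `L` are the cycles of `p`, each of them once. -/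
structure IsDecomp (p : Equiv.Perm α) (L : List (List α)) : Prop where
  isCyc : ∀ l ∈ L, IsCyc p l
  nodup : L.flatten.Nodup
  mem : ∀ x, x ∈ L.flatten

namespace IsDecomp

variable {p : Equiv.Perm α} {L : List (List α)}

theorem perm (h : IsDecomp p L) {L' : List (List α)} (hL : L.Perm L') : IsDecomp p L' :=
  ⟨fun l hl => h.isCyc l (hL.mem_iff.2 hl), hL.flatten.nodup_iff.1 h.nodup,
    fun x => hL.flatten.mem_iff.1 (h.mem x)⟩

theorem of_flatten_perm (h : IsDecomp p L) {q : Equiv.Perm α} {L' : List (List α)}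
    (hL : L.flatten.Perm L'.flatten) (hq : ∀ l ∈ L', IsCyc q l) : IsDecomp q L' :=
  ⟨hq, hL.nodup_iff.1 h.nodup, fun x => hL.mem_iff.1 (h.mem x)⟩

theorem rotate {pre post : List (List α)} {u v : List α}
    (h : IsDecomp p (pre ++ (u ++ v) :: post)) : IsDecomp p (pre ++ (v ++ u) :: post) := by
  refine h.of_flatten_perm ?_ ?_
  · simp only [List.flatten_append, List.flatten_cons]
    exact (List.perm_append_comm.append_right _).append_left _
  · intro l hl
    rw [List.mem_append, List.mem_cons] at hl
    rcases hl with hl | rfl | hl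
    · exact h.isCyc l (by simp [hl])
    · exact (h.isCyc (u ++ v) (by simp)).append_comm
    · exact h.isCyc l (by simp [hl])

theorem split {pre post : List (List α)} {s s' : α} {a b : List α}
    (h : IsDecomp p (pre ++ (s :: a ++ s' :: b) :: post)) :
    IsDecomp (p * Equiv.swap s s') (pre ++ (s' :: a) :: (s :: b) :: post) := by
  have hn := h.nodup
  simp only [List.flatten_append, List.flatten_cons] at hn
  have hn1 : (s :: a ++ s' :: b).Nodup :=
    (List.nodup_append.1 (List.nodup_append.1 hn).2.1).1
  have hdis : ∀ l, l ∈ pre ∨ l ∈ post → s ∉ l ∧ s' ∉ l := by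
    intro l hl
    have h1 : ∀ x ∈ (s :: a ++ s' :: b), x ∉ l := by
      intro x hx hxl
      rcases hl with hl | hl
      · exact (List.nodup_append.1 hn).2.2 x (List.mem_flatten.2 ⟨l, hl, hxl⟩) x
          (List.mem_append_left _ hx) rfl
      · exact (List.nodup_append.1 (List.nodup_append.1 hn).2.1).2.2 x hx x
          (List.mem_flatten.2 ⟨l, hl, hxl⟩) rfl
    exact ⟨h1 s (by simp), h1 s' (by simp)⟩
  have hs := (h.isCyc (s :: a ++ s' :: b) (by simp)).split hn1
  refine h.of_flatten_perm ?_ ?_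
  · simp only [List.flatten_append, List.flatten_cons]
    refine List.Perm.append_left _ ?_
    rw [← List.append_assoc]
    refine List.Perm.append_right _ ?_
    rw [List.perm_iff_count]
    intro x
    simp [List.count_cons]
    omega
  · intro l hl
    rw [List.mem_append, List.mem_cons, List.mem_cons] at hl
    rcases hl with hl | rfl | rfl | hl
    · exact (h.isCyc l (by simp [hl])).mul_swap_of_notMem (hdis l (.inl hl)).1 (hdis l (.inl hl)).2
    · exact hs.1
    · exact hs.2
    · exact (h.isCyc l (by simp [hl])).mul_swap_of_notMem (hdis l (.inr hl)).1 (hdis l (.inr hl)).2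

theorem merge {rest : List (List α)} {s s' : α} {a b : List α}
    (h : IsDecomp p ((s :: a) :: (s' :: b) :: rest)) :
    IsDecomp (p * Equiv.swap s s') ((s :: b ++ s' :: a) :: rest) := by
  have hn := h.nodup
  simp only [List.flatten_cons] at hn
  rw [← List.append_assoc] at hn
  have hn1 := (List.nodup_append.1 hn).1
  refine h.of_flatten_perm ?_ ?_
  · simp only [List.flatten_cons]
    rw [← List.append_assoc]
    refine List.Perm.append_right _ ?_
    rw [List.perm_iff_count]
    intro x
    simp [List.count_cons]
    omega
  · intro l hl
    rw [List.mem_cons] at hl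
    rcases hl with rfl | hl
    · exact (h.isCyc _ (by simp)).merge (h.isCyc _ (by simp)) hn1
    · have h1 : ∀ x ∈ (s :: a ++ s' :: b), x ∉ l := fun x hx hxl =>
        (List.nodup_append.1 hn).2.2 x hx x (List.mem_flatten.2 ⟨l, hl, hxl⟩) rfl
      exact (h.isCyc l (by simp [hl])).mul_swap_of_notMem (h1 s (by simp)) (h1 s' (by simp))

theorem exists_perm_cons (h : IsDecomp p L) (s : α) :
    ∃ a rest, L.length = rest.length + 1 ∧ IsDecomp p ((s :: a) :: rest) ∧
      ∀ l ∈ L, s ∉ l → l ∈ rest := by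
  obtain ⟨l, hl, hs⟩ := List.mem_flatten.1 (h.mem s)
  obtain ⟨pre, post, rfl⟩ := List.append_of_mem hl
  obtain ⟨u, v, rfl⟩ := List.append_of_mem hs
  refine ⟨v ++ u, pre ++ post, by simp; omega, ?_, ?_⟩
  · exact h.rotate.perm List.perm_middle
  · intro l hl hsl
    rw [List.mem_append, List.mem_cons] at hl
    rcases hl with hl | rfl | hl
    · simp [hl]
    · simp at hsl
    · simp [hl]

theorem exists_merge (h : IsDecomp p L) {s s' : α}
    (hss : ∀ l ∈ L, ¬ (s ∈ l ∧ s' ∈ l)) :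
    ∃ L', IsDecomp (p * Equiv.swap s s') L' ∧ L'.length + 1 = L.length := by
  obtain ⟨l', hl', hs'⟩ := List.mem_flatten.1 (h.mem s')
  have hs : s ∉ l' := fun hs => hss l' hl' ⟨hs, hs'⟩
  obtain ⟨a, rest, hlen, hd, hrest⟩ := h.exists_perm_cons s
  obtain ⟨pre, post, rfl⟩ := List.append_of_mem (hrest l' hl' hs)
  obtain ⟨u, v, rfl⟩ := List.append_of_mem hs'
  have h1 : IsDecomp p ((s' :: v ++ u) :: (s :: a) :: (pre ++ post)) := by
    refine IsDecomp.perm (L := ((s :: a) :: pre) ++ (s' :: v ++ u) :: post)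
      (IsDecomp.rotate hd) ?_
    exact List.perm_middle
  have h2 := (h1.perm (List.Perm.swap _ _ _)).merge
  exact ⟨_, h2, by simp at hlen ⊢; omega⟩

/-- Only the upper bound is needed: a transposition creates at most one new cycle, which feeds the
count of circuits. -/
theorem exists_mul_swap (h : IsDecomp p L) {s s' : α} (hne : s ≠ s') :
    ∃ L', IsDecomp (p * Equiv.swap s s') L' ∧ L'.length ≤ L.length + 1 := by
  by_cases hss : ∀ l ∈ L, ¬ (s ∈ l ∧ s' ∈ l)
  · obtain ⟨L', h1, h2⟩ := h.exists_merge hss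
    exact ⟨L', h1, by omega⟩
  · obtain ⟨a, rest, hlen, hd, hrest⟩ := h.exists_perm_cons s
    have hs' : s' ∈ a := by
      push Not at hss
      obtain ⟨l, hl, hs, hs'⟩ := hss
      have h1 := (h.isCyc l hl).sameCycle hs hs'
      have h2 := (hd.isCyc (s :: a) (by simp)).mem_of_sameCycle (by simp) h1
      rcases List.mem_cons.1 h2 with h3 | h3
      · exact absurd h3.symm hne
      · exact h3
    obtain ⟨u, v, rfl⟩ := List.append_of_mem hs'
    exact ⟨_, IsDecomp.split (pre := []) hd, by simp; omega⟩

end IsDecomp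

end CycleLists

end PairOfPants

end

noncomputable section

namespace PairOfPants

theorem exists_isCyc_cons {α : Type} [DecidableEq α] [Finite α] (p : Equiv.Perm α) (s : α) :
    ∃ a, IsCyc p (s :: a) ∧ (s :: a).Nodup := by
  have hper : s ∈ Function.periodicPts p := by
    have := Fintype.ofFinite α
    refine ⟨orderOf p, orderOf_pos p, ?_⟩
    change p^[orderOf p] s = s
    rw [Equiv.Perm.iterate_eq_pow, pow_orderOf_eq_one]; rfl
  have hpos := Function.minimalPeriod_pos_of_mem_periodicPts hper
  obtain ⟨n, hn⟩ : ∃ n, Function.minimalPeriod p s = n + 1 := ⟨_, (Nat.succ_pred_eq_of_pos hpos).symm⟩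
  refine ⟨(List.range n).map (fun i => (p ^ (i + 1)) s), ?_, ?_⟩
  · rw [isCyc_cons, List.map_cons, List.map_map]
    have h1 : (p ^ (n + 1)) s = s := by
      rw [← hn, ← Equiv.Perm.iterate_eq_pow]; exact Function.iterate_minimalPeriod
    have h2 : (List.range n).map (fun i => (p ^ (i + 1)) s) ++ [s] =
        (List.range (n + 1)).map (fun i => (p ^ (i + 1)) s) := by
      rw [List.range_succ, List.map_append]; simp [h1]
    rw [h2, List.range_succ_eq_map, List.map_cons, List.map_map]
    congr 1
    refine List.map_congr_left fun i _ => ?_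
    simp [pow_succ']
  · have h2 : s :: (List.range n).map (fun i => (p ^ (i + 1)) s) =
        (List.range (n + 1)).map (fun i => (p ^ i) s) := by
      rw [List.range_succ_eq_map, List.map_cons, List.map_map]; rfl
    rw [h2, ← hn]
    refine List.Nodup.map_on ?_ List.nodup_range
    intro i hi j hj hij
    rw [List.mem_range] at hi hj
    simp only [← Equiv.Perm.iterate_eq_pow] at hij
    exact Function.iterate_injOn_Iio_minimalPeriod hi hj hij

theorem perm_exchange_tails {α : Type} (s s' : α) (a b : List α) :
    ((s :: a) ++ s' :: b).Perm (s :: b ++ s' :: a) := by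
  classical
  rw [List.perm_iff_count]
  intro x
  simp [List.count_cons]
  omega

namespace HyperbolicSurface

open scoped Classical

variable {F E B R : Type} [Fintype F] [Fintype E] [Fintype B] [Fintype R]
  (S : HyperbolicSurface F E B R)

/-! ## Gluing along some of the edges -/

/-- The side glued to a given side when only the edges of `X` are glued. -/
def oppOn (X : Finset E) : Equiv.Perm (Side E B) :=
  Function.Involutive.toPerm
    (fun s => match s with
      | Sum.inl (e, b) => if e ∈ X then Sum.inl (e, !b) else Sum.inl (e, b)
      | Sum.inr b => Sum.inr b)
    (by
      rintro (⟨e, b⟩ | b)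
      · by_cases h : e ∈ X <;> simp [h]
      · rfl)

theorem oppOn_inl (X : Finset E) (e : E) (b : Bool) : oppOn X (Sum.inl (e, b) : Side E B) =
    if e ∈ X then Sum.inl (e, !b) else Sum.inl (e, b) := rfl

theorem oppOn_empty : (oppOn ∅ : Equiv.Perm (Side E B)) = 1 := by
  ext s
  rcases s with ⟨e, b⟩ | b
  · simp [oppOn_inl]
  · rfl

theorem oppOn_univ : (oppOn Finset.univ : Equiv.Perm (Side E B)) = opp E B := by
  ext s
  rcases s with ⟨e, b⟩ | b
  · simp [oppOn_inl]
  · rfl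

theorem oppOn_insert {X : Finset E} {e : E} (he : e ∉ X) (b : Bool) :
    (oppOn (insert e X) : Equiv.Perm (Side E B)) =
      oppOn X * Equiv.swap (Sum.inl (e, b)) (Sum.inl (e, !b)) := by
  ext s
  rw [Equiv.Perm.mul_apply]
  rcases s with ⟨e', b'⟩ | b'
  · by_cases h : e' = e
    · subst h
      by_cases hb : b' = b
      · subst hb
        rw [Equiv.swap_apply_left, oppOn_inl, oppOn_inl, if_pos (Finset.mem_insert_self _ _),
          if_neg he]
      · have hb2 : b' = !b := by cases b <;> cases b' <;> simp_all
        subst hb2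
        rw [Equiv.swap_apply_right, oppOn_inl, oppOn_inl, if_pos (Finset.mem_insert_self _ _),
          if_neg he, Bool.not_not]
    · rw [Equiv.swap_apply_of_ne_of_ne (by simp [h]) (by simp [h]), oppOn_inl, oppOn_inl]
      simp [h]
  · rw [Equiv.swap_apply_of_ne_of_ne (by simp) (by simp)]; rfl

/-- The permutation `next ∘ opp` when only the edges of `X` are glued. -/
def turn (X : Finset E) : Equiv.Perm (Side E B) := S.next * oppOn X

/-- The link between gluing and cycle surgery: one more edge is one more transposition. -/
theorem turn_insert {X : Finset E} {e : E} (he : e ∉ X) (b : Bool) :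
    S.turn (insert e X) = S.turn X * Equiv.swap (Sum.inl (e, b)) (Sum.inl (e, !b)) := by
  rw [turn, oppOn_insert he b, ← mul_assoc]; rfl

theorem face_next (s : Side E B) : S.face (S.next s) = S.face s := by
  rw [S.face_eq_iff]
  exact (Equiv.Perm.SameCycle.refl _ _).apply_left

/-- The path crossing a side if its edge is in `X`, and the constant path otherwise. -/
def letterOn (X : Finset E) : Side E B → PathElt (E → Fin 3 → ℂ)
  | Sum.inl (e, b) => if e ∈ X then S.letter (Sum.inl (e, b)) else 1
  | Sum.inr _ => 1

theorem letterOn_inl_of_mem {X : Finset E} {e : E} (he : e ∈ X) (b : Bool) :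
    S.letterOn X (Sum.inl (e, b)) = S.letter (Sum.inl (e, b)) := if_pos he

theorem letterOn_inl_of_notMem {X : Finset E} {e : E} (he : e ∉ X) (b : Bool) :
    S.letterOn X (Sum.inl (e, b)) = 1 := if_neg he

theorem letterOn_univ : S.letterOn Finset.univ = S.letter := by
  ext s : 1
  rcases s with ⟨e, b⟩ | b
  · simp [letterOn]
  · rfl

theorem letterOn_insert {X : Finset E} {e : E} {s : Side E B} {b : Bool}
    (h : s ≠ Sum.inl (e, b)) (h' : s ≠ Sum.inl (e, !b)) :
    S.letterOn (insert e X) s = S.letterOn X s := by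
  rcases s with ⟨e', b'⟩ | b'
  · have : e' ≠ e := by
      rintro rfl
      cases b <;> cases b' <;> simp_all
    simp [letterOn, this]
  · rfl

theorem letterOn_isPath (X : Finset E) (s : Side E B) :
    (S.letterOn X s).IsPath S.boundaryOne
      (faceIncl F (S.face s)) (faceIncl F (S.face (S.turn X s))) := by
  have h : S.face (S.turn X s) = S.face (oppOn X s) := S.face_next _
  rw [h]
  rcases s with ⟨e, b⟩ | b
  · by_cases he : e ∈ X
    · rw [S.letterOn_inl_of_mem he, oppOn_inl, if_pos he]
      exact S.letter_isPath _
    · rw [S.letterOn_inl_of_notMem he, oppOn_inl, if_neg he]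
      exact PathElt.isPath_one
  · exact PathElt.isPath_one

theorem sideChain_apply_of_ne {e e' : E} (h : e' ≠ e) (b : Bool) (v : Fin 3 → ℂ) :
    S.sideChain (Sum.inl (e, b)) v e' = 0 := by
  cases b <;> simp [sideChain, Pi.single_eq_of_ne h]

theorem letterOn_mem_supported {X : Finset E} {e : E} (he : e ∉ X) (s : Side E B) :
    S.letterOn X s ∈
      PathElt.supported (LinearMap.proj e : (E → Fin 3 → ℂ) →ₗ[ℂ] (Fin 3 → ℂ)) := by
  rcases s with ⟨e', b⟩ | b
  · by_cases he' : e' ∈ X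
    · rw [S.letterOn_inl_of_mem he']
      intro v
      exact S.sideChain_apply_of_ne (by rintro rfl; exact he he') b v
    · rw [S.letterOn_inl_of_notMem he']
      exact one_mem _
  · exact one_mem _

/-- The path crossing the sides of `l` with edges in `X`. -/
def word (X : Finset E) (l : List (Side E B)) : PathElt (E → Fin 3 → ℂ) :=
  (l.map (S.letterOn X)).prod

@[simp] theorem word_nil (X : Finset E) : S.word X [] = 1 := rfl
@[simp] theorem word_cons (X : Finset E) (s : Side E B) (l : List (Side E B)) :
    S.word X (s :: l) = S.letterOn X s * S.word X l := by simp [word]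
@[simp] theorem word_append (X : Finset E) (l l' : List (Side E B)) :
    S.word X (l ++ l') = S.word X l * S.word X l' := by simp [word]

theorem word_insert {X : Finset E} {e : E} {l : List (Side E B)} {b : Bool}
    (h : Sum.inl (e, b) ∉ l) (h' : Sum.inl (e, !b) ∉ l) : S.word (insert e X) l = S.word X l := by
  rw [word, word, List.map_congr_left]
  intro s hs
  exact S.letterOn_insert (b := b) (by rintro rfl; exact h hs) (by rintro rfl; exact h' hs)

theorem word_mem_supported {X : Finset E} {e : E} (he : e ∉ X) (l : List (Side E B)) :
    S.word X l ∈ PathElt.supported (LinearMap.proj e : (E → Fin 3 → ℂ) →ₗ[ℂ] (Fin 3 → ℂ)) := by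
  refine Subgroup.list_prod_mem _ fun x hx => ?_
  obtain ⟨s, -, rfl⟩ := List.mem_map.1 hx
  exact S.letterOn_mem_supported he s

/-- The closing side `z` is left arbitrary, independent of `s`, so that the induction can pass to
tails of a cycle. -/
theorem word_isPath {X : Finset E} {t z : Side E B} {v : List (Side E B)} :
    ∀ {u : List (Side E B)} {s : Side E B} {a : List (Side E B)}, u ++ t :: v = s :: a →
      (s :: a).map (S.turn X) = a ++ [z] →
      (S.word X u).IsPath S.boundaryOne (faceIncl F (S.face s)) (faceIncl F (S.face t))
  | [], s, a, h, _ => by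
    obtain ⟨rfl, -⟩ := List.cons.inj h
    exact PathElt.isPath_one
  | s' :: u, s, a, h, hz => by
    obtain ⟨rfl, h2⟩ := List.cons.inj h
    obtain ⟨s2, a2, rfl⟩ : ∃ s2 a2, a = s2 :: a2 := by
      cases a with
      | nil => simp at h2
      | cons s2 a2 => exact ⟨_, _, rfl⟩
    rw [List.map_cons, List.cons_append] at hz
    obtain ⟨h3, h4⟩ := List.cons.inj hz
    rw [word_cons]
    refine (S.letterOn_isPath X s').mul ?_
    rw [h3]
    exact word_isPath h2 h4

theorem word_append_isPath {X : Finset E} {s t : Side E B} {u v : List (Side E B)}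
    (h : IsCyc (S.turn X) (s :: u ++ t :: v)) :
    (S.word X (s :: u)).IsPath S.boundaryOne (faceIncl F (S.face s)) (faceIncl F (S.face t)) :=
  S.word_isPath (u := s :: u) rfl (isCyc_cons.1 h)

/-! ## A spanning tree of faces -/

/-- The edges chosen for the faces of `K` other than `f₀`. -/
def treeEdges (f₀ : F) (K : Finset F) (t : F → E) : Finset E := (K.erase f₀).image t

/-- The columns: `∂ (t f)` for the faces `f ≠ f₀` of `K`, and the standard ones otherwise. -/
def treeCol (f₀ : F) (K : Finset F) (t : F → E) (f : F) : (Fin 3 → ℂ) →ₗ[ℂ] (F → Fin 3 → ℂ) :=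
  if f ∈ K.erase f₀ then
    S.boundaryOne ∘ₗ LinearMap.single ℂ (fun _ : E => Fin 3 → ℂ) (t f)
  else faceIncl F f

/-- The edges `t f`, for `f ∈ K` other than `f₀`, form a spanning tree of the faces of `K`. -/
structure IsTreeOn (f₀ : F) (K : Finset F) (t : F → E) : Prop where
  root_mem : f₀ ∈ K
  injOn : Set.InjOn t (K.erase f₀ : Finset F)
  face_mem : ∀ e ∈ treeEdges f₀ K t, ∀ b, S.face (Sum.inl (e, b)) ∈ K
  exists_cyc : ∃ l, IsCyc (S.turn (treeEdges f₀ K t)) l ∧ l.Nodup ∧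
    (∀ s, s ∈ l ↔ S.face s ∈ K) ∧ S.word (treeEdges f₀ K t) l = 1
  det_sq : LinearMap.det (ofCols (S.treeCol f₀ K t)) ^ 2 = 1

theorem exists_isCyc_face (f : F) (s : Side E B) (hs : S.face s = f) :
    ∃ a, IsCyc S.next (s :: a) ∧ (s :: a).Nodup ∧ ∀ t, t ∈ s :: a ↔ S.face t = f := by
  obtain ⟨a, h1, h2⟩ := exists_isCyc_cons S.next s
  refine ⟨a, h1, h2, fun t => ⟨fun ht => ?_, fun ht => ?_⟩⟩
  · rw [← hs, S.face_eq_iff]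
    exact h1.sameCycle ht (by simp)
  · exact h1.mem_of_sameCycle (s := s) (by simp) ((S.face_eq_iff s t).1 (hs.trans ht.symm))

theorem isTreeOn_singleton (f₀ : F) (t : F → E) : S.IsTreeOn f₀ {f₀} t := by
  have hT : treeEdges f₀ {f₀} t = ∅ := by simp [treeEdges]
  refine ⟨by simp, by simp, by simp [hT], ?_, ?_⟩
  · obtain ⟨s, hs⟩ := S.face_surjective f₀
    obtain ⟨a, h1, h2, h3⟩ := S.exists_isCyc_face f₀ s hs
    refine ⟨s :: a, ?_, h2, fun t => by rw [h3]; simp, ?_⟩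
    · rw [hT, turn, oppOn_empty, mul_one]; exact h1
    · rw [hT, word, List.prod_eq_one]
      intro x hx
      obtain ⟨u, -, rfl⟩ := List.mem_map.1 hx
      rcases u with ⟨e, b⟩ | b
      · exact S.letterOn_inl_of_notMem (by simp) b
      · rfl
  · have : S.treeCol f₀ {f₀} t = fun f => LinearMap.single ℂ (fun _ : F => Fin 3 → ℂ) f := by
      ext f : 1
      simp [treeCol, faceIncl]
    rw [this, ofCols_id]
    simp

/-- Otherwise membership of the face in `K` would be preserved by `next` and `opp`, hence constant
by connectedness. -/
theorem exists_crossing_side {f₀ : F} {K : Finset F} (h0 : f₀ ∈ K) (hK : K ≠ Finset.univ) :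
    ∃ e b, S.face (Sum.inl (e, b)) ∈ K ∧ S.face (Sum.inl (e, !b)) ∉ K := by
  by_contra! hcon
  apply hK
  rw [Finset.eq_univ_iff_forall]
  have key : ∀ s, S.face s ∈ K ↔ S.face (opp E B s) ∈ K := by
    have h1 : ∀ s, S.face s ∈ K → S.face (opp E B s) ∈ K := by
      rintro (⟨e, b⟩ | b) h
      · exact hcon e b h
      · exact h
    exact fun s => ⟨h1 s, fun h => by simpa using h1 _ h⟩
  have h2 : ∀ s t, S.face s ∈ K ↔ S.face t ∈ K := by
    intro s t
    induction S.connected s t with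
    | rel x y h =>
      rcases h with rfl | rfl
      · rw [S.face_next]
      · exact key x
    | refl x => rfl
    | symm x y _ ih => exact ih.symm
    | trans x y z _ _ ih1 ih2 => exact ih1.trans ih2
  intro f
  obtain ⟨s, rfl⟩ := S.face_surjective f
  obtain ⟨s0, rfl⟩ := S.face_surjective f₀
  exact (h2 s0 s).1 h0

theorem det_neg_id_sq :
    LinearMap.det (-LinearMap.id : (Fin 3 → ℂ) →ₗ[ℂ] (Fin 3 → ℂ)) ^ 2 = 1 := by
  rw [sq, ← LinearMap.det_comp]
  simp

/-- Attaching a new polygon along one edge merges its boundary cycle with that of the disc built so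
far. The edge then occurs once in each direction and cancels in the boundary word. The new column is
block triangular over the old ones, because earlier tree edges do not touch the new face. -/
theorem IsTreeOn.extend {f₀ : F} {K : Finset F} {t : F → E} (h : S.IsTreeOn f₀ K t) {e : E}
    {b : Bool} (h1 : S.face (Sum.inl (e, b)) ∈ K) (h2 : S.face (Sum.inl (e, !b)) ∉ K) :
    S.IsTreeOn f₀ (insert (S.face (Sum.inl (e, !b))) K)
      (Function.update t (S.face (Sum.inl (e, !b))) e) := by
  set f := S.face (Sum.inl (e, !b)) with hf
  have hf0 : f ≠ f₀ := by rintro h'; exact h2 (h' ▸ h.root_mem)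
  have hfK : f ∉ K.erase f₀ := fun h' => h2 (Finset.mem_of_mem_erase h')
  have hK : (insert f K).erase f₀ = insert f (K.erase f₀) := Finset.erase_insert_of_ne hf0
  have hupd : ∀ g ∈ K.erase f₀, Function.update t f e g = t g := fun g hg =>
    Function.update_of_ne (by rintro rfl; exact hfK hg) _ _
  have hT : treeEdges f₀ (insert f K) (Function.update t f e) =
      insert e (treeEdges f₀ K t) := by
    rw [treeEdges, hK, Finset.image_insert, Function.update_self, treeEdges,
      Finset.image_congr hupd]
  have heT : e ∉ treeEdges f₀ K t := fun he => h2 (h.face_mem e he (!b))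
  refine ⟨Finset.mem_insert_of_mem h.root_mem, ?_, ?_, ?_, ?_⟩
  · rw [hK, Finset.coe_insert, Set.injOn_insert (Finset.mem_coe.not.2 hfK)]
    constructor
    · exact h.injOn.congr fun g hg => (hupd g hg).symm
    · rw [Function.update_self]
      rintro ⟨g, hg, hge⟩
      rw [hupd g hg] at hge
      exact heT (Finset.mem_image.2 ⟨g, hg, hge⟩)
  · rw [hT]
    intro e' he' b'
    rw [Finset.mem_insert] at he' ⊢
    rcases he' with rfl | he'
    · by_cases hb : b' = b
      · subst hb; exact .inr h1
      · have : b' = !b := by cases b <;> cases b' <;> simp_all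
        subst this; exact .inl rfl
    · exact .inr (h.face_mem e' he' b')
  · rw [hT, S.turn_insert heT b]
    obtain ⟨l, hl, hn, hmem, hw⟩ := h.exists_cyc
    obtain ⟨u, v, rfl, hl'⟩ := hl.exists_cons ((hmem _).2 h1)
    obtain ⟨a2, g1, g2, g3⟩ := S.exists_isCyc_face f (Sum.inl (e, !b)) rfl
    have hdis : ∀ x ∈ u ++ Sum.inl (e, b) :: v, x ∉ Sum.inl (e, !b) :: a2 := by
      intro x hx hx'
      rw [hmem] at hx
      rw [g3] at hx'
      exact h2 (hx' ▸ hx)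
    have hfe : ∀ e' b', S.face (Sum.inl (e', b')) = f → e' ∉ treeEdges f₀ K t :=
      fun e' b' h' he' => h2 (h' ▸ h.face_mem e' he' b')
    have g1' : IsCyc (S.turn (treeEdges f₀ K t)) (Sum.inl (e, !b) :: a2) := by
      refine ⟨g1.1, ?_⟩
      rw [← g1.2]
      refine List.map_congr_left fun x hx => ?_
      rw [g3] at hx
      rw [turn, Equiv.Perm.mul_apply]
      rcases x with ⟨e', b'⟩ | b'
      · rw [oppOn_inl, if_neg (hfe e' b' hx)]
      · rfl
    have hw2 : S.word (treeEdges f₀ K t) a2 = 1 := by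
      rw [word, List.prod_eq_one]
      intro x hx
      obtain ⟨y, hy, rfl⟩ := List.mem_map.1 hx
      have := (g3 y).1 (List.mem_cons_of_mem _ hy)
      rcases y with ⟨e', b'⟩ | b'
      · exact S.letterOn_inl_of_notMem (hfe e' b' this) b'
      · rfl
    have hperm : (Sum.inl (e, b) :: v ++ u).Perm (u ++ Sum.inl (e, b) :: v) :=
      List.perm_append_comm
    have hn' : (Sum.inl (e, b) :: (v ++ u)).Nodup := hperm.nodup_iff.2 hn
    have hnn : ((Sum.inl (e, b) :: (v ++ u)) ++ Sum.inl (e, !b) :: a2).Nodup := by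
      rw [List.nodup_append]
      refine ⟨hn', g2, fun x hx y hy hxy => ?_⟩
      subst hxy
      exact hdis x (hperm.mem_iff.1 hx) hy
    have hmerge := hl'.merge g1' hnn
    refine ⟨_, hmerge, ?_, ?_, ?_⟩
    · exact (perm_exchange_tails _ _ _ _).nodup_iff.1 hnn
    · intro s
      have e1 : s ∈ Sum.inl (e, b) :: a2 ++ Sum.inl (e, !b) :: (v ++ u) ↔
          s ∈ u ++ Sum.inl (e, b) :: v ∨ s ∈ Sum.inl (e, !b) :: a2 := by
        simp only [List.mem_append, List.mem_cons]; tauto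
      change s ∈ Sum.inl (e, b) :: a2 ++ Sum.inl (e, !b) :: (v ++ u) ↔ _
      rw [e1, hmem, g3, Finset.mem_insert]
      tauto
    · have hx1 : Sum.inl (e, b) ∉ v ++ u := by
        have := List.nodup_cons.1 hn'; exact this.1
      have hx2 : Sum.inl (e, !b) ∉ v ++ u := by
        intro hx
        refine hdis (Sum.inl (e, !b)) ?_ (by simp)
        simp at hx ⊢; tauto
      have hy1 : Sum.inl (e, b) ∉ a2 := fun hx =>
        hdis (Sum.inl (e, b)) (by simp) (List.mem_cons_of_mem _ hx)
      have hy2 : Sum.inl (e, !b) ∉ a2 := (List.nodup_cons.1 g2).1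
      -- The side at which the cycle is cut open has a trivial letter, its edge not being glued yet,
      -- and a cyclic rotation of a trivial word is trivial.
      have hw3 : S.word (treeEdges f₀ K t) (v ++ u) = 1 := by
        rw [word_append, word_cons, S.letterOn_inl_of_notMem heT, one_mul] at hw
        rw [word_append]
        exact mul_eq_one_comm.1 hw
      change S.word (insert e _) (Sum.inl (e, b) :: a2 ++ Sum.inl (e, !b) :: (v ++ u)) = 1
      rw [S.word_append, S.word_cons, S.word_cons, S.word_insert hx1 hx2, S.word_insert hy1 hy2,
        hw2, hw3, S.letterOn_inl_of_mem (Finset.mem_insert_self _ _),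
        S.letterOn_inl_of_mem (Finset.mem_insert_self _ _), ← opp_inl (B := B), S.letter_opp]
      simp
  · have hcol : S.treeCol f₀ (insert f K) (Function.update t f e) =
        Function.update (S.treeCol f₀ K t) f
          (S.boundaryOne ∘ₗ LinearMap.single ℂ (fun _ : E => Fin 3 → ℂ) e) := by
      ext g : 1
      by_cases hg : g = f
      · subst hg
        rw [Function.update_self, treeCol, hK, if_pos (Finset.mem_insert_self _ _),
          Function.update_self]
      · rw [Function.update_of_ne hg, treeCol, hK, treeCol]
        by_cases hg' : g ∈ K.erase f₀
        · rw [if_pos (Finset.mem_insert_of_mem hg'), if_pos hg', hupd g hg']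
        · rw [if_neg (by rw [Finset.mem_insert]; tauto), if_neg hg']
    rw [hcol, det_ofCols_update, mul_pow, h.det_sq, mul_one]
    -- The diagonal block is minus the identity or a holonomy, according to whether the new face is
    -- the start or the end of the edge; both have determinant of square one.
    · cases b
      · have : (LinearMap.proj f : (F → Fin 3 → ℂ) →ₗ[ℂ] _) ∘ₗ
            (S.boundaryOne ∘ₗ LinearMap.single ℂ (fun _ : E => Fin 3 → ℂ) e) = -LinearMap.id := by
          refine LinearMap.ext fun v => ?_
          have hne : S.face (Sum.inl (e, true)) ≠ S.face (Sum.inl (e, false)) :=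
            fun h' => h2 (h' ▸ h1 : S.face (Sum.inl (e, true)) ∈ K)
          simp only [LinearMap.comp_apply, S.boundaryOne_single]
          simp [faceIncl, Pi.single_eq_of_ne hne, hf]
        rw [this, det_neg_id_sq]
      · have : (LinearMap.proj f : (F → Fin 3 → ℂ) →ₗ[ℂ] _) ∘ₗ
            (S.boundaryOne ∘ₗ LinearMap.single ℂ (fun _ : E => Fin 3 → ℂ) e) = adT (S.glue e) := by
          refine LinearMap.ext fun v => ?_
          have hne : S.face (Sum.inl (e, false)) ≠ S.face (Sum.inl (e, true)) :=
            fun h' => h2 (h' ▸ h1 : S.face (Sum.inl (e, false)) ∈ K)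
          simp only [LinearMap.comp_apply, S.boundaryOne_single]
          simp [faceIncl, Pi.single_eq_of_ne hne, hf]
        rw [this, det_adT, one_pow]
    · rw [treeCol, if_neg hfK]; rfl
    · intro j hj v
      rw [treeCol]
      by_cases hjK : j ∈ K.erase f₀
      · rw [if_pos hjK, LinearMap.comp_apply, S.boundaryOne_single]
        have hm : t j ∈ treeEdges f₀ K t := Finset.mem_image_of_mem _ hjK
        have n1 : f ≠ S.face (Sum.inl (t j, false)) := fun h' => h2 (h' ▸ h.face_mem _ hm _)
        have n2 : f ≠ S.face (Sum.inl (t j, true)) := fun h' => h2 (h' ▸ h.face_mem _ hm _)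
        simp [faceIncl, Pi.single_eq_of_ne n1, Pi.single_eq_of_ne n2]
      · rw [if_neg hjK]
        simp [faceIncl, Pi.single_eq_of_ne (Ne.symm hj)]

theorem exists_isTreeOn_univ (f₀ : F) (t₀ : F → E) : ∃ t, S.IsTreeOn f₀ Finset.univ t := by
  have key : ∀ n, n + 1 ≤ Fintype.card F → ∃ K t, S.IsTreeOn f₀ K t ∧ K.card = n + 1 := by
    intro n
    induction n with
    | zero => exact fun _ => ⟨{f₀}, t₀, S.isTreeOn_singleton f₀ t₀, by simp⟩
    | succ n ih =>
      intro hn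
      obtain ⟨K, t, h, hK⟩ := ih (by omega)
      obtain ⟨e, b, h1, h2⟩ := S.exists_crossing_side h.root_mem (by
        rintro rfl
        rw [Finset.card_univ] at hK
        omega)
      exact ⟨_, _, h.extend S h1 h2, by rw [Finset.card_insert_of_notMem h2, hK]⟩
  have hpos : 0 < Fintype.card F := Fintype.card_pos_iff.2 ⟨f₀⟩
  obtain ⟨K, t, h, hK⟩ := key (Fintype.card F - 1) (by omega)
  have : K = Finset.univ := Finset.eq_univ_of_card K (by omega)
  subst this
  exact ⟨t, h⟩

end HyperbolicSurface

end PairOfPants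

end

noncomputable section

namespace PairOfPants

namespace HyperbolicSurface

open scoped Classical

variable {F E B R : Type} [Fintype F] [Fintype E] [Fintype B] [Fintype R]
  (S : HyperbolicSurface F E B R)

/-! ## The relation between the loops around the circuits -/

/-- A circuit of a partially glued surface, with a path `base` leading to its first side
and a label. -/
structure Piece (E B : Type) where
  lab : Option E
  sides : List (Side E B)
  base : PathElt (E → Fin 3 → ℂ)

/-- The loop around a circuit, as a loop based at the common base point. -/
def pieceLoop (X : Finset E) (x : Piece E B) : PathElt (E → Fin 3 → ℂ) :=
  x.base * S.word X x.sides * x.base⁻¹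

/-- The surface with the edges of `X ⊇ T` glued is a sphere with holes, whose circuits are listed
in `L`; the product of the corresponding loops is trivial. The labels of the circuits other than
the one through `b₀` are the edges in `X` outside the spanning tree `T`, and replacing the standard
columns of these edges by the chains of the corresponding loops gives a unimodular matrix. -/
structure IsCut (f₀ : F) (T X : Finset E) (b₀ : Side E B) (L : List (Piece E B))
    (col : E → (Fin 3 → ℂ) →ₗ[ℂ] (E → Fin 3 → ℂ)) : Prop where
  sub : T ⊆ X
  decomp : IsDecomp (S.turn X) (L.map Piece.sides)
  labels_nodup : (L.map Piece.lab).Nodup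
  labels : ∀ o, o ∈ L.map Piece.lab ↔ ∀ e, o = some e → e ∈ X ∧ e ∉ T
  prod : (L.map (S.pieceLoop X)).prod = 1
  supp : ∀ x ∈ L, ∀ e ∉ X, x.base ∈
    PathElt.supported (LinearMap.proj e : (E → Fin 3 → ℂ) →ₗ[ℂ] (Fin 3 → ℂ))
  path : ∀ x ∈ L, ∀ s a, x.sides = s :: a →
    x.base.IsPath S.boundaryOne (faceIncl F f₀) (faceIncl F (S.face s))
  root : ∀ x ∈ L, x.lab = none → b₀ ∈ x.sides
  col_std : ∀ e, (e ∈ X → e ∈ T) → col e = LinearMap.single ℂ (fun _ : E => Fin 3 → ℂ) e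
  col_lab : ∀ x ∈ L, ∀ e, x.lab = some e → col e = (S.pieceLoop X x).chain
  det_sq : LinearMap.det (ofCols col) ^ 2 = 1

variable {S} {f₀ : F} {T X : Finset E} {b₀ : Side E B}
  {col : E → (Fin 3 → ℂ) →ₗ[ℂ] (E → Fin 3 → ℂ)}

theorem pieceLoop_rotate (o : Option E) (u v : List (Side E B)) (h : PathElt (E → Fin 3 → ℂ)) :
    S.pieceLoop X ⟨o, v ++ u, h * S.word X u⟩ = S.pieceLoop X ⟨o, u ++ v, h⟩ := by
  simp only [pieceLoop, word_append]
  group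

theorem path_rotate {x : Piece E B} {s : Side E B} {u v : List (Side E B)}
    (hx : x.sides = u ++ s :: v) (hc : IsCyc (S.turn X) x.sides)
    (hp : ∀ s a, x.sides = s :: a →
      x.base.IsPath S.boundaryOne (faceIncl F f₀) (faceIncl F (S.face s))) :
    (x.base * S.word X u).IsPath S.boundaryOne (faceIncl F f₀) (faceIncl F (S.face s)) := by
  cases u with
  | nil => simpa using hp s v hx
  | cons z u =>
    refine (hp z _ hx).mul (S.word_append_isPath (v := v) ?_)
    rw [← hx]; exact hc

theorem IsCut.rotate {pre post : List (Piece E B)} {o : Option E} {u v : List (Side E B)}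
    {s : Side E B} {h : PathElt (E → Fin 3 → ℂ)}
    (hL : S.IsCut f₀ T X b₀ (pre ++ ⟨o, u ++ s :: v, h⟩ :: post) col) :
    S.IsCut f₀ T X b₀ (pre ++ ⟨o, s :: v ++ u, h * S.word X u⟩ :: post) col := by
  have hmem : ∀ x, x ∈ pre ++ (⟨o, s :: v ++ u, h * S.word X u⟩ : Piece E B) :: post ↔
      x = ⟨o, s :: v ++ u, h * S.word X u⟩ ∨ (x ∈ pre ∨ x ∈ post) := by
    intro x; simp only [List.mem_append, List.mem_cons]; tauto
  have hold : ∀ x, x ∈ pre ∨ x ∈ post → x ∈ pre ++ (⟨o, u ++ s :: v, h⟩ : Piece E B) :: post := by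
    intro x; simp only [List.mem_append, List.mem_cons]; tauto
  have h0 : (⟨o, u ++ s :: v, h⟩ : Piece E B) ∈ pre ++ ⟨o, u ++ s :: v, h⟩ :: post := by simp
  refine ⟨hL.sub, ?_, by simpa using hL.labels_nodup, by simpa using hL.labels, ?_, ?_, ?_, ?_,
    hL.col_std, ?_, hL.det_sq⟩
  · have := hL.decomp
    rw [List.map_append, List.map_cons] at this ⊢
    exact this.rotate
  · have := hL.prod
    rw [List.map_append, List.map_cons] at this ⊢
    rwa [pieceLoop_rotate]
  · intro x hx e he
    rcases (hmem x).1 hx with rfl | hx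
    · exact mul_mem (hL.supp _ h0 e he) (S.word_mem_supported he u)
    · exact hL.supp x (hold x hx) e he
  · intro x hx s' a hsa
    rcases (hmem x).1 hx with rfl | hx
    · obtain ⟨rfl, -⟩ := List.cons.inj hsa
      exact path_rotate (x := ⟨o, u ++ s :: v, h⟩) rfl
        (hL.decomp.isCyc _ (List.mem_map_of_mem h0)) (hL.path _ h0)
    · exact hL.path x (hold x hx) s' a hsa
  · intro x hx hn
    rcases (hmem x).1 hx with rfl | hx
    · have := hL.root _ h0 hn
      simp at this ⊢; tauto
    · exact hL.root x (hold x hx) hn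
  · intro x hx e he
    rcases (hmem x).1 hx with rfl | hx
    · rw [pieceLoop_rotate]
      exact hL.col_lab _ h0 e he
    · exact hL.col_lab x (hold x hx) e he

theorem IsCut.length {L : List (Piece E B)} (hL : S.IsCut f₀ T X b₀ L col) :
    L.length = (X \ T).card + 1 := by
  have h1 : (L.map Piece.lab).toFinset = insert none ((X \ T).image some) := by
    ext o
    rw [List.mem_toFinset, hL.labels]
    rcases o with _ | e <;> simp
  have h2 := congrArg Finset.card h1
  rw [List.toFinset_card_of_nodup hL.labels_nodup, List.length_map,
    Finset.card_insert_of_notMem (by simp),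
    Finset.card_image_of_injective _ (Option.some_injective E)] at h2
  exact h2

/-- Different circuits have base sides in different cycles. -/
theorem card_circuits_le {LL : List (List (Side E B))} (h : IsDecomp (S.next * opp E B) LL) :
    Fintype.card R + 3 ≤ LL.length := by
  have h1 : ∀ c, ∃ i : Fin LL.length, S.base c ∈ LL[i] := by
    intro c
    obtain ⟨l, hl, hc⟩ := List.mem_flatten.1 (h.mem (S.base c))
    obtain ⟨i, hi, rfl⟩ := List.mem_iff_getElem.1 hl
    exact ⟨⟨i, hi⟩, hc⟩
  choose i hi using h1
  have hinj : Function.Injective i := by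
    intro c c' hcc
    have := (h.isCyc _ (List.getElem_mem (i c).2)).sameCycle (hi c)
      (t := S.base c') (by have := hi c'; rw [← hcc] at this; exact this)
    rw [← S.circuit_eq_iff, S.circuit_base, S.circuit_base] at this
    exact this
  have := Fintype.card_le_of_injective i hinj
  simpa using this

/-- Each edge still to be glued adds at most one cycle, and the final number of cycles is known from
below. -/
theorem card_circuits_le_of_decomp {X : Finset E} {LL : List (List (Side E B))}
    (h : IsDecomp (S.turn X) LL) : Fintype.card R + 3 ≤ LL.length + Xᶜ.card := by
  induction hn : Xᶜ.card generalizing X LL with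
  | zero =>
    have : X = Finset.univ := by
      rw [Finset.card_eq_zero, Finset.compl_eq_empty_iff] at hn; exact hn
    subst this
    rw [turn, oppOn_univ] at h
    exact card_circuits_le h
  | succ n ih =>
    obtain ⟨e, he⟩ : ∃ e, e ∈ Xᶜ := Finset.card_pos.1 (by omega)
    rw [Finset.mem_compl] at he
    obtain ⟨LL', h1, h2⟩ := h.exists_mul_swap
      (s := (Sum.inl (e, true) : Side E B)) (s' := Sum.inl (e, !true)) (by simp)
    rw [← S.turn_insert he] at h1
    have := ih h1 (by
      rw [Finset.compl_insert, Finset.card_erase_of_mem (Finset.mem_compl.2 he), hn]; rfl)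
    omega

/-- The loop crosses the edge `e` exactly once, so the `e`-coordinate of its chain is a holonomy up
to sign. -/
theorem det_proj_loop_sq {e : E} {b : Bool} {h w : PathElt (E → Fin 3 → ℂ)}
    (hh : h ∈ PathElt.supported (LinearMap.proj e : (E → Fin 3 → ℂ) →ₗ[ℂ] (Fin 3 → ℂ)))
    (hw : w ∈ PathElt.supported (LinearMap.proj e : (E → Fin 3 → ℂ) →ₗ[ℂ] (Fin 3 → ℂ))) :
    LinearMap.det ((LinearMap.proj e : (E → Fin 3 → ℂ) →ₗ[ℂ] (Fin 3 → ℂ)) ∘ₗ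
      (h * (S.letter (Sum.inl (e, b)) * w) * h⁻¹).chain) ^ 2 = 1 := by
  have h1 : ∀ v, (h * (S.letter (Sum.inl (e, b)) * w) * h⁻¹).chain v e =
      S.sideChain (Sum.inl (e, b)) (adT h.hol v) e := by
    intro v
    have a1 := PathElt.mem_supported.1 hh v
    have a2 := PathElt.mem_supported.1 hw
    have a3 := PathElt.mem_supported.1 (inv_mem hh)
    simp only [LinearMap.proj_apply] at a1 a2 a3
    simp only [PathElt.chain_mul_apply, Pi.add_apply, a1, a2, a3, letter_chain, zero_add, add_zero]
  cases b
  · have : (LinearMap.proj e : (E → Fin 3 → ℂ) →ₗ[ℂ] (Fin 3 → ℂ)) ∘ₗ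
        (h * (S.letter (Sum.inl (e, false)) * w) * h⁻¹).chain =
        (-LinearMap.id) ∘ₗ adT (S.glue e)⁻¹ ∘ₗ adT h.hol := by
      refine LinearMap.ext fun v => ?_
      rw [LinearMap.comp_apply, LinearMap.proj_apply, h1]
      simp [sideChain]
    rw [this, LinearMap.det_comp, LinearMap.det_comp, det_adT, det_adT, mul_one, mul_one,
      det_neg_id_sq]
  · have : (LinearMap.proj e : (E → Fin 3 → ℂ) →ₗ[ℂ] (Fin 3 → ℂ)) ∘ₗ
        (h * (S.letter (Sum.inl (e, true)) * w) * h⁻¹).chain = adT h.hol := by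
      refine LinearMap.ext fun v => ?_
      rw [LinearMap.comp_apply, LinearMap.proj_apply, h1]
      simp [sideChain]
    rw [this, det_adT, one_pow]

theorem IsCut.row_eq_zero {L : List (Piece E B)} (hL : S.IsCut f₀ T X b₀ L col) {e : E}
    (he : e ∉ X) (j : E) (hj : j ≠ e) (v : Fin 3 → ℂ) : col j v e = 0 := by
  by_cases hjX : j ∈ X ∧ j ∉ T
  · obtain ⟨x, hx, hxj⟩ := List.mem_map.1 ((hL.labels (some j)).2 (by
      rintro e' h'; rw [← Option.some.inj h']; exact hjX))
    rw [hL.col_lab x hx j hxj]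
    have : S.pieceLoop X x ∈
        PathElt.supported (LinearMap.proj e : (E → Fin 3 → ℂ) →ₗ[ℂ] (Fin 3 → ℂ)) :=
      mul_mem (mul_mem (hL.supp x hx e he) (S.word_mem_supported he _))
        (inv_mem (hL.supp x hx e he))
    exact PathElt.mem_supported.1 this v
  · rw [hL.col_std j (by tauto)]
    simp [Pi.single_eq_of_ne (Ne.symm hj)]

/-- The loop around the old circuit factors as the product of the loops around the two new ones, so
the product relation persists. One piece inherits the old label and the other is labelled by the new
edge; `hb` makes the unlabelled piece keep the marked side `b₀`. -/
theorem IsCut.split {pre post : List (Piece E B)} {o : Option E} {a a' : List (Side E B)}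
    {e : E} {b : Bool} {h : PathElt (E → Fin 3 → ℂ)}
    (hL : S.IsCut f₀ T X b₀
      (pre ++ ⟨o, Sum.inl (e, b) :: a ++ Sum.inl (e, !b) :: a', h⟩ :: post) col) (he : e ∉ X)
    (hb : o = none → b₀ ∈ Sum.inl (e, !b) :: a) :
    ∃ L' col', S.IsCut f₀ T (insert e X) b₀ L' col' := by
  set x₀ : Piece E B := ⟨o, Sum.inl (e, b) :: a ++ Sum.inl (e, !b) :: a', h⟩ with hx₀
  -- The path to the first side of this piece continues across the new edge, as its first side lies
  -- in the polygon on the far side.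
  set x₁ : Piece E B := ⟨o, Sum.inl (e, !b) :: a, h * S.letter (Sum.inl (e, b))⟩ with hx₁
  set x₂ : Piece E B := ⟨some e, Sum.inl (e, b) :: a', h⟩ with hx₂
  have hmem : ∀ x, x ∈ pre ++ x₁ :: x₂ :: post ↔ x = x₁ ∨ x = x₂ ∨ (x ∈ pre ∨ x ∈ post) := by
    intro x; simp only [List.mem_append, List.mem_cons]; tauto
  have hold : ∀ x, x ∈ pre ∨ x ∈ post → x ∈ pre ++ x₀ :: post := by
    intro x; simp only [List.mem_append, List.mem_cons]; tauto
  have h0 : x₀ ∈ pre ++ x₀ :: post := by simp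
  -- where the two sides of the new edge occur
  have hn := hL.decomp.nodup
  simp only [List.map_append, List.map_cons, List.flatten_append, List.flatten_cons] at hn
  have hn0 : x₀.sides.Nodup := (List.nodup_append.1 (List.nodup_append.1 hn).2.1).1
  have hdis : ∀ x, x ∈ pre ∨ x ∈ post → Sum.inl (e, b) ∉ x.sides ∧ Sum.inl (e, !b) ∉ x.sides := by
    intro x hx
    have h1 : ∀ y ∈ x₀.sides, y ∉ x.sides := by
      intro y hy hyx
      rcases hx with hx | hx
      · exact (List.nodup_append.1 hn).2.2 y
          (List.mem_flatten.2 ⟨_, List.mem_map_of_mem hx, hyx⟩) y (List.mem_append_left _ hy) rfl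
      · exact (List.nodup_append.1 (List.nodup_append.1 hn).2.1).2.2 y hy y
          (List.mem_flatten.2 ⟨_, List.mem_map_of_mem hx, hyx⟩) rfl
    exact ⟨h1 _ (by simp [hx₀]), h1 _ (by simp [hx₀])⟩
  have hsa : Sum.inl (e, b) ∉ a ∧ Sum.inl (e, b) ∉ a' ∧
      Sum.inl (e, !b) ∉ a ∧ Sum.inl (e, !b) ∉ a' := by
    simp [hx₀, List.nodup_cons, List.nodup_append] at hn0
    grind
  -- the loops
  have hwa := S.word_insert (X := X) hsa.1 hsa.2.2.1
  have hwa' := S.word_insert (X := X) hsa.2.1 hsa.2.2.2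
  have hl : S.letter (Sum.inl (e, !b)) = (S.letter (Sum.inl (e, b)))⁻¹ := by
    rw [← opp_inl, S.letter_opp]
  have hc0 : S.pieceLoop X x₀ = h * (S.word X a * S.word X a') * h⁻¹ := by
    simp [pieceLoop, hx₀, S.letterOn_inl_of_notMem he]
  have hc1 : S.pieceLoop (insert e X) x₁ =
      h * S.word X a * (S.letter (Sum.inl (e, b)))⁻¹ * h⁻¹ := by
    simp only [pieceLoop, hx₁, word_cons, S.letterOn_inl_of_mem (Finset.mem_insert_self e X),
      hwa, hl]
    group
  have hc2 : S.pieceLoop (insert e X) x₂ =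
      h * (S.letter (Sum.inl (e, b)) * S.word X a') * h⁻¹ := by
    simp only [pieceLoop, hx₂, word_cons, S.letterOn_inl_of_mem (Finset.mem_insert_self e X),
      hwa']
  have hc12 : S.pieceLoop (insert e X) x₁ * S.pieceLoop (insert e X) x₂ = S.pieceLoop X x₀ := by
    rw [hc0, hc1, hc2]; group
  have hc : ∀ x, x ∈ pre ∨ x ∈ post → S.pieceLoop (insert e X) x = S.pieceLoop X x := by
    intro x hx
    rw [pieceLoop, S.word_insert (hdis x hx).1 (hdis x hx).2, pieceLoop]
  -- the labels
  have hlab : ∀ x ∈ pre ++ x₀ :: post, x.lab ≠ some e := by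
    intro x hx hxe
    exact he ((hL.labels (some e)).1 (hxe ▸ List.mem_map_of_mem hx) e rfl).1
  have hln := hL.labels_nodup
  simp only [List.map_append, List.map_cons] at hln
  have hlo : ∀ x, x ∈ pre ∨ x ∈ post → x.lab ≠ o := by
    intro x hx hxo
    rcases hx with hx | hx
    · exact (List.nodup_append.1 hln).2.2 o (hxo ▸ List.mem_map_of_mem hx) o (by simp [hx₀]) rfl
    · exact (List.nodup_cons.1 (List.nodup_append.1 hln).2.1).1
        (by simp only [hx₀]; exact hxo ▸ List.mem_map_of_mem hx)
  -- the columns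
  obtain ⟨col', hstd, hlab1, hlab2, hdet⟩ : ∃ col' : E → (Fin 3 → ℂ) →ₗ[ℂ] (E → Fin 3 → ℂ),
      (∀ e', e' ≠ e → o ≠ some e' → col' e' = col e') ∧
      col' e = (S.pieceLoop (insert e X) x₂).chain ∧
      (∀ e₁, o = some e₁ → col' e₁ = (S.pieceLoop (insert e X) x₁).chain) ∧
      LinearMap.det (ofCols col') ^ 2 = 1 := by
    have hcole : col e = LinearMap.single ℂ (fun _ : E => Fin 3 → ℂ) e :=
      hL.col_std e (fun h' => absurd h' he)
    -- The new loop replaces the standard column of `e`. No other column meets row `e`, since none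
    -- of the earlier loops crosses this edge.
    have hd1 : LinearMap.det (ofCols (Function.update col e
        (S.pieceLoop (insert e X) x₂).chain)) ^ 2 = 1 := by
      rw [det_ofCols_update col e _ hcole (hL.row_eq_zero he), mul_pow, hL.det_sq, mul_one, hc2]
      exact det_proj_loop_sq (hL.supp x₀ h0 e he) (S.word_mem_supported he a')
    rcases ho : o with _ | e₁
    · exact ⟨_, fun e' h1 _ => Function.update_of_ne h1 _ _, Function.update_self _ _ _,
        fun e₁ h' => by simp at h', hd1⟩
    · have hne : e ≠ e₁ := by
        rintro rfl
        exact hlab x₀ h0 ho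
      refine ⟨Function.update (Function.update col e (S.pieceLoop (insert e X) x₂).chain) e₁
        (S.pieceLoop (insert e X) x₁).chain, ?_, ?_, ?_, ?_⟩
      · intro e' h1 h2
        rw [Function.update_of_ne (by rintro rfl; exact h2 rfl), Function.update_of_ne h1]
      · rw [Function.update_of_ne hne, Function.update_self]
      · intro e' h'
        obtain rfl := Option.some.inj h'
        rw [Function.update_self]
      -- The inherited column changes from the loop of `x₀` to that of `x₀ x₂⁻¹`. On chains this
      -- adds a multiple of the column just installed at `e`, an elementary operation.
      · have h1 : S.pieceLoop (insert e X) x₁ =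
            S.pieceLoop X x₀ * (S.pieceLoop (insert e X) x₂)⁻¹ := by rw [← hc12]; group
        have h2 : (S.pieceLoop (insert e X) x₁).chain =
            Function.update col e (S.pieceLoop (insert e X) x₂).chain e₁ +
            Function.update col e (S.pieceLoop (insert e X) x₂).chain e ∘ₗ
              (-(adT (S.pieceLoop (insert e X) x₂).hol⁻¹ ∘ₗ adT (S.pieceLoop X x₀).hol)) := by
          rw [Function.update_self, Function.update_of_ne (Ne.symm hne),
            hL.col_lab x₀ h0 e₁ ho, h1, PathElt.chain_mul, PathElt.chain_inv]
          refine LinearMap.ext fun v => ?_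
          simp
        rw [h2, det_ofCols_update_add _ hne, hd1]
  refine ⟨pre ++ x₁ :: x₂ :: post, col', ?_⟩
  refine ⟨hL.sub.trans (Finset.subset_insert _ _), ?_, ?_, ?_, ?_, ?_, ?_, ?_, ?_, ?_, hdet⟩
  · have := hL.decomp
    rw [List.map_append, List.map_cons] at this
    have h2 := IsDecomp.split this
    rw [← S.turn_insert he] at h2
    simpa [hx₁, hx₂] using h2
  · have h1 : (pre ++ x₁ :: x₂ :: post).map Piece.lab =
        pre.map Piece.lab ++ o :: some e :: post.map Piece.lab := by simp [hx₁, hx₂]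
    have h2 : (pre.map Piece.lab ++ o :: some e :: post.map Piece.lab).Perm
        (some e :: (pre.map Piece.lab ++ o :: post.map Piece.lab)) := by
      refine List.Perm.trans (List.Perm.append_left _ (List.Perm.swap _ _ _)) ?_
      exact List.perm_middle
    rw [h1, h2.nodup_iff, List.nodup_cons]
    refine ⟨?_, hln⟩
    intro h3
    have h4 : some e ∈ (pre ++ x₀ :: post).map Piece.lab := by simpa [hx₀] using h3
    obtain ⟨x, hx, hxe⟩ := List.mem_map.1 h4
    exact hlab x hx hxe
  · intro o'
    have h1 : o' ∈ (pre ++ x₁ :: x₂ :: post).map Piece.lab ↔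
        o' = some e ∨ o' ∈ (pre ++ x₀ :: post).map Piece.lab := by
      simp only [List.map_append, List.map_cons, List.mem_append, List.mem_cons, hx₀, hx₁, hx₂]
      tauto
    rw [h1, hL.labels]
    have heT : e ∉ T := fun h' => he (hL.sub h')
    constructor
    · rintro (rfl | h2) e' h'
      · obtain rfl := Option.some.inj h'
        exact ⟨Finset.mem_insert_self _ _, heT⟩
      · exact ⟨Finset.mem_insert_of_mem (h2 e' h').1, (h2 e' h').2⟩
    · intro h2
      by_cases h3 : o' = some e
      · exact .inl h3
      · refine .inr fun e' h' => ⟨?_, (h2 e' h').2⟩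
        rcases Finset.mem_insert.1 (h2 e' h').1 with rfl | h4
        · exact absurd h' h3
        · exact h4
  · have h1 := hL.prod
    rw [List.map_append, List.map_cons, List.prod_append, List.prod_cons] at h1
    rw [List.map_append, List.map_cons, List.map_cons, List.prod_append, List.prod_cons,
      List.prod_cons, ← mul_assoc (S.pieceLoop _ x₁), hc12,
      List.map_congr_left fun x hx => hc x (.inl hx),
      List.map_congr_left fun x hx => hc x (.inr hx), h1]
  · intro x hx e' he'
    have he'X : e' ∉ X := fun h' => he' (Finset.mem_insert_of_mem h')
    rcases (hmem x).1 hx with rfl | rfl | hx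
    · refine mul_mem (hL.supp x₀ h0 e' he'X) ?_
      rw [← S.letterOn_inl_of_mem (Finset.mem_insert_self e X)]
      exact S.letterOn_mem_supported he' _
    · exact hL.supp x₀ h0 e' he'X
    · exact hL.supp x (hold x hx) e' he'X
  · intro x hx s l hsl
    have hp := hL.path x₀ h0 (Sum.inl (e, b)) (a ++ Sum.inl (e, !b) :: a') rfl
    rcases (hmem x).1 hx with rfl | rfl | hx
    · obtain ⟨rfl, -⟩ := List.cons.inj hsl
      exact hp.mul (S.letter_isPath _)
    · obtain ⟨rfl, -⟩ := List.cons.inj hsl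
      exact hp
    · exact hL.path x (hold x hx) s l hsl
  · intro x hx hxn
    rcases (hmem x).1 hx with rfl | rfl | hx
    · exact hb hxn
    · simp [hx₂] at hxn
    · exact hL.root x (hold x hx) hxn
  · intro e' he'
    have h1 : e' ≠ e := by
      rintro rfl
      exact he (hL.sub (he' (Finset.mem_insert_self _ _)))
    have h2 : o ≠ some e' := by
      intro h2
      have := (hL.labels o).1 (List.mem_map_of_mem (f := Piece.lab) h0) e' h2
      exact this.2 (he' (Finset.mem_insert_of_mem this.1))
    rw [hstd e' h1 h2]
    exact hL.col_std e' fun h' => he' (Finset.mem_insert_of_mem h')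
  · intro x hx e' hxe'
    rcases (hmem x).1 hx with rfl | rfl | hx
    · exact hlab2 e' hxe'
    · obtain rfl := Option.some.inj hxe'
      exact hlab1
    · have h1 : e' ≠ e := fun h1 => hlab x (hold x hx) (h1 ▸ hxe')
      have h2 : o ≠ some e' := fun h2 => hlo x hx (hxe'.trans h2.symm)
      rw [hstd e' h1 h2, hc x hx]
      exact hL.col_lab x (hold x hx) e' hxe'

end HyperbolicSurface

end PairOfPants

end

noncomputable section

namespace PairOfPants

namespace HyperbolicSurface

open scoped Classical

variable {F E B R : Type} [Fintype F] [Fintype E] [Fintype B] [Fintype R]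
  (S : HyperbolicSurface F E B R)

variable {S} {f₀ : F} {T X : Finset E} {b₀ : Side E B}
  {col : E → (Fin 3 → ℂ) →ₗ[ℂ] (E → Fin 3 → ℂ)}

/-! ### Gluing the remaining edges, and the resulting presentation -/

/-- This is where genus zero enters: under `hcard`, a merge would leave two circuits too few, more
than the later edges can make up. -/
theorem IsCut.exists_insert {L : List (Piece E B)} (hL : S.IsCut f₀ T X b₀ L col) {e : E}
    (he : e ∉ X) (hcard : Fintype.card E + 1 = Fintype.card R + 3 + T.card) :
    ∃ L' col', S.IsCut f₀ T (insert e X) b₀ L' col' := by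
  have hex : ∃ x ∈ L, Sum.inl (e, true) ∈ x.sides ∧ Sum.inl (e, false) ∈ x.sides := by
    by_contra! hcon
    obtain ⟨LL, h1, h2⟩ := hL.decomp.exists_merge (s := (Sum.inl (e, true) : Side E B))
      (s' := Sum.inl (e, false)) (by
        intro l hl
        obtain ⟨x, hx, rfl⟩ := List.mem_map.1 hl
        exact fun h => hcon x hx h.1 h.2)
    have h3 : S.turn X * Equiv.swap (Sum.inl (e, true)) (Sum.inl (e, false)) =
        S.turn (insert e X) := (S.turn_insert he true).symm
    rw [h3] at h1
    have h4 := card_circuits_le_of_decomp h1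
    rw [List.length_map, hL.length, Finset.card_sdiff_of_subset hL.sub] at h2
    rw [Finset.card_compl, Finset.card_insert_of_notMem he] at h4
    have h5 := Finset.card_le_card hL.sub
    have h6 : (insert e X).card ≤ Fintype.card E := Finset.card_le_univ _
    rw [Finset.card_insert_of_notMem he] at h6
    omega
  obtain ⟨⟨o, l, h⟩, hx, hs, hs'⟩ := hex
  obtain ⟨pre, post, rfl⟩ := List.append_of_mem hx
  simp only at hs hs'
  obtain ⟨u, v, rfl⟩ := List.append_of_mem hs
  have hL2 := hL.rotate
  have hs2 : Sum.inl (e, false) ∈ v ++ u := by simp at hs' ⊢; tauto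
  obtain ⟨a, a', ha⟩ := List.append_of_mem hs2
  rw [List.cons_append, ha] at hL2
  -- If the marked side falls in the wrong half, start the circuit at the other side of the edge,
  -- which exchanges the two halves.
  by_cases hb : o = none → b₀ ∈ Sum.inl (e, false) :: a
  · exact hL2.split (b := true) he hb
  · push Not at hb
    have hL3 := IsCut.rotate (u := Sum.inl (e, true) :: a) (s := Sum.inl (e, false)) hL2
    refine hL3.split (b := false) he fun ho => ?_
    have := hL2.root _ (List.mem_append_right _ List.mem_cons_self) ho
    simp only [List.mem_cons, List.mem_append, not_or] at this hb ⊢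
    simp only [Bool.not_false]
    tauto

theorem IsCut.exists_univ {L : List (Piece E B)} (hL : S.IsCut f₀ T X b₀ L col)
    (hcard : Fintype.card E + 1 = Fintype.card R + 3 + T.card) :
    ∃ L' col', S.IsCut f₀ T Finset.univ b₀ L' col' := by
  induction hn : Xᶜ.card generalizing X L col with
  | zero =>
    have : X = Finset.univ := by
      rw [Finset.card_eq_zero, Finset.compl_eq_empty_iff] at hn; exact hn
    subst this
    exact ⟨L, col, hL⟩
  | succ n ih =>
    obtain ⟨e, he⟩ : ∃ e, e ∈ Xᶜ := Finset.card_pos.1 (by omega)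
    rw [Finset.mem_compl] at he
    obtain ⟨L', col', hL'⟩ := hL.exists_insert he hcard
    exact ih hL' (by
      rw [Finset.compl_insert, Finset.card_erase_of_mem (Finset.mem_compl.2 he), hn]; rfl)

/-- The starting point: a disc with one circuit, which is unlabelled and has trivial word, and all
columns standard. -/
theorem IsTreeOn.exists_isCut {t : F → E} (h : S.IsTreeOn f₀ Finset.univ t) (b₀ : Side E B) :
    ∃ L, S.IsCut f₀ (treeEdges f₀ Finset.univ t) (treeEdges f₀ Finset.univ t) b₀ L
      (fun e => LinearMap.single ℂ (fun _ : E => Fin 3 → ℂ) e) := by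
  obtain ⟨l, hl, hn, hmem, hw⟩ := h.exists_cyc
  obtain ⟨s, hs⟩ := S.face_surjective f₀
  obtain ⟨u, v, rfl, hl'⟩ := hl.exists_cons ((hmem s).2 (Finset.mem_univ _))
  have hmem' : ∀ x, x ∈ s :: (v ++ u) := by
    intro x
    have := (hmem x).2 (Finset.mem_univ _)
    simp at this ⊢; tauto
  have hw' : S.word (treeEdges f₀ Finset.univ t) (s :: v ++ u) = 1 := by
    rw [word_append] at hw ⊢
    exact mul_eq_one_comm.1 hw
  refine ⟨[⟨none, s :: v ++ u, 1⟩], Finset.Subset.refl _, ⟨?_, ?_, ?_⟩, by simp, ?_, ?_, ?_, ?_, ?_,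
    fun _ _ => rfl, ?_, by rw [ofCols_id]; simp⟩
  · simpa using hl'
  · have : (s :: v ++ u).Nodup := (List.perm_append_comm.nodup_iff).1 hn
    simpa using this
  · intro x; simpa using hmem' x
  · intro o
    rcases o with _ | e <;> simp
  · simp only [List.map_cons, List.map_nil, List.prod_singleton, pieceLoop, hw', one_mul, inv_one]
  · intro x hx e _
    rw [List.mem_singleton] at hx
    subst hx
    exact one_mem _
  · intro x hx s' a hsa
    rw [List.mem_singleton] at hx
    subst hx
    obtain ⟨rfl, -⟩ := List.cons.inj hsa
    rw [hs]
    exact PathElt.isPath_one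
  · intro x hx _
    rw [List.mem_singleton] at hx
    subst hx
    exact hmem' b₀
  · intro x hx e hxe
    rw [List.mem_singleton] at hx
    subst hx
    simp at hxe

variable (S)

/-- The loop around a circuit. -/
def loopElt (c : R ⊕ Fin 3) : PathElt (E → Fin 3 → ℂ) := ((S.loop c).map S.letter).prod

theorem loopElt_chain (c : R ⊕ Fin 3) : (S.loopElt c).chain = S.pathChain (S.loop c) :=
  S.letter_prod_chain _

theorem loopElt_hol (c : R ⊕ Fin 3) : (S.loopElt c).hol = ((S.loop c).map S.crossing).prod :=
  S.letter_prod_hol _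

/-- The loop around a circuit, connected to a base point by the path `h c`. -/
def basedLoop (h : R ⊕ Fin 3 → PathElt (E → Fin 3 → ℂ)) (c : R ⊕ Fin 3) :
    PathElt (E → Fin 3 → ℂ) :=
  h c * S.loopElt c * (h c)⁻¹

/-- A presentation of a tessellated sphere with holes: a spanning tree of the faces, and
connecting paths for the circuits such that the product of the loops is trivial, together with
a labelling of all but one of the circuits by the edges outside the tree, such that the chains of
the loops and the edges of the tree form a unimodular matrix. -/
structure Presentation where
  f₀ : F
  t : F → E
  tree : S.IsTreeOn f₀ Finset.univ t
  circuits : List (R ⊕ Fin 3)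
  nodup : circuits.Nodup
  mem_circuits : ∀ c, c ∈ circuits
  h : R ⊕ Fin 3 → PathElt (E → Fin 3 → ℂ)
  isPath : ∀ c, (h c).IsPath S.boundaryOne (faceIncl F f₀) (faceIncl F (S.face (S.base c)))
  prod : (circuits.map (S.basedLoop h)).prod = 1
  lab : R ⊕ Fin 3 → Option E
  lab_injective : Function.Injective lab
  lab_zero : lab (Sum.inr 0) = none
  lab_range : ∀ o, (∃ c, lab c = o) ↔ ∀ e, o = some e → e ∉ treeEdges f₀ Finset.univ t
  col : E → (Fin 3 → ℂ) →ₗ[ℂ] (E → Fin 3 → ℂ)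
  col_tree : ∀ e ∈ treeEdges f₀ Finset.univ t,
    col e = LinearMap.single ℂ (fun _ : E => Fin 3 → ℂ) e
  col_lab : ∀ c e, lab c = some e → col e = (S.basedLoop h c).chain
  det_sq : LinearMap.det (ofCols col) ^ 2 = 1

theorem loopElt_eq {c : R ⊕ Fin 3} {l : List (Side E B)}
    (h : IsCyc (S.next * opp E B) (S.base c :: l)) (hn : (S.base c :: l).Nodup) :
    S.loopElt c = ((S.base c :: l).map S.letter).prod := by
  rw [loopElt, loop, ← h.eq_map_range hn]

/-- A spanning tree has one edge less than there are faces, so `euler` is exactly the count required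
by `IsCut.exists_univ`. Marking the base side of circuit `inr 0` makes this circuit the unlabelled
one. -/
theorem nonempty_presentation : Nonempty S.Presentation := by
  let s₀ := S.base (Sum.inr 0)
  -- An edge is needed only as the arbitrary initial value of the tree function; the Euler relation
  -- supplies one.
  have hE : Nonempty E := by
    by_contra hE
    rw [not_nonempty_iff] at hE
    have h1 := S.euler
    have h2 : Fintype.card E = 0 := Fintype.card_eq_zero
    have h3 : 0 < Fintype.card F := Fintype.card_pos_iff.2 ⟨S.face s₀⟩
    omega
  obtain ⟨t, ht⟩ := S.exists_isTreeOn_univ (S.face s₀) (fun _ => hE.some)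
  set f₀ := S.face s₀ with hf₀
  obtain ⟨L₀, hL₀⟩ := ht.exists_isCut s₀
  have hcardT : (treeEdges f₀ Finset.univ t).card + 1 = Fintype.card F := by
    rw [treeEdges, Finset.card_image_of_injOn ht.injOn,
      Finset.card_erase_of_mem (Finset.mem_univ _), Finset.card_univ]
    have h3 : 0 < Fintype.card F := Fintype.card_pos_iff.2 ⟨f₀⟩
    omega
  obtain ⟨L, col, hL⟩ := hL₀.exists_univ (by have := S.euler; omega)
  have hdec := hL.decomp
  rw [turn, oppOn_univ] at hdec
  have hcycx : ∀ x ∈ L, IsCyc (S.next * opp E B) x.sides := fun x hx =>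
    hdec.isCyc _ (List.mem_map_of_mem hx)
  -- the piece of each circuit
  have hpiece : ∀ c, ∃ x ∈ L, S.base c ∈ x.sides := by
    intro c
    obtain ⟨l, hl, hc⟩ := List.mem_flatten.1 (hdec.mem (S.base c))
    obtain ⟨x, hx, rfl⟩ := List.mem_map.1 hl
    exact ⟨x, hx, hc⟩
  choose piece hpL hpb using hpiece
  have huniq : ∀ x ∈ L, ∀ y ∈ L, ∀ s, s ∈ x.sides → s ∈ y.sides → x = y := by
    intro x hx y hy s hsx hsy
    by_contra hxy
    have h1 := (List.nodup_flatten.1 hdec.nodup).2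
    rw [List.pairwise_map] at h1
    have hsym : Std.Symm (fun a b : Piece E B => a.sides.Disjoint b.sides) :=
      ⟨fun _ _ h => h.symm⟩
    exact (h1.forall hx hy hxy) hsx hsy
  have hpiece_surj : ∀ x ∈ L, ∃ c, piece c = x := by
    intro x hx
    obtain ⟨s, hs⟩ := List.exists_mem_of_ne_nil _ (hcycx x hx).1
    refine ⟨S.circuit s, huniq _ (hpL _) x hx (S.base (S.circuit s)) (hpb _) ?_⟩
    refine (hcycx x hx).mem_of_sameCycle hs ?_
    rw [← S.circuit_eq_iff, S.circuit_base]
  have hpiece_inj : Function.Injective piece := by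
    intro c c' hcc
    have := (hcycx _ (hpL c)).sameCycle (hpb c) (t := S.base c') (by rw [hcc]; exact hpb c')
    rwa [← S.circuit_eq_iff, S.circuit_base, S.circuit_base] at this
  choose! circ hcirc using hpiece_surj
  have hcp : ∀ c, circ (piece c) = c := fun c => hpiece_inj (hcirc _ (hpL c))
  -- the connecting paths
  have hsplit : ∀ c, ∃ u v, (piece c).sides = u ++ S.base c :: v := fun c =>
    List.append_of_mem (hpb c)
  choose u v huv using hsplit
  -- The path of the piece leads to its own first side; the word of the initial segment moves on
  -- along the circuit to the prescribed base side.
  let h : R ⊕ Fin 3 → PathElt (E → Fin 3 → ℂ) := fun c =>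
    (piece c).base * S.word Finset.univ (u c)
  have hloop : ∀ c, S.basedLoop h c = S.pieceLoop Finset.univ (piece c) := by
    intro c
    have hc := hcycx _ (hpL c)
    rw [huv c] at hc
    have hn : (S.base c :: v c ++ u c).Nodup := by
      have := (List.nodup_flatten.1 hdec.nodup).1 _ (List.mem_map_of_mem (hpL c))
      rw [huv c] at this
      exact (List.perm_append_comm.nodup_iff).1 this
    rw [basedLoop, S.loopElt_eq hc.append_comm hn, pieceLoop, huv c]
    have hword : ∀ l, (l.map S.letter).prod = S.word Finset.univ l := by
      intro l; rw [word, letterOn_univ]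
    rw [hword]
    simp only [h, List.append_eq, ← List.cons_append, word_append]
    group
  refine ⟨⟨f₀, t, ht, L.map circ, ?_, ?_, h, ?_, ?_, fun c => (piece c).lab, ?_, ?_, ?_, col, ?_, ?_,
    hL.det_sq⟩⟩
  · refine List.Nodup.map_on ?_ hL.labels_nodup.of_map
    intro x hx y hy hxy
    rw [← hcirc x hx, ← hcirc y hy, hxy]
  · intro c
    exact List.mem_map.2 ⟨piece c, hpL c, hcp c⟩
  · intro c
    exact path_rotate (huv c) (hL.decomp.isCyc _ (List.mem_map_of_mem (hpL c))) (hL.path _ (hpL c))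
  · rw [List.map_map, ← hL.prod]
    congr 1
    refine List.map_congr_left fun x hx => ?_
    rw [Function.comp_apply, hloop, hcirc x hx]
  · intro c c' hcc
    exact hpiece_inj (List.inj_on_of_nodup_map hL.labels_nodup (hpL c) (hpL c') hcc)
  · have hne := (hL.labels none).2 (by simp)
    obtain ⟨x, hx, hxn⟩ := List.mem_map.1 hne
    have := huniq x hx _ (hpL (Sum.inr 0)) s₀ (hL.root x hx hxn) (hpb _)
    rw [← this, hxn]
  · intro o
    have h1 := hL.labels o
    simp only [Finset.mem_univ, true_and, List.mem_map] at h1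
    rw [← h1]
    constructor
    · rintro ⟨c, hc⟩
      exact ⟨piece c, hpL c, hc⟩
    · rintro ⟨x, hx, hxo⟩
      exact ⟨circ x, by rw [hcirc x hx, hxo]⟩
  · intro e he
    exact hL.col_std e fun _ => he
  · intro c e hce
    rw [hloop]
    exact hL.col_lab _ (hpL c) e hce

end HyperbolicSurface

end PairOfPants

end

noncomputable section

namespace PairOfPants

/-! ## Frames in the hyperbolic plane -/

open UpperHalfPlane (I)

/-- The rotation by the angle `θ` around `I`. -/
def rot (θ : ℝ) : SL(2, ℝ) :=
  ⟨!![Real.cos (θ / 2), Real.sin (θ / 2); -Real.sin (θ / 2), Real.cos (θ / 2)], by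
    rw [Matrix.det_fin_two_of]
    linear_combination Real.sin_sq_add_cos_sq (θ / 2)⟩

/-- The translation by `t` along the vertical geodesic through `I`. -/
def trans (t : ℝ) : SL(2, ℝ) :=
  ⟨!![Real.exp (t / 2), 0; 0, Real.exp (-(t / 2))], by
    rw [Matrix.det_fin_two_of, ← Real.exp_add]; simp⟩

theorem rot_val (θ : ℝ) : (rot θ).1 =
    !![Real.cos (θ / 2), Real.sin (θ / 2); -Real.sin (θ / 2), Real.cos (θ / 2)] := rfl

theorem trans_val (t : ℝ) : (trans t).1 =
    !![Real.exp (t / 2), 0; 0, Real.exp (-(t / 2))] := rfl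

theorem rot_add (a b : ℝ) : rot (a + b) = rot a * rot b := by
  apply Subtype.ext
  rw [Matrix.SpecialLinearGroup.coe_mul, rot_val, rot_val, rot_val, Matrix.mul_fin_two, add_div,
    Real.cos_add, Real.sin_add]
  ext i j
  fin_cases i <;> fin_cases j <;> simp <;> ring

theorem rot_zero : rot 0 = 1 := by
  ext i j
  fin_cases i <;> fin_cases j <;> simp [rot]

theorem rot_two_pi : rot (2 * Real.pi) = -1 := by
  ext i j
  fin_cases i <;> fin_cases j <;> simp [rot]

theorem rot_neg (a : ℝ) : rot (-a) = (rot a)⁻¹ :=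
  eq_inv_of_mul_eq_one_left (by rw [← rot_add, neg_add_cancel, rot_zero])

theorem trans_add (a b : ℝ) : trans (a + b) = trans a * trans b := by
  apply Subtype.ext
  rw [Matrix.SpecialLinearGroup.coe_mul, trans_val, trans_val, trans_val, Matrix.mul_fin_two,
    add_div, neg_add, Real.exp_add, Real.exp_add]
  simp

theorem trans_zero : trans 0 = 1 := by
  ext i j
  fin_cases i <;> fin_cases j <;> simp [trans]

/-- A half turn about a point of a geodesic reverses the geodesic. -/
theorem rot_pi_mul_trans (t : ℝ) : rot Real.pi * trans t = trans (-t) * rot Real.pi := by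
  apply Subtype.ext
  rw [Matrix.SpecialLinearGroup.coe_mul, Matrix.SpecialLinearGroup.coe_mul, trans_val, trans_val,
    rot_val, Matrix.mul_fin_two, Matrix.mul_fin_two]
  simp [neg_div]

theorem coe_smul_eq (A : SL(2, ℝ)) (z : ℍ) :
    ((A • z : ℍ) : ℂ) = ((A 0 0 : ℂ) * z + A 0 1) / ((A 1 0 : ℂ) * z + A 1 1) := by
  rw [UpperHalfPlane.coe_specialLinearGroup_apply]
  simp

theorem denom_ne (A : SL(2, ℝ)) (z : ℍ) : (A 1 0 : ℂ) * z + A 1 1 ≠ 0 := by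
  have := UpperHalfPlane.denom_ne_zero (A : GL (Fin 2) ℝ) z
  simpa [UpperHalfPlane.denom] using this

theorem det_complex (A : SL(2, ℝ)) : (A 0 0 : ℂ) * A 1 1 - (A 0 1 : ℂ) * A 1 0 = 1 := by
  have := A.det_coe
  rw [Matrix.det_fin_two] at this
  exact_mod_cast this

theorem coe_sub_conj_ne (z w : ℍ) : (w : ℂ) - (starRingEnd ℂ) (z : ℂ) ≠ 0 := by
  intro h
  have := congrArg Complex.im h
  simp at this
  linarith [z.im_pos, w.im_pos]

/-- In disc coordinates centred at a point and at its image, an isometry is multiplication by a unit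
complex number independent of `w`. -/
theorem toDisc_smul (A : SL(2, ℝ)) (z w : ℍ) : toDisc (A • z) (A • w) =
    toDisc z w * ((starRingEnd ℂ) ((A 1 0 : ℂ) * z + A 1 1) / ((A 1 0 : ℂ) * z + A 1 1)) := by
  have h1 := denom_ne A z
  have h2 := denom_ne A w
  have h3 : (starRingEnd ℂ) ((A 1 0 : ℂ) * z + A 1 1) ≠ 0 := (map_ne_zero _).2 h1
  have hd := det_complex A
  have h4 := coe_sub_conj_ne z w
  have h5 := coe_sub_conj_ne (A • z) (A • w)
  simp only [map_add, map_mul, Complex.conj_ofReal] at h3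
  have e1 : ((A • w : ℍ) : ℂ) - ((A • z : ℍ) : ℂ) =
      ((w : ℂ) - z) / (((A 1 0 : ℂ) * w + A 1 1) * ((A 1 0 : ℂ) * z + A 1 1)) := by
    rw [coe_smul_eq, coe_smul_eq, div_sub_div _ _ h2 h1]
    congr 1
    linear_combination ((w : ℂ) - z) * hd
  have e2 : ((A • w : ℍ) : ℂ) - (starRingEnd ℂ) ((A • z : ℍ) : ℂ) =
      ((w : ℂ) - (starRingEnd ℂ) (z : ℂ)) /
        (((A 1 0 : ℂ) * w + A 1 1) * ((A 1 0 : ℂ) * (starRingEnd ℂ) (z : ℂ) + A 1 1)) := by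
    rw [coe_smul_eq, coe_smul_eq]
    simp only [map_add, map_mul, Complex.conj_ofReal, map_div₀]
    rw [div_sub_div _ _ h2 h3]
    congr 1
    linear_combination ((w : ℂ) - (starRingEnd ℂ) (z : ℂ)) * hd
  rw [toDisc, toDisc, e1, e2]
  simp only [map_add, map_mul, Complex.conj_ofReal]
  rw [div_div_div_eq, div_mul_div_comm, div_eq_div_iff (mul_ne_zero (mul_ne_zero h2 h1) h4)
    (mul_ne_zero h4 h1)]
  ring

theorem toDisc_injective (z : ℍ) : Function.Injective (toDisc z) := by
  intro w w' h
  have h1 := coe_sub_conj_ne z w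
  have h2 := coe_sub_conj_ne z w'
  have h3 := coe_sub_conj_ne z z
  rw [toDisc, toDisc, div_eq_div_iff h1 h2] at h
  have : ((z : ℂ) - (starRingEnd ℂ) (z : ℂ)) * ((w : ℂ) - w') = 0 := by linear_combination h
  rcases mul_eq_zero.1 this with h4 | h4
  · exact absurd h4 h3
  · exact UpperHalfPlane.ext (sub_eq_zero.1 h4)

theorem coe_trans_smul_I (t : ℝ) : ((trans t • I : ℍ) : ℂ) = Real.exp t * Complex.I := by
  rw [coe_smul_eq]
  have h : Real.exp t = Real.exp (t / 2) * Real.exp (t / 2) := by rw [← Real.exp_add]; ring_nf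
  have h0 : (Real.exp (t / 2) : ℂ) ≠ 0 := by exact_mod_cast (Real.exp_pos _).ne'
  simp only [trans_val, UpperHalfPlane.coe_I]
  simp only [Matrix.of_apply, Matrix.cons_val', Matrix.cons_val_zero, Matrix.cons_val_one,
    Matrix.cons_val_fin_one, Complex.ofReal_zero, zero_mul, zero_add, add_zero, Real.exp_neg,
    Complex.ofReal_inv, h, Complex.ofReal_mul]
  field_simp

theorem dist_I_trans (t : ℝ) : dist I (trans t • I) = |t| := by
  have him : (trans t • I : ℍ).im = Real.exp t := by
    rw [← UpperHalfPlane.coe_im, coe_trans_smul_I]; simp [Complex.exp_ofReal_re]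
  have hre : I.re = (trans t • I : ℍ).re := by
    rw [← UpperHalfPlane.coe_re (trans t • I), coe_trans_smul_I]; simp
  rw [UpperHalfPlane.dist_of_re_eq hre, him, UpperHalfPlane.I_im, Real.log_exp, Real.log_one,
    Real.dist_eq]
  simp

theorem rot_smul_I (θ : ℝ) : rot θ • I = I := by
  apply UpperHalfPlane.ext
  rw [coe_smul_eq, div_eq_iff (denom_ne _ _)]
  simp only [rot_val, UpperHalfPlane.coe_I]
  simp
  linear_combination (Complex.sin (θ / 2)) * Complex.I_mul_I

/-- The radius, in the disc model, of the circle of radius `t`. -/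
def discRadius (t : ℝ) : ℝ := (Real.exp t - 1) / (Real.exp t + 1)

theorem discRadius_pos {t : ℝ} (ht : 0 < t) : 0 < discRadius t :=
  div_pos (by linarith [Real.add_one_lt_exp ht.ne']) (by positivity)

theorem toDisc_I_trans (t : ℝ) : toDisc I (trans t • I) = discRadius t := by
  rw [toDisc, coe_trans_smul_I, discRadius, UpperHalfPlane.coe_I, Complex.conj_I]
  have : (Real.exp t : ℂ) + 1 ≠ 0 := by
    have : Real.exp t + 1 ≠ 0 := by positivity
    exact_mod_cast this
  have h2 : (Real.exp t : ℂ) * Complex.I - -Complex.I ≠ 0 := by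
    rw [sub_neg_eq_add, ← add_one_mul]; exact mul_ne_zero this Complex.I_ne_zero
  push_cast at *
  rw [div_eq_div_iff h2 this]
  ring

theorem toDisc_I_rot (θ : ℝ) (w : ℍ) :
    toDisc I (rot θ • w) = Complex.exp (θ * Complex.I) * toDisc I w := by
  have h := toDisc_smul (rot θ) I w
  rw [rot_smul_I] at h
  rw [h, mul_comm]
  congr 1
  rw [div_eq_iff (denom_ne _ _)]
  have e1 : ((rot θ) 1 0 : ℂ) * (I : ℍ) + (rot θ) 1 1 = Complex.exp (-(θ / 2) * Complex.I) := by
    rw [Complex.exp_mul_I]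
    simp [rot_val]
    ring
  have e2 : (starRingEnd ℂ) (((rot θ) 1 0 : ℂ) * (I : ℍ) + (rot θ) 1 1) =
      Complex.exp (θ / 2 * Complex.I) := by
    rw [Complex.exp_mul_I, map_add, map_mul, Complex.conj_ofReal, Complex.conj_ofReal,
      UpperHalfPlane.coe_I, Complex.conj_I]
    simp [rot_val]
    ring
  rw [e2, e1, ← Complex.exp_add]
  ring_nf

/-- Polar coordinates: the direction is the argument in the disc model, and the distance is found by
inverting `discRadius`. -/
theorem exists_polar (w : ℍ) (hw : w ≠ I) :
    ∃ φ t, φ = (toDisc I w).arg ∧ 0 < t ∧ w = rot φ • trans t • I := by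
  set ζ := toDisc I w with hζ
  have hζ0 : ζ ≠ 0 := by
    rw [hζ, toDisc, div_ne_zero_iff]
    refine ⟨fun h => hw (UpperHalfPlane.ext (sub_eq_zero.1 h)), coe_sub_conj_ne _ _⟩
  have hr0 : 0 < ‖ζ‖ := norm_pos_iff.2 hζ0
  have hr1 : ‖ζ‖ < 1 := by
    rw [hζ, toDisc, norm_div, div_lt_one (norm_pos_iff.2 (coe_sub_conj_ne _ _))]
    rw [← sq_lt_sq₀ (norm_nonneg _) (norm_nonneg _), Complex.sq_norm, Complex.sq_norm,
      Complex.normSq_apply, Complex.normSq_apply]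
    have := w.im_pos
    simp
    nlinarith
  set t := Real.log ((1 + ‖ζ‖) / (1 - ‖ζ‖)) with ht
  have h1 : 0 < 1 - ‖ζ‖ := by linarith
  have hexp : Real.exp t = (1 + ‖ζ‖) / (1 - ‖ζ‖) := Real.exp_log (by positivity)
  have hrad : discRadius t = ‖ζ‖ := by
    rw [discRadius, hexp]
    field_simp
    ring
  refine ⟨ζ.arg, t, rfl, ?_, ?_⟩
  · apply Real.log_pos
    rw [lt_div_iff₀ h1]
    linarith
  · apply toDisc_injective I
    rw [toDisc_I_rot, toDisc_I_trans, hrad, mul_comm, Complex.norm_mul_exp_arg_mul_I]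

theorem exists_frame {z w : ℍ} (h : z ≠ w) :
    ∃ g : SL(2, ℝ), g • I = z ∧ 0 < dist z w ∧ g • trans (dist z w) • I = w := by
  set A := UpperHalfPlane.toSL2R z with hA
  have hAI : A • I = z := UpperHalfPlane.toSL2R_smul_I z
  have hne : A⁻¹ • w ≠ I := by
    intro h'
    apply h
    rw [← hAI, ← h', smul_inv_smul]
  obtain ⟨φ, t, -, ht, hw⟩ := exists_polar _ hne
  have hw' : w = (A * rot φ) • trans t • I := by
    rw [mul_smul, ← hw, smul_inv_smul]
  have hz : (A * rot φ) • I = z := by rw [mul_smul, rot_smul_I, hAI]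
  have hd : dist z w = t := by
    have : dist ((A * rot φ) • I) ((A * rot φ) • trans t • I) = t := by
      rw [dist_smul, dist_I_trans, abs_of_pos ht]
    rwa [hz, ← hw'] at this
  exact ⟨A * rot φ, hz, by rw [hd]; exact ht, by rw [hd, ← hw']⟩

/-- An isometry fixing `I` and a direction at `I` is `±1` in `SL(2, ℝ)`, and `symSq` does not see
the sign. Equality of `t` and `t'` need not be assumed. -/
theorem frame_unique {g g' : SL(2, ℝ)} {t t' : ℝ} (ht : 0 < t) (ht' : 0 < t')
    (h0 : g • I = g' • I) (h1 : g • trans t • I = g' • trans t' • I) : symSq g = symSq g' := by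
  set k := g⁻¹ * g' with hk
  have hg' : g' = g * k := by rw [hk, mul_inv_cancel_left]
  have hkI : k • I = I := by rw [hk, mul_smul, ← h0, inv_smul_smul]
  have hkt : k • trans t' • I = trans t • I := by rw [hk, mul_smul, ← h1, inv_smul_smul]
  have e := toDisc_smul k I (trans t' • I)
  rw [hkI, hkt, toDisc_I_trans, toDisc_I_trans, ← mul_div_assoc, eq_div_iff (denom_ne _ _)] at e
  -- Both disc positions are positive reals, so comparing imaginary parts leaves `(r + r') * k 1 0 =
  -- 0` with `r + r' > 0`.
  have hc : k 1 0 = 0 := by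
    have := congrArg Complex.im e
    simp [UpperHalfPlane.coe_I] at this
    have h3 : (discRadius t + discRadius t') * k 1 0 = 0 := by linarith
    rcases mul_eq_zero.1 h3 with h4 | h4
    · linarith [discRadius_pos ht, discRadius_pos ht']
    · exact h4
  have e2 : ((k • I : ℍ) : ℂ) = Complex.I := by rw [hkI]; rfl
  rw [coe_smul_eq, div_eq_iff (denom_ne _ _)] at e2
  have hb : k 0 1 = 0 := by
    have := congrArg Complex.re e2
    simpa [UpperHalfPlane.coe_I, hc] using this
  have had : k 0 0 = k 1 1 := by
    have := congrArg Complex.im e2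
    simpa [UpperHalfPlane.coe_I, hc] using this
  have hdet := k.det_coe
  rw [Matrix.det_fin_two, hc, hb, had] at hdet
  have hk1 : symSq k = 1 := by
    have h5 : k 1 1 = 1 ∨ k 1 1 = -1 := by
      have : k 1 1 * k 1 1 = 1 := by linarith
      exact mul_self_eq_one_iff.1 this
    rcases h5 with h5 | h5
    · have : k = 1 := by
        ext i j
        fin_cases i <;> fin_cases j <;> simp [hc, hb, had, h5]
      rw [this, symSq_one]
    · have : k = -1 := by
        ext i j
        fin_cases i <;> fin_cases j <;> simp [hc, hb, had, h5]
      rw [this, symSq_neg, symSq_one]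
  rw [hg', symSq_mul, hk1, mul_one]

/-- The two quantities differ by a positive factor, explicit in the proof. Seen from `z` the
geodesics become rays, and the side is the sign of the oriented angle. -/
theorem leftOf_iff (z w u : ℍ) :
    LeftOf z w u ↔ 0 < ((starRingEnd ℂ) (toDisc z w) * toDisc z u).im := by
  have e : (starRingEnd ℂ) (toDisc z w) * toDisc z u =
      ((2 * z.im * Matrix.det !![1, z.re, Complex.normSq (z : ℂ);
                    1, w.re, Complex.normSq (w : ℂ);
                    1, u.re, Complex.normSq (u : ℂ)] /
        (Complex.normSq ((w : ℂ) - (starRingEnd ℂ) (z : ℂ)) *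
          Complex.normSq ((u : ℂ) - (starRingEnd ℂ) (z : ℂ))) : ℝ) : ℂ) * Complex.I +
      (((starRingEnd ℂ) (toDisc z w) * toDisc z u).re : ℂ) := by
    have h1 := coe_sub_conj_ne z w
    have h2 := coe_sub_conj_ne z u
    have h3 : Complex.normSq ((w : ℂ) - (starRingEnd ℂ) (z : ℂ)) ≠ 0 :=
      Complex.normSq_eq_zero.not.2 h1
    have h4 : Complex.normSq ((u : ℂ) - (starRingEnd ℂ) (z : ℂ)) ≠ 0 :=
      Complex.normSq_eq_zero.not.2 h2
    apply Complex.ext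
    · rw [Complex.add_re, Complex.re_ofReal_mul, Complex.I_re, Complex.ofReal_re]; ring
    · simp only [toDisc, map_div₀, Complex.add_im, Complex.mul_im, Complex.ofReal_re,
        Complex.ofReal_im, Complex.I_im, Complex.I_re, mul_zero, mul_one, add_zero,
        Complex.div_re, Complex.div_im, Matrix.det_fin_three, Matrix.of_apply, Matrix.cons_val',
        Matrix.cons_val_zero, Matrix.cons_val_one, Matrix.cons_val, Complex.normSq_conj]
      field_simp
      simp [Complex.normSq_apply]
      ring
  rw [e]
  simp only [Complex.add_im, Complex.mul_im, Complex.ofReal_re, Complex.ofReal_im, Complex.I_im,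
    Complex.I_re, mul_zero, mul_one, add_zero]
  have h3 : 0 < Complex.normSq ((w : ℂ) - (starRingEnd ℂ) (z : ℂ)) :=
    Complex.normSq_pos.2 (coe_sub_conj_ne z w)
  have h4 : 0 < Complex.normSq ((u : ℂ) - (starRingEnd ℂ) (z : ℂ)) :=
    Complex.normSq_pos.2 (coe_sub_conj_ne z u)
  rw [div_pos_iff_of_pos_right (mul_pos h3 h4), mul_pos_iff_of_pos_left
    (mul_pos two_pos z.im_pos), LeftOf]

theorem LeftOf.ne_left {z w u : ℍ} (h : LeftOf z w u) : z ≠ w := by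
  rintro rfl
  simp [LeftOf, Matrix.det_fin_three] at h
  linarith [mul_comm (Complex.normSq (z : ℂ)) z.re]

/-- Positive orientation puts the argument of `u` relative to `w` in `(0, π)`, so the unoriented
angle is the oriented one and rotating the frame by it points at `u`. -/
theorem LeftOf.corner {g : SL(2, ℝ)} {t : ℝ} {z w u : ℍ} (h : LeftOf z w u) (ht : 0 < t)
    (hz : g • I = z) (hw : g • trans t • I = w) :
    0 < hypAngle z w u ∧ hypAngle z w u < Real.pi ∧
      ∃ t', 0 < t' ∧ u = (g * rot (hypAngle z w u)) • trans t' • I := by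
  have hne : g⁻¹ • u ≠ I := by
    intro h'
    have : u = z := by rw [← hz, ← h', smul_inv_smul]
    subst this
    rw [leftOf_iff] at h
    simp [toDisc] at h
  obtain ⟨φ, t', hφ, ht', hu⟩ := exists_polar _ hne
  have hu' : u = g • rot φ • trans t' • I := by rw [← hu, smul_inv_smul]
  have hr := discRadius_pos ht
  have hr' := discRadius_pos ht'
  set j : ℂ := (g 1 0 : ℂ) * (I : ℍ) + g 1 1 with hj
  have hj0 : j ≠ 0 := denom_ne g I
  set μ : ℂ := (starRingEnd ℂ) j / j with hμ
  have hμ0 : μ ≠ 0 := div_ne_zero ((map_ne_zero _).2 hj0) hj0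
  have hμ1 : (starRingEnd ℂ) μ * μ = 1 := by
    rw [hμ, map_div₀, Complex.conj_conj]
    have : (starRingEnd ℂ) j ≠ 0 := (map_ne_zero _).2 hj0
    field_simp
  have e1 : toDisc z w = discRadius t * μ := by
    rw [← hz, ← hw, toDisc_smul, toDisc_I_trans]
  have e2 : toDisc z u = Complex.exp (φ * Complex.I) * discRadius t' * μ := by
    rw [hu', ← hz, toDisc_smul, toDisc_I_rot, toDisc_I_trans]
  have hr0 : (discRadius t : ℂ) ≠ 0 := by exact_mod_cast hr.ne'
  have hr0' : (discRadius t' : ℂ) ≠ 0 := by exact_mod_cast hr'.ne'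
  have hφ1 : φ ≤ Real.pi := by rw [hφ]; exact Complex.arg_le_pi _
  have hφ2 : -Real.pi < φ := by rw [hφ]; exact Complex.neg_pi_lt_arg _
  have hsin : 0 < Real.sin φ := by
    rw [leftOf_iff, e1, e2] at h
    have e3 : (starRingEnd ℂ) (discRadius t * μ) * (Complex.exp (φ * Complex.I) * discRadius t' * μ)
        = ((discRadius t * discRadius t' : ℝ) : ℂ) * Complex.exp (φ * Complex.I) := by
      rw [map_mul, Complex.conj_ofReal]
      push_cast
      linear_combination (discRadius t * discRadius t' * Complex.exp (φ * Complex.I) : ℂ) * hμ1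
    rw [e3, Complex.im_ofReal_mul, Complex.exp_ofReal_mul_I_im] at h
    exact pos_of_mul_pos_right h (mul_pos hr hr').le
  have hφ0 : 0 < φ := by
    by_contra hcon
    linarith [Real.sin_nonpos_of_nonpos_of_neg_pi_le (not_lt.1 hcon) hφ2.le]
  have hφπ : φ ≠ Real.pi := by
    rintro h'
    rw [h', Real.sin_pi] at hsin
    exact lt_irrefl _ hsin
  have hang : hypAngle z w u = φ := by
    rw [hypAngle, InnerProductGeometry.angle_comm, Complex.angle_eq_abs_arg, e1, e2]
    · have e3 : Complex.exp (φ * Complex.I) * discRadius t' * μ / (discRadius t * μ) =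
          ((discRadius t' / discRadius t : ℝ) : ℂ) *
            (Complex.cos φ + Complex.sin φ * Complex.I) := by
        rw [← Complex.exp_mul_I]
        push_cast
        field_simp
      rw [e3, Complex.arg_mul_cos_add_sin_mul_I (div_pos hr' hr) ⟨hφ2, hφ1⟩, abs_of_pos hφ0]
    · rw [e2]; exact mul_ne_zero (mul_ne_zero (Complex.exp_ne_zero _) hr0') hμ0
    · rw [e1]; exact mul_ne_zero hr0 hμ0
  rw [hang]
  exact ⟨hφ0, lt_of_le_of_ne hφ1 hφπ, t', ht', by rw [mul_smul, ← hu']⟩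

end PairOfPants

end

noncomputable section

namespace PairOfPants

namespace HyperbolicSurface

open scoped Classical
open UpperHalfPlane (I)

variable {F E B R : Type} [Fintype F] [Fintype E] [Fintype B] [Fintype R]
  (S : HyperbolicSurface F E B R)

/-! ## Holonomy around a circuit -/

/-- The permutation `next ∘ opp`, whose cycles are the circuits. -/
def turnAll : Equiv.Perm (Side E B) := S.next * opp E B

theorem circuit_turnAll (s : Side E B) : S.circuit (S.turnAll s) = S.circuit s := by
  rw [S.circuit_eq_iff]
  exact (Equiv.Perm.SameCycle.refl _ _).apply_left

/-- The sides met by the loop around the circuit of `s`, from `s` on. -/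
def cycleList (s : Side E B) : List (Side E B) :=
  (List.range (Function.minimalPeriod S.turnAll s)).map (fun i => (S.turnAll ^ i) s)

theorem loop_eq_cycleList (c : R ⊕ Fin 3) : S.loop c = S.cycleList (S.base c) := rfl

theorem exists_cycleList_eq (s : Side E B) :
    ∃ a, S.cycleList s = s :: a ∧ IsCyc S.turnAll (s :: a) ∧ (s :: a).Nodup := by
  obtain ⟨a, h1, h2⟩ := exists_isCyc_cons S.turnAll s
  exact ⟨a, (h1.eq_map_range h2).symm, h1, h2⟩

theorem mem_cycleList {s t : Side E B} : t ∈ S.cycleList s ↔ S.circuit t = S.circuit s := by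
  obtain ⟨a, h1, h2, -⟩ := S.exists_cycleList_eq s
  rw [h1, S.circuit_eq_iff]
  constructor
  · intro h
    exact (h2.sameCycle (s := s) (by simp) h).symm
  · intro h
    exact h2.mem_of_sameCycle (s := s) (by simp) h.symm

theorem sum_cycleList (f : Side E B → ℝ) (s : Side E B) :
    ((S.cycleList s).map f).sum = ∑ t with S.circuit t = S.circuit s, f t := by
  have hn : (S.cycleList s).Nodup := by
    obtain ⟨a, h1, -, h2⟩ := S.exists_cycleList_eq s
    rw [h1]; exact h2
  rw [← List.sum_toFinset f hn]
  refine Finset.sum_congr ?_ fun _ _ => rfl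
  ext t
  simp [mem_cycleList]

theorem sum_circuit_turnAll (f : Side E B → ℝ) (s : Side E B) :
    ∑ t with S.circuit t = S.circuit s, f (S.turnAll t) =
      ∑ t with S.circuit t = S.circuit s, f t := by
  refine Finset.sum_equiv S.turnAll (fun t => ?_) fun _ _ => rfl
  simp [circuit_turnAll]

/-- If each crossing is an element of a fixed one-parameter group when read in moving frames `G`,
the frames cancel between neighbours and the parameters add. -/
theorem symSq_telescope {α : Type} {q : Equiv.Perm α} {x G : α → SL(2, ℝ)} {c : ℝ → SL(2, ℝ)}
    (hc : ∀ a b, c (a + b) = c a * c b) {f : α → ℝ} {z : α} :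
    ∀ (a : List α) (s : α), (s :: a).map q = a ++ [z] →
      (∀ t ∈ s :: a, symSq (x t) = symSq (G t * c (f t) * (G (q t))⁻¹)) →
      symSq ((s :: a).map x).prod = symSq (G s * c ((s :: a).map f).sum * (G z)⁻¹)
  | [], s, h, hx => by
    have hz : q s = z := by simpa using h
    simpa [hz] using hx s (by simp)
  | s2 :: a, s, h, hx => by
    rw [List.map_cons, List.cons_append] at h
    obtain ⟨h1, h2⟩ := List.cons.inj h
    have ih := symSq_telescope hc a s2 h2 fun t ht => hx t (List.mem_cons_of_mem _ ht)
    have hsum : ((s :: s2 :: a).map f).sum = f s + ((s2 :: a).map f).sum := by simp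
    rw [List.map_cons, List.prod_cons, symSq_mul, ih, hx s (by simp), h1, ← symSq_mul, hsum, hc]
    congr 1
    group

theorem symSq_prod_cycleList {x G : Side E B → SL(2, ℝ)} {c : ℝ → SL(2, ℝ)}
    (hc : ∀ a b, c (a + b) = c a * c b) {f : Side E B → ℝ} {s : Side E B}
    (hx : ∀ t, S.circuit t = S.circuit s →
      symSq (x t) = symSq (G t * c (f t) * (G (S.turnAll t))⁻¹)) :
    symSq ((S.cycleList s).map x).prod =
      symSq (G s * c (∑ t with S.circuit t = S.circuit s, f t) * (G s)⁻¹) := by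
  rw [← S.sum_cycleList]
  have hm := fun t => S.mem_cycleList (s := s) (t := t)
  obtain ⟨a, h1, h2, -⟩ := S.exists_cycleList_eq s
  rw [h1] at hm ⊢
  exact symSq_telescope hc a s (isCyc_cons.1 h2) fun t ht => hx t ((hm t).1 ht)

/-! ### Frames along the sides -/

theorem leftOf_prev (s : Side E B) :
    LeftOf (S.pos s) (S.pos (S.next s)) (S.pos (S.next.symm s)) := by
  have h1 := S.three_le (S.next.symm s)
  rw [Equiv.apply_symm_apply] at h1
  refine S.convex s _ ?_ (fun h => h1.1 h.symm) fun h => h1.2 h.symm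
  have := S.face_next (S.next.symm s)
  rw [Equiv.apply_symm_apply] at this
  exact this.symm

/-- A frame at the starting vertex of a side, in the direction of the side. -/
def frame (s : Side E B) : SL(2, ℝ) := (exists_frame (S.leftOf_prev s).ne_left).choose

/-- The length of a side. -/
def len (s : Side E B) : ℝ := dist (S.pos s) (S.pos (S.next s))

theorem frame_smul_I (s : Side E B) : S.frame s • I = S.pos s :=
  (exists_frame (S.leftOf_prev s).ne_left).choose_spec.1

theorem len_pos (s : Side E B) : 0 < S.len s :=
  (exists_frame (S.leftOf_prev s).ne_left).choose_spec.2.1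

theorem frame_smul_trans (s : Side E B) : S.frame s • trans (S.len s) • I = S.pos (S.next s) :=
  (exists_frame (S.leftOf_prev s).ne_left).choose_spec.2.2

theorem corner_spec (s : Side E B) : 0 < S.cornerAngle s ∧ S.cornerAngle s < Real.pi ∧
    ∃ t', 0 < t' ∧
      S.pos (S.next.symm s) = (S.frame s * rot (S.cornerAngle s)) • trans t' • I :=
  (S.leftOf_prev s).corner (S.len_pos s) (S.frame_smul_I s) (S.frame_smul_trans s)

theorem crossing_smul (e : E) (b : Bool) :
    S.crossing (Sum.inl (e, b)) • S.pos (S.next (Sum.inl (e, !b))) = S.pos (Sum.inl (e, b)) ∧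
    S.crossing (Sum.inl (e, b)) • S.pos (Sum.inl (e, !b)) = S.pos (S.next (Sum.inl (e, b))) := by
  cases b
  · simp only [crossing, Bool.not_false]
    rw [inv_smul_eq_iff, inv_smul_eq_iff]
    exact ⟨(S.glue_start e).symm, (S.glue_end e).symm⟩
  · exact ⟨S.glue_end e, S.glue_start e⟩

/-- Both sides are determined by frames at the same glued edge. In the adjacent polygon this edge is
the side preceding `turnAll s`, reached from its frame by turning through the corner angle. -/
theorem symSq_crossing_inl (e : E) (b : Bool) :
    symSq (S.crossing (Sum.inl (e, b))) = symSq (S.frame (Sum.inl (e, b)) *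
      rot (-S.cornerAngle (S.turnAll (Sum.inl (e, b)))) *
        (S.frame (S.turnAll (Sum.inl (e, b))))⁻¹) := by
  set s : Side E B := Sum.inl (e, b)
  obtain ⟨-, -, t', ht', hp⟩ := S.corner_spec (S.turnAll s)
  have hprev : S.next.symm (S.turnAll s) = Sum.inl (e, !b) := Equiv.symm_apply_apply _ _
  rw [hprev] at hp
  have h := frame_unique (S.len_pos s) ht' (g := S.frame s)
    (g' := S.crossing s * (S.frame (S.turnAll s) * rot (S.cornerAngle (S.turnAll s))))
    (by rw [mul_smul, mul_smul, rot_smul_I, S.frame_smul_I, S.frame_smul_I]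
        exact (S.crossing_smul e b).1.symm)
    (by rw [mul_smul, ← hp, S.frame_smul_trans]; exact (S.crossing_smul e b).2.symm)
  rw [mul_assoc, symSq_mul, h, ← symSq_mul, rot_neg]
  congr 1
  group

/-- Both frames sit at the end of the boundary side and look back along it. -/
theorem symSq_frame_inr (b : B) :
    symSq (S.frame (Sum.inr b) * trans (S.len (Sum.inr b)) * rot Real.pi) =
      symSq (S.frame (S.turnAll (Sum.inr b)) * rot (S.cornerAngle (S.turnAll (Sum.inr b)))) := by
  set s : Side E B := Sum.inr b
  obtain ⟨-, -, t', ht', hp⟩ := S.corner_spec (S.turnAll s)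
  have hprev : S.next.symm (S.turnAll s) = s := Equiv.symm_apply_apply _ _
  rw [hprev] at hp
  refine frame_unique (S.len_pos s) ht' ?_ ?_
  · rw [mul_smul, mul_smul, mul_smul, rot_smul_I, rot_smul_I, S.frame_smul_trans, S.frame_smul_I]
    rfl
  · rw [← hp, ← mul_smul, mul_assoc, rot_pi_mul_trans, mul_smul, mul_smul, mul_smul, rot_smul_I,
      ← mul_smul (trans _), ← trans_add, add_neg_cancel, trans_zero, one_smul, S.frame_smul_I]

/-! ### Interior vertices and cone points -/

theorem SameVertex.circuit_eq {S : HyperbolicSurface F E B R} {s t : Side E B}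
    (h : S.SameVertex s t) : S.circuit t = S.circuit s := by
  induction h with
  | rel x y h => rw [h.2]; exact S.circuit_turnAll x
  | refl x => rfl
  | symm x y _ ih => exact ih.symm
  | trans x y z h1 h2 ih1 ih2 => exact ih2.trans ih1

theorem circuit_pow (n : ℕ) (s : Side E B) :
    S.circuit ((S.turnAll ^ n) s) = S.circuit s := by
  induction n with
  | zero => rfl
  | succ n ih => rw [pow_succ', Equiv.Perm.mul_apply, S.circuit_turnAll, ih]

theorem exists_pow_eq {s t : Side E B} (h : S.circuit t = S.circuit s) :
    ∃ n : ℕ, (S.turnAll ^ n) s = t := by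
  obtain ⟨i, -, hi⟩ := List.mem_map.1 (S.mem_cycleList.2 h)
  exact ⟨i, hi⟩

theorem sameVertex_iff {s : Side E B}
    (hs : ∀ b : B, S.circuit (Sum.inr b) ≠ S.circuit s) (t : Side E B) :
    S.SameVertex s t ↔ S.circuit t = S.circuit s := by
  refine ⟨SameVertex.circuit_eq, fun h => ?_⟩
  obtain ⟨n, rfl⟩ := S.exists_pow_eq h
  clear h
  induction n with
  | zero => exact Relation.EqvGen.refl _
  | succ n ih =>
    refine ih.trans _ _ _ (Relation.EqvGen.rel _ _ ⟨?_, ?_⟩)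
    · rcases hb : (S.turnAll ^ n) s with p | b
      · exact ⟨p, rfl⟩
      · exact absurd (hb ▸ S.circuit_pow n s) (hs b)
    · rw [pow_succ', Equiv.Perm.mul_apply]; rfl

theorem vertexAngle_eq {s : Side E B} (hs : ∀ b : B, S.circuit (Sum.inr b) ≠ S.circuit s) :
    S.vertexAngle s = ∑ t with S.circuit t = S.circuit s, S.cornerAngle t := by
  rw [vertexAngle]
  refine Finset.sum_congr ?_ fun _ _ => rfl
  ext t
  simp only [Finset.mem_filter, Finset.mem_univ, true_and]
  exact S.sameVertex_iff hs t

theorem vertexAngle_pos (s : Side E B) : 0 < S.vertexAngle s := by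
  rw [vertexAngle]
  refine Finset.sum_pos (fun t _ => (S.corner_spec t).1) ⟨s, ?_⟩
  simp only [Finset.mem_filter, Finset.mem_univ, true_and]
  exact Relation.EqvGen.refl _

/-- The loop around an interior vertex, or around a cone point, acts as a rotation. -/
theorem symSq_prod_crossing {s : Side E B}
    (hs : ∀ b : B, S.circuit (Sum.inr b) ≠ S.circuit s) :
    symSq ((S.cycleList s).map S.crossing).prod =
      symSq (S.frame s * rot (-S.vertexAngle s) * (S.frame s)⁻¹) := by
  have h := S.symSq_prod_cycleList (x := S.crossing) (G := S.frame) (c := rot) rot_add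
    (f := fun t => -S.cornerAngle (S.turnAll t)) (s := s) (by
      intro t ht
      rcases t with ⟨e, b⟩ | b
      · exact S.symSq_crossing_inl e b
      · exact absurd ht (hs b))
  rw [h, Finset.sum_neg_distrib, S.sum_circuit_turnAll, S.vertexAngle_eq hs]

/-! ### Geodesic boundary components -/

/-- The boundary sides are those of the second kind. -/
theorem exists_steps {s : Side E B} (hs : ∃ b : B, S.circuit (Sum.inr b) = S.circuit s) :
    ∃ n : ℕ, ∃ b : B, (S.turnAll ^ n) s = Sum.inr b := by
  obtain ⟨b, hb⟩ := hs
  obtain ⟨n, hn⟩ := S.exists_pow_eq hb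
  exact ⟨n, b, hn⟩

/-- The number of steps around the vertex up to the next boundary side. -/
def steps (s : Side E B) : ℕ :=
  if h : ∃ n : ℕ, ∃ b : B, (S.turnAll ^ n) s = Sum.inr b then Nat.find h else 0

theorem steps_spec {s : Side E B} (hs : ∃ b : B, S.circuit (Sum.inr b) = S.circuit s) :
    ∃ b : B, (S.turnAll ^ S.steps s) s = Sum.inr b := by
  rw [steps, dif_pos (S.exists_steps hs)]
  exact Nat.find_spec (S.exists_steps hs)

theorem steps_min {s : Side E B} (hs : ∃ b : B, S.circuit (Sum.inr b) = S.circuit s) {m : ℕ}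
    (hm : m < S.steps s) (b : B) : (S.turnAll ^ m) s ≠ Sum.inr b := by
  rw [steps, dif_pos (S.exists_steps hs)] at hm
  intro h
  exact Nat.find_min (S.exists_steps hs) hm ⟨b, h⟩

theorem steps_inr (b : B) : S.steps (Sum.inr b) = 0 := by
  by_contra h
  exact S.steps_min (s := Sum.inr b) ⟨b, rfl⟩ (Nat.pos_of_ne_zero h) b rfl

theorem steps_inl {e : E} {c : Bool}
    (hs : ∃ b : B, S.circuit (Sum.inr b) = S.circuit (Sum.inl (e, c))) :
    S.steps (Sum.inl (e, c)) = S.steps (S.turnAll (Sum.inl (e, c))) + 1 := by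
  set s : Side E B := Sum.inl (e, c) with hse
  have hs' : ∃ b : B, S.circuit (Sum.inr b) = S.circuit (S.turnAll s) := by
    rw [S.circuit_turnAll]; exact hs
  have hpow : ∀ n, (S.turnAll ^ n) (S.turnAll s) = (S.turnAll ^ (n + 1)) s := fun n => by
    rw [pow_succ]; rfl
  obtain ⟨b, hb⟩ := S.steps_spec hs
  obtain ⟨b', hb'⟩ := S.steps_spec hs'
  rw [hpow] at hb'
  have h0 : S.steps s ≠ 0 := by
    intro h0
    rw [h0, hse] at hb
    simp at hb
  obtain ⟨m, hm⟩ := Nat.exists_eq_succ_of_ne_zero h0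
  rw [hm, Nat.succ_eq_add_one, ← hpow] at hb
  apply le_antisymm
  · by_contra hlt
    exact S.steps_min hs (not_le.1 hlt) b' hb'
  · by_contra hlt
    rw [hm] at hlt
    exact S.steps_min hs' (by omega) b hb

/-- The angle by which the frame of a side has to be rotated to point to the direction of the next
boundary side. -/
def boundaryAngle (s : Side E B) : ℝ :=
  -∑ j ∈ Finset.range (S.steps s), S.cornerAngle ((S.turnAll ^ (j + 1)) s)

theorem boundaryAngle_inl {e : E} {c : Bool}
    (hs : ∃ b : B, S.circuit (Sum.inr b) = S.circuit (Sum.inl (e, c))) :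
    S.boundaryAngle (Sum.inl (e, c)) = S.boundaryAngle (S.turnAll (Sum.inl (e, c))) -
      S.cornerAngle (S.turnAll (Sum.inl (e, c))) := by
  rw [boundaryAngle, boundaryAngle, S.steps_inl hs, Finset.sum_range_succ']
  simp only [pow_succ, pow_zero, one_mul, Equiv.Perm.mul_apply]
  ring

theorem boundaryAngle_inr (b : B) : S.boundaryAngle (Sum.inr b) = 0 := by
  rw [boundaryAngle, S.steps_inr]; simp

/-- The corners at a boundary vertex form one segment of the circuit, from just after a boundary
side up to and including the next one; the first corner is split off because `boundaryAngle` omits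
it. -/
theorem vertexAngle_turnAll_inr (b : B) : S.vertexAngle (S.turnAll (Sum.inr b)) =
    S.cornerAngle (S.turnAll (Sum.inr b)) - S.boundaryAngle (S.turnAll (Sum.inr b)) := by
  set t := S.turnAll (Sum.inr b) with ht
  have hs : ∃ b : B, S.circuit (Sum.inr b) = S.circuit t :=
    ⟨b, by rw [ht, S.circuit_turnAll]⟩
  have hmem : ∀ u, S.SameVertex t u ↔ ∃ j ≤ S.steps t, (S.turnAll ^ j) t = u := by
    have key : ∀ x y, Relation.EqvGen (fun s t : Side E B => (∃ p : E × Bool, s = Sum.inl p) ∧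
        t = S.next (opp E B s)) x y → ((∃ j ≤ S.steps t, (S.turnAll ^ j) t = x) ↔
          ∃ j ≤ S.steps t, (S.turnAll ^ j) t = y) := by
      intro x y h
      induction h with
      | rel x y h =>
        obtain ⟨⟨p, rfl⟩, rfl⟩ := h
        constructor
        · rintro ⟨j, hj, hjx⟩
          refine ⟨j + 1, ?_, by rw [pow_succ', Equiv.Perm.mul_apply, hjx]; rfl⟩
          rcases Nat.lt_or_ge j (S.steps t) with h1 | h1
          · exact h1
          · obtain ⟨b', hb'⟩ := S.steps_spec hs
            rw [le_antisymm h1 hj, hjx] at hb'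
            simp at hb'
        · rintro ⟨j, hj, hjx⟩
          have hjx' : (S.turnAll ^ j) t = S.turnAll (Sum.inl p) := hjx
          cases j with
          | zero =>
            have := S.turnAll.injective (ht.symm.trans hjx')
            simp at this
          | succ j =>
            rw [pow_succ', Equiv.Perm.mul_apply] at hjx'
            exact ⟨j, by omega, S.turnAll.injective hjx'⟩
      | refl x => exact Iff.rfl
      | symm x y _ ih => exact ih.symm
      | trans x y z _ _ ih1 ih2 => exact ih1.trans ih2
    intro u
    constructor
    · intro h
      exact (key _ _ h).1 ⟨0, Nat.zero_le _, rfl⟩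
    · rintro ⟨j, hj, rfl⟩
      induction j with
      | zero => exact Relation.EqvGen.refl _
      | succ j ih =>
        refine (ih (by omega)).trans _ _ _ (Relation.EqvGen.rel _ _ ⟨?_, ?_⟩)
        · rcases hb : (S.turnAll ^ j) t with p | b'
          · exact ⟨p, rfl⟩
          · exact absurd hb (S.steps_min hs (by omega) b')
        · rw [pow_succ', Equiv.Perm.mul_apply]; rfl
  have hfil : (Finset.univ.filter fun u => S.SameVertex t u) =
      (Finset.range (S.steps t + 1)).image fun j => (S.turnAll ^ j) t := by
    ext u
    simp only [Finset.mem_filter, Finset.mem_univ, true_and, Finset.mem_image, Finset.mem_range,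
      hmem, Nat.lt_succ_iff]
  have hinj : Set.InjOn (fun j => (S.turnAll ^ j) t) (Finset.range (S.steps t + 1)) := by
    have key : ∀ i j : ℕ, i < j → j ≤ S.steps t → (S.turnAll ^ i) t ≠ (S.turnAll ^ j) t := by
      intro i j hij hj h
      obtain ⟨k, rfl⟩ := Nat.exists_eq_add_of_lt hij
      rw [add_assoc, pow_add, Equiv.Perm.mul_apply] at h
      have h1 := (S.turnAll ^ i).injective h
      rw [pow_succ', Equiv.Perm.mul_apply] at h1
      have h2 := S.turnAll.injective (ht.symm.trans h1)
      exact S.steps_min hs (by omega) b h2.symm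
    intro i hi j hj h
    simp only [Finset.coe_range, Set.mem_Iio] at hi hj
    rcases Nat.lt_trichotomy i j with h1 | h1 | h1
    · exact absurd h (key i j h1 (by omega))
    · exact h1
    · exact absurd h.symm (key j i h1 (by omega))
  rw [vertexAngle, hfil, Finset.sum_image hinj, Finset.sum_range_succ', boundaryAngle]
  simp only [pow_zero, Equiv.Perm.one_apply]
  ring

/-- The frame at the starting vertex of a side of a boundary circuit, in the direction of
the boundary. -/
def boundaryFrame (s : Side E B) : SL(2, ℝ) := S.frame s * rot (S.boundaryAngle s)

/-- The loop along a geodesic boundary component acts as a translation. -/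
theorem symSq_prod_crossing_boundary {s : Side E B}
    (hs : ∃ b : B, S.circuit (Sum.inr b) = S.circuit s)
    (hπ : ∀ t, S.circuit t = S.circuit s → S.vertexAngle t = Real.pi) :
    symSq ((S.cycleList s).map S.crossing).prod =
      symSq (S.boundaryFrame s *
        trans (∑ b : B with S.circuit (Sum.inr b) = S.circuit s, S.len (Sum.inr b)) *
        (S.boundaryFrame s)⁻¹) := by
  -- In frames aligned with the boundary an interior crossing contributes nothing. A boundary side
  -- contributes its length, because the angle `π` at its end lets the frame continue straight on.
  have h := S.symSq_prod_cycleList (x := S.crossing) (G := S.boundaryFrame) (c := trans) trans_add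
    (f := fun t => Sum.elim (fun _ => 0) (fun b => S.len (Sum.inr b)) t) (s := s) (by
      intro t ht
      rcases t with ⟨e, c⟩ | b
      · have ha := S.boundaryAngle_inl (e := e) (c := c) (by rw [ht]; exact hs)
        simp only [Sum.elim_inl, trans_zero, mul_one, boundaryFrame]
        rw [S.symSq_crossing_inl, ha, sub_eq_add_neg, add_comm, rot_add]
        congr 1
        group
      · have h1 := S.symSq_frame_inr b
        have h2 := S.vertexAngle_turnAll_inr b
        rw [hπ _ (by rw [S.circuit_turnAll, ht])] at h2
        have h3 : S.cornerAngle (S.turnAll (Sum.inr b)) =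
            Real.pi + S.boundaryAngle (S.turnAll (Sum.inr b)) := by linarith
        rw [h3] at h1
        simp only [Sum.elim_inr, boundaryFrame, S.boundaryAngle_inr, rot_zero, mul_one, crossing]
        have h4 : S.frame (Sum.inr b) * trans (S.len (Sum.inr b)) =
            S.frame (Sum.inr b) * trans (S.len (Sum.inr b)) * rot Real.pi * (rot Real.pi)⁻¹ := by
          group
        rw [symSq_mul, h4, symSq_mul (_ * rot Real.pi), h1, ← symSq_mul, ← symSq_mul, add_comm,
          rot_add, symSq_one, ← symSq_one]
        congr 1
        group)
  rw [h]
  congr 4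
  rw [Finset.sum_filter, Finset.sum_filter, Fintype.sum_sum_type]
  simp

end HyperbolicSurface

end PairOfPants

end

noncomputable section

namespace PairOfPants

open UpperHalfPlane (I)

/-! ## The action on forms in a frame -/

theorem symSq_mul_congr {A A' B B' : SL(2, ℝ)} (h : symSq A = symSq A') (h' : symSq B = symSq B') :
    symSq (A * B) = symSq (A' * B') := by
  rw [symSq_mul, symSq_mul, h, h']

theorem symSq_inv_congr {A A' : SL(2, ℝ)} (h : symSq A = symSq A') : symSq A⁻¹ = symSq A'⁻¹ := by
  have h1 : symSq A⁻¹ * symSq A = 1 := by rw [← symSq_mul, inv_mul_cancel, symSq_one]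
  have h2 : symSq A' * symSq A'⁻¹ = 1 := by rw [← symSq_mul, mul_inv_cancel, symSq_one]
  rw [← h] at h2
  rw [← mul_one (symSq A⁻¹), ← h2, ← mul_assoc, h1, one_mul]

namespace HyperbolicSurface

theorem adT_congr {A A' : SL(2, ℝ)} (h : symSq A = symSq A') : adT A = adT A' := by
  rw [adT, adT, h]

theorem adT_apply (A : SL(2, ℝ)) (v : Fin 3 → ℂ) : adT A v =
    ![(A 0 0 : ℂ) ^ 2 * v 0 + (A 0 0 : ℂ) * (A 1 0 : ℂ) * v 1 + (A 1 0 : ℂ) ^ 2 * v 2,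
      2 * (A 0 0 : ℂ) * (A 0 1 : ℂ) * v 0 +
        ((A 0 0 : ℂ) * (A 1 1 : ℂ) + (A 0 1 : ℂ) * (A 1 0 : ℂ)) * v 1 +
        2 * (A 1 0 : ℂ) * (A 1 1 : ℂ) * v 2,
      (A 0 1 : ℂ) ^ 2 * v 0 + (A 0 1 : ℂ) * (A 1 1 : ℂ) * v 1 + (A 1 1 : ℂ) ^ 2 * v 2] := by
  ext i
  fin_cases i <;>
    simp only [adT, symSq, Matrix.mulVecLin_apply, Matrix.mulVec, dotProduct, Fin.sum_univ_three,
      Matrix.transpose_apply] <;> simp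

/-- The form fixed by the rotations about `I`, and two forms spanning the complement. -/
def pointForm : Fin 3 → ℂ := ![1, 0, 1]
def derivForm : Fin 3 → ℂ := ![-1, 0, 1]
def normalForm : Fin 3 → ℂ := ![0, 2, 0]

theorem trans_neg (t : ℝ) : trans (-t) = (trans t)⁻¹ :=
  eq_inv_of_mul_eq_one_left (by rw [← trans_add, neg_add_cancel, trans_zero])

theorem adT_trans_inv_pointForm (t : ℝ) : adT (trans t)⁻¹ pointForm =
    (Real.cosh t : ℂ) • pointForm + (Real.sinh t : ℂ) • derivForm := by
  have h1 : ∀ x : ℝ, Complex.exp x = Complex.exp (x / 2) ^ 2 := fun x => by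
    rw [← Complex.exp_nat_mul]; congr 1; push_cast; ring
  rw [← trans_neg, adT_apply]
  ext i
  fin_cases i
  · simp [trans_val, pointForm, derivForm, Complex.cosh, Complex.sinh, h1 t]
    rw [← Complex.ofReal_neg, h1 (-t)]
    push_cast
    rw [neg_div]; ring
  · simp [trans_val, pointForm, derivForm]
  · simp [trans_val, pointForm, derivForm, Complex.cosh, Complex.sinh, h1 t]
    rw [← Complex.ofReal_neg, h1 (-t)]
    push_cast
    rw [neg_div, neg_neg]; ring

theorem adT_rot_inv_derivForm (θ : ℝ) : adT (rot θ)⁻¹ derivForm =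
    (Real.cos θ : ℂ) • derivForm + (Real.sin θ : ℂ) • normalForm := by
  have h1 : (Real.cos θ : ℂ) = (Real.cos (θ / 2) : ℂ) ^ 2 - (Real.sin (θ / 2) : ℂ) ^ 2 := by
    have := Real.cos_two_mul' (θ / 2)
    rw [mul_div_cancel₀ _ two_ne_zero] at this
    rw [this]; push_cast; ring
  have h2 : (Real.sin θ : ℂ) = 2 * (Real.sin (θ / 2) : ℂ) * (Real.cos (θ / 2) : ℂ) := by
    have := Real.sin_two_mul (θ / 2)
    rw [mul_div_cancel₀ _ two_ne_zero] at this
    rw [this]; push_cast; ring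
  rw [← rot_neg, adT_apply, h1, h2]
  ext i
  fin_cases i <;>
    simp only [rot_val, derivForm, normalForm, neg_div, Real.cos_neg, Real.sin_neg] <;>
    simp <;> ring

theorem adT_pointForm {k : SL(2, ℝ)} (hk : k • I = I) : adT k pointForm = pointForm := by
  have h := congrArg (fun z : ℍ => (z : ℂ)) hk
  simp only [coe_smul_eq] at h
  rw [div_eq_iff (denom_ne _ _), UpperHalfPlane.coe_I] at h
  have hr := congrArg Complex.re h
  have hi := congrArg Complex.im h
  simp at hr hi
  have hd := det_complex k
  have hr' : (k 0 1 : ℂ) = -(k 1 0 : ℂ) := by rw [hr]; push_cast; ring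
  have hi' : (k 0 0 : ℂ) = (k 1 1 : ℂ) := by rw [hi]
  rw [adT_apply]
  rw [hr', hi'] at hd ⊢
  ext i
  fin_cases i
  · simp [pointForm]; linear_combination hd
  · simp [pointForm]; ring
  · simp [pointForm]; linear_combination hd

/-- The transported form depends only on the point, so it represents points of the plane inside the
space of quadratic forms. -/
theorem adT_inv_pointForm_congr {g g' : SL(2, ℝ)} (h : g • I = g' • I) :
    adT g⁻¹ pointForm = adT g'⁻¹ pointForm := by
  have hk : (g'⁻¹ * g) • I = I := by rw [mul_smul, h, inv_smul_smul]
  have h1 := adT_pointForm hk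
  have h2 : g⁻¹ = (g'⁻¹ * g)⁻¹ * g'⁻¹ := by group
  have h3 : adT (g'⁻¹ * g)⁻¹ pointForm = pointForm := by
    conv_lhs => rw [← h1]
    rw [adT_inv_adT]
  rw [h2, adT_mul_apply, h3]

open scoped Classical

variable {F E B R : Type} [Fintype F] [Fintype E] [Fintype B] [Fintype R]
  (S : HyperbolicSurface F E B R)

theorem face_turnAll (s : Side E B) : S.face (S.turnAll s) = S.face (opp E B s) :=
  S.face_next (opp E B s)

theorem isPath_prod_letter {z : Side E B} : ∀ (a : List (Side E B)) (s : Side E B),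
    (s :: a).map S.turnAll = a ++ [z] →
    (((s :: a).map S.letter).prod).IsPath S.boundaryOne (faceIncl F (S.face s))
      (faceIncl F (S.face z))
  | [], s, h => by
    have hz : S.turnAll s = z := by simpa using h
    rw [← hz, face_turnAll]
    simpa using S.letter_isPath s
  | s2 :: a, s, h => by
    rw [List.map_cons, List.cons_append] at h
    obtain ⟨h1, h2⟩ := List.cons.inj h
    have h3 := S.letter_isPath s
    rw [← face_turnAll, h1] at h3
    rw [List.map_cons, List.prod_cons]
    exact h3.mul (isPath_prod_letter a s2 h2)

theorem isPath_cycleList (s : Side E B) :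
    (((S.cycleList s).map S.letter).prod).IsPath S.boundaryOne (faceIncl F (S.face s))
      (faceIncl F (S.face s)) := by
  obtain ⟨a, h1, h2, -⟩ := S.exists_cycleList_eq s
  rw [h1]
  exact S.isPath_prod_letter a s (isCyc_cons.1 h2)

/-! ### Flat functionals -/

/-- The value of a functional on `0`-chains at a form transported by the frame `g`, in
the polygon of `s`. -/
def flatVal (L : (F → Fin 3 → ℂ) →ₗ[ℂ] ℂ) (s : Side E B) (g : SL(2, ℝ)) (v : Fin 3 → ℂ) : ℝ :=
  (L (faceIncl F (S.face s) (adT g⁻¹ v))).re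

section flat

variable {S} {L : (F → Fin 3 → ℂ) →ₗ[ℂ] ℂ}

theorem flatVal_congr {s : Side E B} {g g' : SL(2, ℝ)} (h : symSq g = symSq g')
    (v : Fin 3 → ℂ) : S.flatVal L s g v = S.flatVal L s g' v := by
  rw [flatVal, flatVal, adT_congr (symSq_inv_congr h)]

theorem flatVal_smul_congr {s : Side E B} {g g' : SL(2, ℝ)} (h : g • I = g' • I) :
    S.flatVal L s g pointForm = S.flatVal L s g' pointForm := by
  rw [flatVal, flatVal, adT_inv_pointForm_congr h]

theorem flatVal_face {s s' : Side E B} (h : S.face s = S.face s') (g : SL(2, ℝ))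
    (v : Fin 3 → ℂ) : S.flatVal L s g v = S.flatVal L s' g v := by
  rw [flatVal, flatVal, h]

/-- Along a unit speed geodesic the function solves `f'' = f`, with initial data given by
`pointForm` and `derivForm`. -/
theorem flatVal_mul_trans (s : Side E B) (g : SL(2, ℝ)) (t : ℝ) :
    S.flatVal L s (g * trans t) pointForm =
      Real.cosh t * S.flatVal L s g pointForm + Real.sinh t * S.flatVal L s g derivForm := by
  simp only [flatVal, mul_inv_rev, adT_mul_apply, adT_trans_inv_pointForm, map_add, map_smul]
  simp only [smul_eq_mul, Complex.add_re, Complex.re_ofReal_mul]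

theorem flatVal_mul_rot (s : Side E B) (g : SL(2, ℝ)) (θ : ℝ) :
    S.flatVal L s (g * rot θ) derivForm =
      Real.cos θ * S.flatVal L s g derivForm + Real.sin θ * S.flatVal L s g normalForm := by
  simp only [flatVal, mul_inv_rev, adT_mul_apply, adT_rot_inv_derivForm, map_add, map_smul]
  simp only [smul_eq_mul, Complex.add_re, Complex.re_ofReal_mul]

/-- Flatness: a functional that kills boundaries takes the same value on a coefficient before and
after transport along a path. -/
theorem flatVal_isPath (hL : L ∘ₗ S.boundaryOne = 0) {x : PathElt (E → Fin 3 → ℂ)}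
    {s s' : Side E B}
    (hx : x.IsPath S.boundaryOne (faceIncl F (S.face s)) (faceIncl F (S.face s')))
    (g : SL(2, ℝ)) (v : Fin 3 → ℂ) :
    S.flatVal L s (x.hol * g) v = S.flatVal L s' g v := by
  have h1 := congrArg L (hx (adT (x.hol * g)⁻¹ v))
  have h2 : L (S.boundaryOne (x.chain (adT (x.hol * g)⁻¹ v))) = 0 := LinearMap.congr_fun hL _
  rw [h2, map_sub, ← adT_mul_apply, mul_inv_rev, inv_mul_cancel_right] at h1
  rw [flatVal, flatVal, mul_inv_rev, ← sub_eq_zero.1 h1.symm]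

theorem flatVal_turnAll (hL : L ∘ₗ S.boundaryOne = 0) (e : E) (b : Bool) (φ : ℝ)
    (v : Fin 3 → ℂ) :
    S.flatVal L (S.turnAll (Sum.inl (e, b)))
        (S.frame (S.turnAll (Sum.inl (e, b))) * rot φ) v =
      S.flatVal L (Sum.inl (e, b)) (S.frame (Sum.inl (e, b)) *
        rot (-S.cornerAngle (S.turnAll (Sum.inl (e, b))) + φ)) v := by
  have h := S.letter_isPath (Sum.inl (e, b))
  rw [← face_turnAll] at h
  rw [← flatVal_isPath hL h]
  apply flatVal_congr
  rw [symSq_mul, letter_hol, S.symSq_crossing_inl, ← symSq_mul, rot_add]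
  congr 1
  group

/-- The value of the functional at the starting vertex of a side. -/
def vertexVal (S : HyperbolicSurface F E B R) (L : (F → Fin 3 → ℂ) →ₗ[ℂ] ℂ) (s : Side E B) : ℝ :=
  S.flatVal L s (S.frame s) pointForm

theorem flatVal_rot_pointForm (s : Side E B) (g : SL(2, ℝ)) (θ : ℝ) :
    S.flatVal L s (g * rot θ) pointForm = S.flatVal L s g pointForm :=
  flatVal_smul_congr (by rw [mul_smul, rot_smul_I])

theorem vertexVal_turnAll (hL : L ∘ₗ S.boundaryOne = 0) (e : E) (b : Bool) :
    S.vertexVal L (S.turnAll (Sum.inl (e, b))) = S.vertexVal L (Sum.inl (e, b)) := by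
  have h := flatVal_turnAll hL e b 0 pointForm
  rwa [flatVal_rot_pointForm, flatVal_rot_pointForm] at h

theorem vertexVal_next (s : Side E B) : S.vertexVal L (S.next s) =
    Real.cosh (S.len s) * S.vertexVal L s +
      Real.sinh (S.len s) * S.flatVal L s (S.frame s) derivForm := by
  rw [vertexVal, flatVal_face (S.face_next s), vertexVal, ← flatVal_mul_trans]
  apply flatVal_smul_congr
  rw [S.frame_smul_I, mul_smul, S.frame_smul_trans]

theorem exists_vertexVal_prev (s : Side E B) : ∃ t, 0 < t ∧ S.vertexVal L (S.next.symm s) =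
    Real.cosh t * S.vertexVal L s + Real.sinh t *
      S.flatVal L s (S.frame s * rot (S.cornerAngle s)) derivForm := by
  obtain ⟨-, -, t, ht, h⟩ := S.corner_spec s
  refine ⟨t, ht, ?_⟩
  have h1 : S.face (S.next.symm s) = S.face s := by
    conv_rhs => rw [← S.next.apply_symm_apply s, S.face_next]
  rw [vertexVal, flatVal_face h1, vertexVal,
    ← flatVal_rot_pointForm s (S.frame s) (S.cornerAngle s), ← flatVal_mul_trans]
  apply flatVal_smul_congr
  rw [S.frame_smul_I, mul_smul, h]

/-- Since `cosh > 1`, a positive value would grow along the side unless the initial slope is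
negative. -/
theorem deriv_neg_of_max {s : Side E B} (h0 : 0 < S.vertexVal L s)
    (hmax : ∀ t, S.vertexVal L t ≤ S.vertexVal L s) :
    S.flatVal L s (S.frame s) derivForm < 0 := by
  have h1 := hmax (S.next s)
  rw [vertexVal_next] at h1
  have h2 := Real.one_lt_cosh.2 (S.len_pos s).ne'
  have h3 := Real.sinh_pos_iff.2 (S.len_pos s)
  by_contra h
  nlinarith [mul_nonneg h3.le (not_lt.1 h)]

/-- A sinusoidal function that is negative at the points of a sequence with steps less than `π`
cannot go through a full turn. -/
theorem sinusoid_absurd {a b : ℝ} {φ : ℕ → ℝ} {n : ℕ} (h0 : φ 0 = 0) (hn : φ n = 2 * Real.pi)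
    (hstep : ∀ j < n, φ j < φ (j + 1) ∧ φ (j + 1) - φ j < Real.pi)
    (hneg : ∀ j ≤ n, Real.cos (φ j) * a - Real.sin (φ j) * b < 0) : False := by
  have hex : ∃ j, Real.pi < φ j := ⟨n, by rw [hn]; linarith [Real.pi_pos]⟩
  set j := Nat.find hex with hj
  have hj1 : Real.pi < φ j := Nat.find_spec hex
  have hjn : j ≤ n := Nat.find_min' hex (by rw [hn]; linarith [Real.pi_pos])
  have hj0 : j ≠ 0 := by
    intro h
    rw [h, h0] at hj1
    linarith [Real.pi_pos]
  obtain ⟨m, hm⟩ := Nat.exists_eq_succ_of_ne_zero hj0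
  rw [Nat.succ_eq_add_one] at hm
  have hm1 : φ m ≤ Real.pi := not_lt.1 (Nat.find_min hex (by omega))
  rw [hm] at hj1
  obtain ⟨h1, h2⟩ := hstep m (by omega)
  have n1 := hneg m (by omega)
  have n2 := hneg (m + 1) (by omega)
  have n0 := hneg 0 (Nat.zero_le _)
  rw [h0, Real.cos_zero, Real.sin_zero] at n0
  have s1 : 0 ≤ Real.sin (Real.pi - φ m) :=
    Real.sin_nonneg_of_nonneg_of_le_pi (by linarith) (by linarith)
  have s2 : 0 < Real.sin (φ (m + 1) - Real.pi) :=
    Real.sin_pos_of_pos_of_lt_pi (by linarith) (by linarith)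
  have s3 : 0 < Real.sin (φ (m + 1) - φ m) :=
    Real.sin_pos_of_pos_of_lt_pi (by linarith) (by linarith)
  rw [Real.sin_pi_sub] at s1
  rw [Real.sin_sub_pi] at s2
  -- The direction `π`, where the sinusoid takes the value `-a > 0`, is a nonnegative combination of
  -- the directions `φ m` and `φ (m + 1)` on its two sides, where it is negative.
  have key : Real.sin (φ m) * (Real.cos (φ (m + 1)) * a - Real.sin (φ (m + 1)) * b) +
      (-Real.sin (φ (m + 1))) * (Real.cos (φ m) * a - Real.sin (φ m) * b) =
      -(Real.sin (φ (m + 1) - φ m) * a) := by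
    rw [Real.sin_sub]; ring
  nlinarith [mul_nonneg s1 (neg_pos.2 n2).le, mul_pos s2 (neg_pos.2 n1),
    mul_pos s3 (neg_pos.2 (show a < 0 by linarith))]

theorem list_sum_range (f : ℕ → ℝ) (n : ℕ) :
    ((List.range n).map f).sum = ∑ i ∈ Finset.range n, f i := by
  induction n with
  | zero => simp
  | succ n ih => simp [List.range_succ, Finset.sum_range_succ, ih]

/-- At a positive maximum the slope is negative along every side that starts at the vertex.
Transported into the frame of `s`, these slopes are values of one sinusoid at the partial sums of
the corner angles. -/
theorem max_interior {s : Side E B} (hL : L ∘ₗ S.boundaryOne = 0)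
    (hs : ∀ b : B, S.circuit (Sum.inr b) ≠ S.circuit s)
    (hΘ : S.vertexAngle s ≤ 2 * Real.pi)
    (hmax : ∀ t, S.vertexVal L t ≤ S.vertexVal L s) : S.vertexVal L s ≤ 0 := by
  by_contra h0
  rw [not_le] at h0
  have hinl : ∀ j : ℕ, ∃ p : E × Bool, (S.turnAll ^ j) s = Sum.inl p := by
    intro j
    rcases hb : (S.turnAll ^ j) s with p | b
    · exact ⟨p, rfl⟩
    · exact absurd (hb ▸ S.circuit_pow j s) (hs b)
  have hval : ∀ j : ℕ, S.vertexVal L ((S.turnAll ^ j) s) = S.vertexVal L s := by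
    intro j
    induction j with
    | zero => rfl
    | succ j ih =>
      obtain ⟨⟨e, b⟩, hp⟩ := hinl j
      rw [pow_succ', Equiv.Perm.mul_apply, ← ih, hp]
      exact vertexVal_turnAll hL e b
  have hder : ∀ (j : ℕ) (φ : ℝ), S.flatVal L ((S.turnAll ^ j) s)
      (S.frame ((S.turnAll ^ j) s) * rot φ) derivForm = S.flatVal L s (S.frame s *
        rot (φ - ∑ i ∈ Finset.range j, S.cornerAngle ((S.turnAll ^ (i + 1)) s))) derivForm := by
    intro j
    induction j with
    | zero => intro φ; simp
    | succ j ih =>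
      intro φ
      obtain ⟨⟨e, b⟩, hp⟩ := hinl j
      have h1 : (S.turnAll ^ (j + 1)) s = S.turnAll (Sum.inl (e, b)) := by
        rw [pow_succ', Equiv.Perm.mul_apply, hp]
      rw [h1, flatVal_turnAll hL, ← hp, ih, Finset.sum_range_succ, hp, h1]
      congr 3
      ring
  set a := S.flatVal L s (S.frame s) derivForm
  set b := S.flatVal L s (S.frame s) normalForm
  have hneg : ∀ j : ℕ, Real.cos (∑ i ∈ Finset.range j, S.cornerAngle ((S.turnAll ^ (i + 1)) s)) * a
      - Real.sin (∑ i ∈ Finset.range j, S.cornerAngle ((S.turnAll ^ (i + 1)) s)) * b < 0 := by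
    intro j
    have h1 := deriv_neg_of_max (S := S) (L := L) (s := (S.turnAll ^ j) s) (by rw [hval]; exact h0)
      (by rw [hval]; exact hmax)
    have h2 := hder j 0
    rw [rot_zero, mul_one, zero_sub, flatVal_mul_rot, Real.cos_neg, Real.sin_neg] at h2
    rw [h2] at h1
    linarith
  set n := Function.minimalPeriod S.turnAll s with hn
  have hsum : ∑ i ∈ Finset.range n, S.cornerAngle ((S.turnAll ^ (i + 1)) s) = S.vertexAngle s := by
    rw [S.vertexAngle_eq hs, ← S.sum_circuit_turnAll, ← S.sum_cycleList, cycleList, List.map_map,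
      list_sum_range]
    refine Finset.sum_congr rfl fun i _ => ?_
    rw [pow_succ']; rfl
  rcases hΘ.eq_or_lt with h | h
  · refine sinusoid_absurd (φ := fun j =>
      ∑ i ∈ Finset.range j, S.cornerAngle ((S.turnAll ^ (i + 1)) s)) (n := n) (by simp)
      (hsum.trans h) ?_ fun j _ => hneg j
    intro j _
    obtain ⟨c1, c2, -⟩ := S.corner_spec ((S.turnAll ^ (j + 1)) s)
    simp only [Finset.sum_range_succ]
    constructor <;> linarith
  -- At a cone angle below `2π`, the sinusoid is also invariant under the rotation by that angle.
  -- Adding the relations at two directions gives `(cos Θ - 1) a = 0`, hence zero slope, a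
  -- contradiction.
  · have h1 := flatVal_isPath hL (S.isPath_cycleList s)
    have h2 : ∀ φ : ℝ, S.flatVal L s (S.frame s * rot (-S.vertexAngle s + φ)) derivForm =
        S.flatVal L s (S.frame s * rot φ) derivForm := by
      intro φ
      rw [← h1 (S.frame s * rot φ)]
      apply flatVal_congr
      rw [symSq_mul _ (S.frame s * rot φ), letter_prod_hol, S.symSq_prod_crossing hs, ← symSq_mul, rot_add]
      congr 1
      group
    have e1 := h2 0
    have e2 := h2 (S.vertexAngle s)
    rw [add_zero] at e1
    rw [neg_add_cancel] at e2
    have ha := hneg 0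
    simp only [flatVal_mul_rot, Real.cos_neg, Real.sin_neg, Real.cos_zero, Real.sin_zero,
      Finset.range_zero, Finset.sum_empty] at e1 e2 ha
    have e3 : (Real.cos (S.vertexAngle s) - 1) * a = 0 := by linarith
    rcases mul_eq_zero.1 e3 with h3 | h3
    · rw [sub_eq_zero, Real.cos_eq_one_iff_of_lt_of_lt
        (by linarith [S.vertexAngle_pos s, Real.pi_pos]) h] at h3
      exact (S.vertexAngle_pos s).ne' h3
    · rw [h3] at ha; simp at ha

/-- Along the boundary geodesic the function is a combination of `cosh` and `sinh` with positive
period `ℓ`. Comparing parameters `0`, `ℓ` and `-ℓ` eliminates the `sinh` term and leaves `(cosh ℓ -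
1) f = 0`. -/
theorem vertexVal_boundary {s : Side E B} (hL : L ∘ₗ S.boundaryOne = 0)
    (hs : ∃ b : B, S.circuit (Sum.inr b) = S.circuit s)
    (hπ : ∀ t, S.circuit t = S.circuit s → S.vertexAngle t = Real.pi) :
    S.vertexVal L s = 0 := by
  set ℓ := ∑ b : B with S.circuit (Sum.inr b) = S.circuit s, S.len (Sum.inr b) with hℓ
  have hℓ0 : 0 < ℓ := by
    obtain ⟨b, hb⟩ := hs
    exact Finset.sum_pos (fun b _ => S.len_pos _) ⟨b, by simp [hb]⟩
  have h1 := flatVal_isPath hL (S.isPath_cycleList s)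
  have h2 : ∀ t : ℝ, S.flatVal L s (S.boundaryFrame s * trans (ℓ + t)) pointForm =
      S.flatVal L s (S.boundaryFrame s * trans t) pointForm := by
    intro t
    rw [← h1 (S.boundaryFrame s * trans t)]
    apply flatVal_congr
    rw [symSq_mul _ (S.boundaryFrame s * trans t), letter_prod_hol,
      S.symSq_prod_crossing_boundary hs hπ, ← hℓ, ← symSq_mul, trans_add]
    congr 1
    group
  have h3 : S.flatVal L s (S.boundaryFrame s) pointForm = S.vertexVal L s :=
    flatVal_rot_pointForm _ _ _
  have e1 := h2 0
  have e2 := h2 (-ℓ)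
  rw [add_neg_cancel] at e2
  simp only [flatVal_mul_trans, add_zero, Real.cosh_neg, Real.sinh_neg, Real.cosh_zero,
    Real.sinh_zero, h3] at e1 e2
  have e3 : (Real.cosh ℓ - 1) * S.vertexVal L s = 0 := by linarith
  rcases mul_eq_zero.1 e3 with h | h
  · linarith [Real.one_lt_cosh.2 hℓ0.ne']
  · exact h

end flat

/-! ### Vanishing of the coinvariants by the maximum principle -/

/-- The two kinds of surfaces: spheres with three cone points, of angles less than `2π`, and
three-holed spheres with geodesic boundary. -/
def IsPants : Prop :=
  (∃ α : Fin 3 → ℝ, (∀ k, α k < Real.pi) ∧ S.IsConeSphere α) ∨ ∃ l : Fin 3 → ℝ, S.IsGeodesicPants l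

variable {S}

theorem vertexVal_nonpos (hS : S.IsPants) {L : (F → Fin 3 → ℂ) →ₗ[ℂ] ℂ}
    (hL : L ∘ₗ S.boundaryOne = 0) (t : Side E B) : S.vertexVal L t ≤ 0 := by
  have : Nonempty (Side E B) := ⟨t⟩
  obtain ⟨s, hs⟩ := Finite.exists_max (S.vertexVal L)
  refine (hs t).trans ?_
  rcases hS with ⟨α, hα, h⟩ | ⟨l, h⟩
  · have hB := h.closed
    refine max_interior hL (fun b => hB.elim b) ?_ hs
    rcases hc : S.circuit s with r | k
    · exact (h.smooth s r hc).le
    · rw [h.cone s k hc]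
      linarith [hα k]
  · rcases hc : S.circuit s with r | k
    · refine max_interior hL (fun b => ?_) (h.smooth s r hc).le hs
      obtain ⟨k, hk⟩ := h.boundary_circuit b
      rw [hk, hc]
      exact Sum.inr_ne_inl
    · obtain ⟨b, hb⟩ := h.exists_boundary k
      exact (vertexVal_boundary hL ⟨b, by rw [hb, hc]⟩
        fun t ht => h.geodesic t k (by rw [ht, hc])).le

theorem vertexVal_eq_zero (hS : S.IsPants) {L : (F → Fin 3 → ℂ) →ₗ[ℂ] ℂ}
    (hL : L ∘ₗ S.boundaryOne = 0) (s : Side E B) : S.vertexVal L s = 0 := by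
  refine le_antisymm (vertexVal_nonpos hS hL s) ?_
  have h := vertexVal_nonpos hS (L := -L) (by rw [LinearMap.neg_comp, hL, neg_zero]) s
  simp only [vertexVal, flatVal, LinearMap.neg_apply, Complex.neg_re] at h ⊢
  linarith

/-- All vertex values vanish, so the slopes at a corner towards both neighbouring vertices vanish.
The corner angle lies in `(0, π)`, so these two directions are independent. -/
theorem flatVal_eq_zero (hS : S.IsPants) {L : (F → Fin 3 → ℂ) →ₗ[ℂ] ℂ}
    (hL : L ∘ₗ S.boundaryOne = 0) (s : Side E B) :
    S.flatVal L s (S.frame s) pointForm = 0 ∧ S.flatVal L s (S.frame s) derivForm = 0 ∧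
      S.flatVal L s (S.frame s) normalForm = 0 := by
  have h0 := vertexVal_eq_zero hS hL s
  have h1 := vertexVal_next (S := S) (L := L) s
  obtain ⟨t, ht, h2⟩ := exists_vertexVal_prev (S := S) (L := L) s
  rw [vertexVal_eq_zero hS hL, h0, mul_zero, zero_add, eq_comm, mul_eq_zero] at h1 h2
  have h3 := h1.resolve_left (Real.sinh_pos_iff.2 (S.len_pos s)).ne'
  have h4 := h2.resolve_left (Real.sinh_pos_iff.2 ht).ne'
  obtain ⟨c1, c2, -⟩ := S.corner_spec s
  rw [flatVal_mul_rot, h3, mul_zero, zero_add, mul_eq_zero] at h4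
  exact ⟨h0, h3, h4.resolve_left (Real.sin_pos_of_pos_of_lt_pi c1 c2).ne'⟩

/-- The coinvariants of the holonomy representation vanish. -/
theorem boundaryOne_surjective (hS : S.IsPants) : Function.Surjective S.boundaryOne := by
  rw [← LinearMap.range_eq_top]
  by_contra hne
  obtain ⟨L, hL0, hL⟩ := Submodule.exists_le_ker_of_lt_top _ (lt_top_iff_ne_top.2 hne)
  have hL1 : L ∘ₗ S.boundaryOne = 0 := LinearMap.ext fun x => hL ⟨x, rfl⟩
  -- `flatVal` takes real parts; applying the argument to `I • L` as well controls the imaginary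
  -- parts.
  have hL2 : (Complex.I • L) ∘ₗ S.boundaryOne = 0 := by rw [LinearMap.smul_comp, hL1, smul_zero]
  apply hL0
  have key : ∀ s v, L (faceIncl F (S.face s) v) = 0 := by
    intro s v
    obtain ⟨a1, a2, a3⟩ := flatVal_eq_zero hS hL1 s
    obtain ⟨b1, b2, b3⟩ := flatVal_eq_zero hS hL2 s
    have hz : ∀ w, S.flatVal L s (S.frame s) w = 0 →
        S.flatVal (Complex.I • L) s (S.frame s) w = 0 →
        L (faceIncl F (S.face s) (adT (S.frame s)⁻¹ w)) = 0 := by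
      intro w h1 h2
      simp only [flatVal, LinearMap.smul_apply, smul_eq_mul, Complex.mul_re, Complex.I_re,
        Complex.I_im, zero_mul, one_mul, zero_sub, neg_eq_zero] at h1 h2
      exact Complex.ext h1 h2
    have h3 : ∀ w, L (faceIncl F (S.face s) (adT (S.frame s)⁻¹ w)) = 0 := by
      intro w
      have hw : w = ((w 0 + w 2) / 2) • pointForm + ((w 2 - w 0) / 2) • derivForm +
          (w 1 / 2) • normalForm := by
        ext i
        fin_cases i <;> simp [pointForm, derivForm, normalForm] <;> ring
      rw [hw]
      simp only [map_add, map_smul, hz _ a1 b1, hz _ a2 b2, hz _ a3 b3, smul_zero, add_zero]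
    rw [← adT_inv_adT (S.frame s) v, h3]
  refine LinearMap.pi_ext fun f v => ?_
  obtain ⟨s, rfl⟩ := S.face_surjective f
  exact key s v

/-! ### The holonomy of the loops -/

/-- A full turn lifts to `-1` in `SL(2, ℝ)`, which acts trivially on quadratic forms. -/
theorem symSq_loop_inl (hS : S.IsPants) (r : R) :
    symSq ((S.loop (Sum.inl r)).map S.crossing).prod = 1 := by
  have hb := S.circuit_base (Sum.inl r)
  have h1 : ∀ b : B, S.circuit (Sum.inr b) ≠ S.circuit (S.base (Sum.inl r)) := by
    intro b
    rcases hS with ⟨α, hα, h⟩ | ⟨l, h⟩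
    · exact h.closed.elim b
    · obtain ⟨k, hk⟩ := h.boundary_circuit b
      rw [hk, hb]
      exact Sum.inr_ne_inl
  have h2 : S.vertexAngle (S.base (Sum.inl r)) = 2 * Real.pi := by
    rcases hS with ⟨α, hα, h⟩ | ⟨l, h⟩
    · exact h.smooth _ r hb
    · exact h.smooth _ r hb
  rw [loop_eq_cycleList, S.symSq_prod_crossing h1, h2, rot_neg, rot_two_pi, symSq_mul, symSq_mul]
  have h3 : symSq (-1 : SL(2, ℝ))⁻¹ = 1 := by
    rw [symSq_inv_congr (symSq_neg 1), inv_one, symSq_one]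
  rw [h3, mul_one, ← symSq_mul, mul_inv_cancel, symSq_one]

theorem boundaryOne_comp_boundaryTwo (hS : S.IsPants) : S.boundaryOne ∘ₗ S.boundaryTwo = 0 := by
  refine LinearMap.pi_ext fun r v => ?_
  have h := S.isPath_cycleList (S.base (Sum.inl r)) v
  rw [← loop_eq_cycleList, letter_prod_hol, letter_prod_chain,
    adT_congr ((symSq_loop_inl hS r).trans symSq_one.symm), adT_one, LinearMap.id_apply,
    sub_self] at h
  rw [← LinearMap.comp_apply] at *
  simp only [LinearMap.comp_apply, LinearMap.zero_apply]
  rw [boundaryTwo, LinearMap.sum_apply, Finset.sum_eq_single r]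
  · simpa using h
  · intro r' _ hr'
    simp [Pi.single_eq_of_ne hr']
  · simp

/-- The discriminant of the characteristic polynomial. -/
def traceDisc (A : SL(2, ℝ)) : ℂ := ((A 0 0 : ℂ) + A 1 1) ^ 2 - 4

/-- Expressed through `symSq`, the quantity is visibly insensitive to signs and to conjugation. -/
theorem traceDisc_eq (A : SL(2, ℝ)) : traceDisc A = (symSq A).trace - 3 := by
  have h := det_complex A
  rw [traceDisc, Matrix.trace_fin_three]
  simp [symSq]
  linear_combination h

theorem traceDisc_congr {A A' : SL(2, ℝ)} (h : symSq A = symSq A') :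
    traceDisc A = traceDisc A' := by
  rw [traceDisc_eq, traceDisc_eq, h]

theorem traceDisc_conj (g A : SL(2, ℝ)) : traceDisc (g * A * g⁻¹) = traceDisc A := by
  rw [traceDisc_eq, traceDisc_eq, symSq_mul, Matrix.trace_mul_comm, ← symSq_mul,
    inv_mul_cancel_left]

theorem traceDisc_rot (θ : ℝ) : traceDisc (rot θ) = -4 * Complex.sin (θ / 2) ^ 2 := by
  rw [traceDisc]
  simp only [rot_val, Matrix.of_apply, Matrix.cons_val', Matrix.cons_val_zero, Matrix.cons_val_one,
    Matrix.cons_val_fin_one]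
  push_cast
  linear_combination 4 * Complex.sin_sq_add_cos_sq ((θ : ℂ) / 2)

theorem traceDisc_trans (t : ℝ) : traceDisc (trans t) = 4 * Complex.sinh (t / 2) ^ 2 := by
  rw [traceDisc]
  simp only [trans_val, Matrix.of_apply, Matrix.cons_val', Matrix.cons_val_zero,
    Matrix.cons_val_one, Matrix.cons_val_fin_one]
  push_cast
  have h := Complex.cosh_sq ((t : ℂ) / 2)
  have h2 : Complex.exp ((t : ℂ) / 2) + Complex.exp (-((t : ℂ) / 2)) =
      2 * Complex.cosh ((t : ℂ) / 2) := by rw [Complex.cosh]; ring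
  rw [h2]
  linear_combination 4 * h

theorem traceDisc_cone {α : Fin 3 → ℝ} (h : S.IsConeSphere α) (k : Fin 3) :
    traceDisc (S.loopHolonomy k) = -4 * Complex.sin (α k) ^ 2 := by
  have h1 := S.symSq_prod_crossing (s := S.base (Sum.inr k)) fun b => h.closed.elim b
  rw [h.cone _ k (S.circuit_base _), ← loop_eq_cycleList] at h1
  rw [loopHolonomy, traceDisc_congr h1, traceDisc_conj, traceDisc_rot]
  have h2 : ((-(2 * α k) : ℝ) : ℂ) / 2 = -(α k : ℂ) := by push_cast; ring
  rw [h2, Complex.sin_neg]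
  ring

theorem sin_cone_ne {α : Fin 3 → ℝ} (hα : ∀ k, α k < Real.pi) (h : S.IsConeSphere α) (k : Fin 3) :
    Complex.sin (α k) ≠ 0 := by
  have h1 := S.vertexAngle_pos (S.base (Sum.inr k))
  rw [h.cone _ k (S.circuit_base _)] at h1
  have h2 := (Real.sin_pos_of_pos_of_lt_pi (by linarith) (hα k)).ne'
  rw [← Complex.ofReal_sin]
  exact_mod_cast h2

theorem traceDisc_geodesic {l : Fin 3 → ℝ} (h : S.IsGeodesicPants l) (k : Fin 3) :
    traceDisc (S.loopHolonomy k) = 4 * Complex.sinh (l k) ^ 2 := by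
  have hb := S.circuit_base (Sum.inr k)
  have h1 := S.symSq_prod_crossing_boundary (s := S.base (Sum.inr k))
    (by rw [hb]; exact h.exists_boundary k) fun t ht => h.geodesic t k (by rw [ht, hb])
  have h2 := h.length k
  rw [hb, ← loop_eq_cycleList] at h1
  simp only [len] at h1
  rw [h2] at h1
  rw [loopHolonomy, traceDisc_congr h1, traceDisc_conj, traceDisc_trans]
  have h2 : ((2 * l k : ℝ) : ℂ) / 2 = (l k : ℂ) := by push_cast; ring
  rw [h2]

theorem sinh_geodesic_ne {l : Fin 3 → ℝ} (h : S.IsGeodesicPants l) (k : Fin 3) :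
    Complex.sinh (l k) ≠ 0 := by
  obtain ⟨b, hb⟩ := h.exists_boundary k
  have h1 : 0 < 2 * l k := by
    rw [← h.length k]
    exact Finset.sum_pos (fun b _ => S.len_pos _) ⟨b, by simp [hb]⟩
  have h2 := (Real.sinh_pos_iff.2 (show 0 < l k by linarith)).ne'
  rw [← Complex.ofReal_sinh]
  exact_mod_cast h2

theorem traceDisc_loopHolonomy_ne (hS : S.IsPants) (k : Fin 3) :
    traceDisc (S.loopHolonomy k) ≠ 0 := by
  rcases hS with ⟨α, hα, h⟩ | ⟨l, h⟩
  · rw [traceDisc_cone h]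
    exact mul_ne_zero (by norm_num) (pow_ne_zero _ (sin_cone_ne hα h k))
  · rw [traceDisc_geodesic h]
    exact mul_ne_zero (by norm_num) (pow_ne_zero _ (sinh_geodesic_ne h k))

end HyperbolicSurface

end PairOfPants

end

noncomputable section

namespace PairOfPants

open scoped Classical

/-! ## Torsion computed from one convenient family of chains -/

section Families

variable {W : Type} [AddCommGroup W] [Module ℂ W]

theorem det_family_mul {κ : Type} [Fintype κ] [DecidableEq κ] (c : Module.Basis κ ℂ W) {w g : κ → W}
    (M : Matrix κ κ ℂ) (h : ∀ j, w j = ∑ i, M i j • g i) : c.det w = c.det g * M.det := by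
  have h1 : c.toMatrix w = c.toMatrix g * M := by
    ext i j
    rw [Module.Basis.toMatrix_apply, h, map_sum, Finsupp.finsetSum_apply, Matrix.mul_apply]
    refine Finset.sum_congr rfl fun k _ => ?_
    rw [map_smul, Finsupp.smul_apply, smul_eq_mul, mul_comm, Module.Basis.toMatrix_apply]
  rw [Module.Basis.det_apply, Module.Basis.det_apply, h1, Matrix.det_mul]

/-- Source of the sign ambiguity: two orderings of a family differ by a permutation. -/
theorem det_comp_equiv {ι κ : Type} [Fintype ι] [DecidableEq ι] (c : Module.Basis ι ℂ W)
    (e e' : ι ≃ κ) (w : κ → W) :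
    c.det (w ∘ e') = c.det (w ∘ e) ∨ c.det (w ∘ e') = -c.det (w ∘ e) := by
  have h1 : w ∘ e' = (w ∘ e) ∘ (e'.trans e.symm) := by
    ext i; simp
  rw [h1, AlternatingMap.map_perm]
  rcases Int.units_eq_one_or (Equiv.Perm.sign (e'.trans e.symm)) with h | h
  · left; rw [h, one_smul]
  · right; rw [h]; simp

theorem exists_sum_eq {κ : Type} [Fintype κ] [DecidableEq κ] {c : Module.Basis κ ℂ W} {x : κ → W}
    (hx : c.det x ≠ 0) (w : W) : ∃ a : κ → ℂ, w = ∑ i, a i • x i := by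
  have h := (Module.Basis.is_basis_iff_det c).2 (isUnit_iff_ne_zero.2 hx)
  have hw : w ∈ Submodule.span ℂ (Set.range x) := by rw [h.2]; trivial
  obtain ⟨a, ha⟩ := (Submodule.mem_span_range_iff_exists_fun ℂ).1 hw
  exact ⟨a, ha.symm⟩

theorem eq_zero_of_sum_eq_zero {κ : Type} [Fintype κ] [DecidableEq κ] {c : Module.Basis κ ℂ W} {x : κ → W}
    (hx : c.det x ≠ 0) {a : κ → ℂ} (h : ∑ i, a i • x i = 0) (i : κ) : a i = 0 :=
  Fintype.linearIndependent_iff.1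
    ((Module.Basis.is_basis_iff_det c).2 (isUnit_iff_ne_zero.2 hx)).1 a h i

end Families

section Complex

variable {C : ℕ → Type} [∀ k, AddCommGroup (C k)] [∀ k, Module ℂ (C k)]
  {ι : ℕ → Type} [∀ k, Fintype (ι k)]

/-- A basis of the `1`-chains made of the boundaries of the basis of the `2`-chains, of given
cycles, and of lifts of a basis of the `0`-chains. -/
structure AdaptedBasis (d : ∀ k, C (k + 1) →ₗ[ℂ] C k) (c : ∀ k, Module.Basis (ι k) ℂ (C k))
    (z : Fin 3 → C 1) where
  g : (ι 2 ⊕ Fin 3) ⊕ ι 0 → C 1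
  x : ι 0 → C 0
  order : ι 1 ≃ (ι 2 ⊕ Fin 3) ⊕ ι 0
  g_two : ∀ i, g (Sum.inl (Sum.inl i)) = d 1 (c 2 i)
  g_cycle : ∀ k, g (Sum.inl (Sum.inr k)) = z k
  d_g : ∀ i, d 0 (g (Sum.inr i)) = x i
  det_g : ((c 1).reindex order).det g ≠ 0
  det_x : (c 0).det x ≠ 0

namespace AdaptedBasis

variable {d : ∀ k, C (k + 1) →ₗ[ℂ] C k} {c : ∀ k, Module.Basis (ι k) ℂ (C k)}
  {z : Fin 3 → C 1} (G : AdaptedBasis d c z)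

/-- The torsion computed from an adapted basis. -/
def value : ℂ := ((c 1).reindex G.order).det G.g / (c 0).det G.x

include G in
theorem surjective : Function.Surjective (d 0) := by
  intro w
  obtain ⟨a, rfl⟩ := exists_sum_eq G.det_x w
  exact ⟨∑ i, a i • G.g (Sum.inr i), by simp [G.d_g]⟩

include G in
theorem injective : Function.Injective (d 1) := by
  rw [← LinearMap.ker_eq_bot, LinearMap.ker_eq_bot']
  intro w hw
  rw [← (c 2).sum_repr w, map_sum] at hw
  simp only [map_smul, ← G.g_two] at hw
  have h := eq_zero_of_sum_eq_zero G.det_g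
    (a := Sum.elim (Sum.elim ((c 2).repr w) 0) 0) (by simpa using hw)
  apply (c 2).repr.injective
  ext i
  simpa using h (Sum.inl (Sum.inl i))

theorem exists_eq_of_boundary {w : C 1} (hw : w ∈ boundaries d 1) :
    ∃ a : ι 2 → ℂ, w = ∑ i, a i • G.g (Sum.inl (Sum.inl i)) := by
  obtain ⟨y, rfl⟩ := hw
  refine ⟨(c 2).repr y, ?_⟩
  conv_lhs => rw [← (c 2).sum_repr y, map_sum]
  simp [G.g_two]

theorem exists_eq_of_cycle (hdd : d 0 ∘ₗ d 1 = 0) (hz : ∀ k, d 0 (z k) = 0) {w : C 1}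
    (hw : d 0 w = 0) : ∃ a : ι 2 ⊕ Fin 3 → ℂ, w = ∑ i, a i • G.g (Sum.inl i) := by
  obtain ⟨a, ha⟩ := exists_sum_eq G.det_g w
  have h0 : ∀ i, d 0 (G.g (Sum.inl i)) = 0 := by
    rintro (i | k)
    · rw [G.g_two]; exact LinearMap.congr_fun hdd _
    · rw [G.g_cycle, hz]
  have h1 : ∑ i, a (Sum.inr i) • G.x i = 0 := by
    rw [ha, map_sum] at hw
    simpa only [map_smul, Fintype.sum_sum_type, h0, smul_zero, Finset.sum_const_zero, zero_add,
      G.d_g] using hw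
  refine ⟨fun i => a (Sum.inl i), ?_⟩
  rw [ha, Fintype.sum_sum_type]
  simp [eq_zero_of_sum_eq_zero G.det_x h1]

/-- The determinant of any other family of the same shape. -/
theorem det_eq (hdd : d 0 ∘ₗ d 1 = 0) (hz : ∀ k, d 0 (z k) = 0)
    (w : (ι 2 ⊕ Fin 3) ⊕ ι 0 → C 1) (y : ι 2 → C 2) (u : ι 0 → C 0)
    (h2 : ∀ i, w (Sum.inl (Sum.inl i)) = d 1 (y i))
    (h1 : ∀ k, w (Sum.inl (Sum.inr k)) - z k ∈ boundaries d 1)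
    (h0 : ∀ i, d 0 (w (Sum.inr i)) = u i) :
    ((c 1).reindex G.order).det w = G.value * (c 0).det u * (c 2).det y := by
  choose A hA using fun k => G.exists_eq_of_boundary (h1 k)
  choose q hq using fun i => exists_sum_eq G.det_x (u i)
  have hcyc : ∀ i, d 0 (w (Sum.inr i) - ∑ j, q i j • G.g (Sum.inr j)) = 0 := by
    intro i
    rw [map_sub, h0, hq, map_sum]
    simp [G.d_g]
  choose b hb using fun i => G.exists_eq_of_cycle hdd hz (hcyc i)
  have hu : (c 0).det u = (c 0).det G.x * (Matrix.of fun j i => q i j).det :=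
    det_family_mul (c 0) _ hq
  -- The transition matrix is block upper triangular. Its diagonal blocks are the change of lifts in
  -- `C 2`, the identity on the three classes, and the change of basis in `C 0`.
  have key := det_family_mul ((c 1).reindex G.order) (w := w) (g := G.g)
    (Matrix.fromBlocks (Matrix.fromBlocks ((c 2).toMatrix y) (Matrix.of fun i k => A k i) 0 1)
      (Matrix.of fun j i => b i j) 0 (Matrix.of fun j i => q i j)) (by
    rintro ((i | k) | i)
    · rw [h2, ← (c 2).sum_repr (y i), map_sum]
      simp only [map_smul, Fintype.sum_sum_type, Matrix.fromBlocks_apply₁₁,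
        Matrix.fromBlocks_apply₂₁, Matrix.zero_apply, zero_smul, Finset.sum_const_zero, add_zero,
        G.g_two]
      rfl
    · simp only [Fintype.sum_sum_type, Matrix.fromBlocks_apply₁₁, Matrix.fromBlocks_apply₁₂,
        Matrix.fromBlocks_apply₂₁, Matrix.fromBlocks_apply₂₂, Matrix.zero_apply, zero_smul,
        Finset.sum_const_zero, add_zero, Matrix.of_apply, ← hA, Matrix.one_apply, ite_smul,
        one_smul, Finset.sum_ite_eq', Finset.mem_univ, if_true, G.g_cycle]
      simp
    · simp only [Fintype.sum_sum_type (α₁ := ι 2 ⊕ Fin 3), Matrix.fromBlocks_apply₁₂,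
        Matrix.fromBlocks_apply₂₂, Matrix.of_apply, ← hb]
      abel)
  rw [key, Matrix.det_fromBlocks_zero₂₁, Matrix.det_fromBlocks_zero₂₁, Matrix.det_one, mul_one,
    hu, value, Module.Basis.det_apply (c 2)]
  have := G.det_x
  field_simp

variable {h : ∀ k, Module.Basis (PantsIndex k) ℂ (Homology d k)}

/-- The changes of basis in degrees `0` and `2` enter the degree `1` determinant as factors and
cancel against the exponents `-1` there; reordering leaves only a sign. -/
theorem value_eq (hdd : d 0 ∘ₗ d 1 = 0) (hz : ∀ k, z k ∈ cycles d 1)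
    (hh : ∀ k : Fin 3, h 1 k = homologyClass d 1 (z k) (hz k))
    (h3 : ∀ k, Subsingleton (C (k + 3))) (T : TorsionChoice ι d h) :
    T.value c 2 = G.value ∨ T.value c 2 = -G.value := by
  have hb2 : IsEmpty (BoundaryIndex d 2) := by
    have h1 : Module.finrank ℂ (boundaries d 2) = 0 := by
      have : Subsingleton (C 3) := h3 0
      have h2 : boundaries d 2 = ⊥ := by
        rw [boundaries, LinearMap.range_eq_bot]
        exact LinearMap.ext fun x => by rw [Subsingleton.elim x 0, map_zero]; rfl
      rw [h2, finrank_bot]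
    rw [BoundaryIndex, h1]
    infer_instance
  have e0 : IsEmpty (LiftIndex d 0) := inferInstanceAs (IsEmpty Empty)
  have e0' : IsEmpty (PantsIndex 0) := inferInstanceAs (IsEmpty Empty)
  have e2 : IsEmpty (PantsIndex 2) := inferInstanceAs (IsEmpty Empty)
  let s0 : ι 0 ≃ BoundaryIndex d 0 :=
    (T.order 0).trans ((Equiv.sumEmpty _ _).trans (Equiv.sumEmpty _ _))
  let s2 : ι 2 ≃ BoundaryIndex d 1 :=
    (T.order 2).trans ((Equiv.sumEmpty _ _).trans (Equiv.emptySum _ (BoundaryIndex d 1)))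
  have n0 : T.newBasis 0 = fun i => (T.b 0 (s0 i) : C 0) := by
    funext i
    rw [TorsionChoice.newBasis, Function.comp_apply]
    simp only [s0, Equiv.trans_apply]
    rcases (T.order 0) i with (j | j) | j
    · rfl
    · exact e0.elim j
    · exact e0'.elim j
  have n2 : T.newBasis 2 = fun i => T.bLift 1 (s2 i) := by
    funext i
    rw [TorsionChoice.newBasis, Function.comp_apply]
    simp only [s2, Equiv.trans_apply]
    rcases (T.order 2) i with (j | j) | j
    · exact hb2.elim j
    · rfl
    · exact e2.elim j
  let w : (ι 2 ⊕ Fin 3) ⊕ ι 0 → C 1 :=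
    Sum.elim (Sum.elim (fun i => T.b 1 (s2 i)) (T.hLift 1)) (fun i => T.bLift 0 (s0 i))
  -- The definition of torsion orders `C 1` as boundaries, lifts, homology, while an adapted basis
  -- puts the homology before the lifts.
  let e' : ι 1 ≃ (ι 2 ⊕ Fin 3) ⊕ ι 0 :=
    (T.order 1).trans ((Equiv.sumAssoc _ _ _).trans
      (((Equiv.refl _).sumCongr (Equiv.sumComm _ _)).trans ((Equiv.sumAssoc _ _ _).symm.trans
        ((s2.symm.sumCongr (Equiv.refl (Fin 3))).sumCongr s0.symm))))
  have n1 : T.newBasis 1 = w ∘ e' := by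
    funext i
    rw [TorsionChoice.newBasis, Function.comp_apply]
    simp only [e', Function.comp_apply, Equiv.trans_apply]
    rcases (T.order 1) i with (j | j) | j
    · exact (congrArg (fun j => (T.b 1 j : C 1)) (s2.apply_symm_apply j)).symm
    · exact (congrArg (T.bLift 0) (s0.apply_symm_apply j)).symm
    · rfl
  have hcl : ∀ k : Fin 3, T.hLift 1 k - z k ∈ boundaries d 1 := by
    intro k
    have h1 := (T.class_hLift 1 k).trans (hh k)
    have h2 := (Submodule.Quotient.eq _).1 h1
    exact Submodule.mem_comap.1 h2
  have hdet := G.det_eq hdd hz w (fun i => T.bLift 1 (s2 i)) (fun i => (T.b 0 (s0 i) : C 0))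
    (fun i => (T.d_bLift 1 _).symm) hcl (fun i => T.d_bLift 0 _)
  have hx0 : (c 0).det (fun i => (T.b 0 (s0 i) : C 0)) ≠ 0 := by
    have htop : boundaries d 0 = ⊤ := LinearMap.range_eq_top.2 G.surjective
    let bb : Module.Basis (ι 0) ℂ (C 0) :=
      ((T.b 0).reindex s0.symm).map (LinearEquiv.ofTop _ htop)
    have : (fun i => (T.b 0 (s0 i) : C 0)) = bb := by
      funext i; simp [bb]
    rw [this]
    exact ((c 0).isUnit_det bb).ne_zero
  have hx2 : (c 2).det (fun i => T.bLift 1 (s2 i)) ≠ 0 := by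
    obtain ⟨e, he⟩ : ∃ e : C 2 ≃ₗ[ℂ] boundaries d 1, ∀ x, (e x : C 1) = d 1 x :=
      ⟨LinearEquiv.ofInjective (d 1) G.injective, fun _ => rfl⟩
    let bb : Module.Basis (ι 2) ℂ (C 2) := ((T.b 1).reindex s2.symm).map e.symm
    have : (fun i => T.bLift 1 (s2 i)) = bb := by
      funext i
      have h1 : T.b 1 (s2 i) = e (T.bLift 1 (s2 i)) :=
        Subtype.ext ((T.d_bLift 1 _).symm.trans (he _).symm)
      rw [Module.Basis.map_apply, Module.Basis.reindex_apply, Equiv.symm_symm, h1,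
        LinearEquiv.symm_apply_apply]
    rw [this]
    exact ((c 2).isUnit_det bb).ne_zero
  have hv : T.value c 2 = (c 1).det (w ∘ e') /
      ((c 0).det (fun i => (T.b 0 (s0 i) : C 0)) * (c 2).det (fun i => T.bLift 1 (s2 i))) := by
    rw [TorsionChoice.value, Finset.prod_range_succ, Finset.prod_range_succ,
      Finset.prod_range_succ, Finset.prod_range_zero, n0, n1, n2]
    norm_num
    field_simp
  rw [Module.Basis.det_reindex] at hdet
  rcases det_comp_equiv (c 1) G.order e' w with h | h
  · left
    rw [hv, h, hdet]
    field_simp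
  · right
    rw [hv, h, hdet]
    field_simp

include G in
-- Needed for equality of sets in `torsion_eq`: the set of torsion values must not be empty. The
-- orderings exist by comparing dimensions.
theorem nonempty_torsionChoice (h3 : ∀ k, Subsingleton (C (k + 3)))
    (h : ∀ k, Module.Basis (PantsIndex k) ℂ (Homology d k)) :
    Nonempty (TorsionChoice ι d h) := by
  have : ∀ k, Module.Finite ℂ (C k) := fun k => Module.Finite.of_basis (c k)
  have hb : ∀ k, Module.finrank ℂ (boundaries d (k + 2)) = 0 := by
    intro k
    have : Subsingleton (C (k + 3)) := h3 k
    have h2 : boundaries d (k + 2) = ⊥ := by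
      rw [boundaries, LinearMap.range_eq_bot]
      exact LinearMap.ext fun x => by rw [Subsingleton.elim x 0, map_zero]; rfl
    rw [h2, finrank_bot]
  have f0 : Module.finrank ℂ (boundaries d 0) = Fintype.card (ι 0) := by
    have htop : boundaries d 0 = ⊤ := LinearMap.range_eq_top.2 G.surjective
    rw [htop, finrank_top, Module.finrank_eq_card_basis (c 0)]
  have f1 : Module.finrank ℂ (boundaries d 1) = Fintype.card (ι 2) := by
    rw [boundaries, LinearMap.finrank_range_of_inj G.injective,
      Module.finrank_eq_card_basis (c 2)]
  have horder : ∀ k, Nonempty (ι k ≃ (BoundaryIndex d k ⊕ LiftIndex d k) ⊕ PantsIndex k)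
    | 0 => by
      have e0 : IsEmpty (LiftIndex d 0) := inferInstanceAs (IsEmpty Empty)
      have e0' : IsEmpty (PantsIndex 0) := inferInstanceAs (IsEmpty Empty)
      exact ⟨(Fintype.equivFinOfCardEq f0.symm).trans
        ((Equiv.sumEmpty _ _).trans (Equiv.sumEmpty _ _)).symm⟩
    | 1 => by
      refine ⟨G.order.trans ?_⟩
      exact (((Fintype.equivFinOfCardEq f1.symm).sumCongr (Equiv.refl (Fin 3))).sumCongr
        (Fintype.equivFinOfCardEq f0.symm)).trans ((Equiv.sumAssoc _ _ _).trans
        (((Equiv.refl _).sumCongr (Equiv.sumComm _ _)).trans (Equiv.sumAssoc _ _ _).symm))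
    | 2 => by
      have hb2 : IsEmpty (BoundaryIndex d 2) := by
        rw [BoundaryIndex, hb 0]; infer_instance
      have e2 : IsEmpty (PantsIndex 2) := inferInstanceAs (IsEmpty Empty)
      exact ⟨(Fintype.equivFinOfCardEq f1.symm).trans
        ((Equiv.sumEmpty _ _).trans (Equiv.emptySum _ (BoundaryIndex d 1))).symm⟩
    | k + 3 => by
      have b1 : IsEmpty (BoundaryIndex d (k + 3)) := by
        rw [BoundaryIndex, hb (k + 1)]; infer_instance
      have b2 : IsEmpty (LiftIndex d (k + 3)) := by
        rw [LiftIndex, BoundaryIndex, hb k]; infer_instance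
      have b3 : IsEmpty (PantsIndex (k + 3)) := inferInstanceAs (IsEmpty Empty)
      have b4 : IsEmpty (ι (k + 3)) := by
        rw [← Fintype.card_eq_zero_iff, ← Module.finrank_eq_card_basis (c (k + 3))]
        have : Subsingleton (C (k + 3)) := h3 k
        exact Module.finrank_zero_of_subsingleton
      exact ⟨Equiv.equivOfIsEmpty _ _⟩
  let b : ∀ k, Module.Basis (BoundaryIndex d k) ℂ (boundaries d k) :=
    fun k => Module.finBasis ℂ (boundaries d k)
  choose l hl using fun k i => (b k i).2
  choose y hy using fun k (i : PantsIndex k) => Submodule.Quotient.mk_surjective _ (h k i)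
  exact ⟨{ b := b
           bLift := l
           d_bLift := hl
           hLift := fun k i => y k i
           hLift_mem := fun k i => (y k i).2
           class_hLift := hy
           order := fun k => (horder k).some }⟩

theorem torsion_eq (hdd : d 0 ∘ₗ d 1 = 0) (hz : ∀ k, z k ∈ cycles d 1)
    (hh : ∀ k : Fin 3, h 1 k = homologyClass d 1 (z k) (hz k))
    (h3 : ∀ k, Subsingleton (C (k + 3))) : torsion 2 d c h = {G.value, -G.value} := by
  ext t
  simp only [torsion, Set.mem_ofPred_eq, Set.mem_insert_iff, Set.mem_singleton_iff]
  constructor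
  · rintro ⟨T, hT⟩
    rcases G.value_eq hdd hz hh h3 T with h1 | h1 <;> rw [h1] at hT
    · exact hT
    · rw [neg_neg] at hT; exact hT.symm
  · intro ht
    obtain ⟨T⟩ := G.nonempty_torsionChoice h3 h
    refine ⟨T, ?_⟩
    rcases G.value_eq hdd hz hh h3 T with h1 | h1 <;> rw [h1]
    · exact ht
    · rw [neg_neg]; exact ht.symm

include G in
/-- The classes of the given cycles form a basis of the first homology. -/
theorem exists_basis_one (hdd : d 0 ∘ₗ d 1 = 0) (hz : ∀ k, z k ∈ cycles d 1) :
    ∃ b : Module.Basis (Fin 3) ℂ (Homology d 1), ∀ k, b k = homologyClass d 1 (z k) (hz k) := by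
  let v : Fin 3 → Homology d 1 := fun k => homologyClass d 1 (z k) (hz k)
  have hli : LinearIndependent ℂ v := by
    rw [Fintype.linearIndependent_iff]
    intro a ha k
    have h1 : ∑ k, a k • v k =
        Submodule.Quotient.mk (∑ k, a k • (⟨z k, hz k⟩ : cycles d 1)) := by
      rw [← Submodule.mkQ_apply, map_sum]
      simp only [map_smul]
      rfl
    rw [h1, Submodule.Quotient.mk_eq_zero] at ha
    have h2 : ∑ k, a k • z k ∈ boundaries d 1 := by
      have := Submodule.mem_comap.1 ha
      simpa using this
    obtain ⟨a', ha'⟩ := G.exists_eq_of_boundary h2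
    have h4 := eq_zero_of_sum_eq_zero G.det_g (a := Sum.elim (Sum.elim (-a') a) 0) (by
      simp [Fintype.sum_sum_type, G.g_cycle, ha'])
    exact h4 (Sum.inl (Sum.inr k))
  have hsp : ⊤ ≤ Submodule.span ℂ (Set.range v) := by
    rintro q -
    obtain ⟨⟨w, hw⟩, rfl⟩ := Submodule.Quotient.mk_surjective _ q
    obtain ⟨a, ha⟩ := G.exists_eq_of_cycle hdd hz hw
    rw [Submodule.mem_span_range_iff_exists_fun]
    refine ⟨fun k => a (Sum.inr k), ?_⟩
    have h1 : ∑ k, a (Sum.inr k) • v k =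
        Submodule.Quotient.mk (∑ k, a (Sum.inr k) • (⟨z k, hz k⟩ : cycles d 1)) := by
      rw [← Submodule.mkQ_apply, map_sum]
      simp only [map_smul]
      rfl
    rw [h1, Submodule.Quotient.eq, Submodule.submoduleOf, Submodule.mem_comap]
    have h2 : (cycles d 1).subtype (∑ k, a (Sum.inr k) • (⟨z k, hz k⟩ : cycles d 1) - ⟨w, hw⟩) =
        -∑ i, a (Sum.inl i) • G.g (Sum.inl (Sum.inl i)) := by
      simp only [map_sub, map_sum, map_smul, Submodule.subtype_apply]
      rw [ha, Fintype.sum_sum_type]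
      simp only [G.g_cycle]
      abel
    rw [h2]
    refine neg_mem (Submodule.sum_mem _ fun i _ => Submodule.smul_mem _ _ ?_)
    rw [G.g_two]
    exact ⟨_, rfl⟩
  exact ⟨Module.Basis.mk hli hsp, fun k => Module.Basis.mk_apply hli hsp k⟩

include G in
theorem subsingleton_homology (h3 : ∀ k, Subsingleton (C (k + 3))) :
    ∀ k, k ≠ 1 → Subsingleton (Homology d k)
  | 0, _ => by
    have htop : boundaries d 0 = ⊤ := LinearMap.range_eq_top.2 G.surjective
    rw [Submodule.Quotient.subsingleton_iff, htop, Submodule.submoduleOf, Submodule.comap_top]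
  | 1, h => absurd rfl h
  | 2, _ => by
    have : Subsingleton (cycles d 2) := by
      refine ⟨fun a b => Subtype.ext (G.injective ?_)⟩
      have h1 : d 1 a = 0 := a.2
      have h2 : d 1 b = 0 := b.2
      rw [h1, h2]
    exact (Submodule.Quotient.mk_surjective _).subsingleton
  | k + 3, _ => by
    have : Subsingleton (C (k + 3)) := h3 k
    exact (Submodule.Quotient.mk_surjective _).subsingleton

end AdaptedBasis

end Complex

end PairOfPants

end

noncomputable section

namespace PairOfPants

namespace HyperbolicSurface

/-! ## Quadratic forms fixed by elements of `SL(2, ℝ)` -/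

/-- The determinant of three vectors. -/
def det3 (u v w : Fin 3 → ℂ) : ℂ :=
  u 0 * (v 1 * w 2 - v 2 * w 1) - u 1 * (v 0 * w 2 - v 2 * w 0) + u 2 * (v 0 * w 1 - v 1 * w 0)

/-- The polarization of the discriminant. -/
def pairing (v : Fin 3 → ℂ) : (Fin 3 → ℂ) →ₗ[ℂ] ℂ where
  toFun z := v 1 * z 1 - 2 * v 0 * z 2 - 2 * v 2 * z 0
  map_add' x y := by simp only [Pi.add_apply]; ring
  map_smul' t x := by simp only [Pi.smul_apply, smul_eq_mul, RingHom.id_apply]; ring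

theorem pairing_apply (v z : Fin 3 → ℂ) :
    pairing v z = v 1 * z 1 - 2 * v 0 * z 2 - 2 * v 2 * z 0 := rfl

theorem pairing_self (v : Fin 3 → ℂ) : pairing v v = discr v := by
  rw [pairing_apply, discr]; ring

/-- `adT A - 1`. -/
def deltaT (A : SL(2, ℝ)) : (Fin 3 → ℂ) →ₗ[ℂ] (Fin 3 → ℂ) := adT A - LinearMap.id

theorem deltaT_apply (A : SL(2, ℝ)) (v : Fin 3 → ℂ) : deltaT A v = adT A v - v := rfl

/-- The quadratic form whose roots are the fixed points. -/
def fixedForm (A : SL(2, ℝ)) : Fin 3 → ℂ := ![A 1 0, A 1 1 - A 0 0, -A 0 1]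

theorem discr_fixedForm (A : SL(2, ℝ)) : discr (fixedForm A) = traceDisc A := by
  have h := det_complex A
  simp only [discr, fixedForm, traceDisc, Matrix.cons_val_zero, Matrix.cons_val_one,
    Matrix.cons_val]
  linear_combination (-4) * h

theorem adT_fixedForm (A : SL(2, ℝ)) : adT A (fixedForm A) = fixedForm A := by
  have h := det_complex A
  rw [adT_apply]
  ext i
  fin_cases i
  · simp [fixedForm]; linear_combination (A 1 0 : ℂ) * h
  · simp [fixedForm]; linear_combination ((A 1 1 : ℂ) - A 0 0) * h
  · simp [fixedForm]; linear_combination (-(A 0 1 : ℂ)) * h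

/-- `deltaT` as a homogeneous expression in the entries. -/
theorem deltaT_eq (A : SL(2, ℝ)) (v : Fin 3 → ℂ) : deltaT A v =
    adT A v - ((A 0 0 : ℂ) * A 1 1 - (A 0 1 : ℂ) * A 1 0) • v := by
  rw [det_complex, one_smul, deltaT_apply]

/-- The image of `adT A - 1` is orthogonal to the fixed form, so the left side is proportional to
`pairing (fixedForm A) z`; as a function of `y` and `y'` it kills the fixed form. The proof makes
both sides homogeneous using `det A = 1` and compares polynomials. -/
theorem det3_deltaT (A : SL(2, ℝ)) (y y' z : Fin 3 → ℂ) :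
    det3 (deltaT A y) (deltaT A y') z =
      -(pairing (fixedForm A) z * det3 (fixedForm A) y y') := by
  rw [← one_mul (-(pairing _ z * _)), ← det_complex A, deltaT_eq, deltaT_eq, adT_apply, adT_apply,
    pairing_apply]
  simp only [det3, fixedForm, Pi.sub_apply, Pi.smul_apply, smul_eq_mul, Matrix.cons_val_zero,
    Matrix.cons_val_one, Matrix.cons_val]
  ring

theorem fixedForm_mul (A B : SL(2, ℝ)) : fixedForm (A * B) =
    ![(A 1 0 : ℂ) * B 0 0 + A 1 1 * B 1 0,
      A 1 0 * B 0 1 + A 1 1 * B 1 1 - (A 0 0 * B 0 0 + A 0 1 * B 1 0),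
      -(A 0 0 * B 0 1 + A 0 1 * B 1 1)] := by
  ext i
  fin_cases i <;> simp [fixedForm, Matrix.mul_apply, Fin.sum_univ_two]

theorem adT_fixedForm_mul (A B : SL(2, ℝ)) :
    adT A (fixedForm (A * B)) = fixedForm (B * A) := by
  rw [← one_smul ℂ (fixedForm (B * A)), ← det_complex A, adT_apply, fixedForm_mul, fixedForm_mul]
  ext i
  fin_cases i <;> simp <;> ring

theorem two_mul_det3_fixedForm (A B : SL(2, ℝ)) (y : Fin 3 → ℂ) :
    2 * det3 (fixedForm (B * A)) (fixedForm B) y = -pairing (fixedForm A) (deltaT B y) := by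
  rw [deltaT_eq, adT_apply, fixedForm_mul, pairing_apply]
  simp only [det3, fixedForm, Pi.sub_apply, Pi.smul_apply, smul_eq_mul, Matrix.cons_val_zero,
    Matrix.cons_val_one, Matrix.cons_val]
  ring

theorem pairing_fixedForm_deltaT (A : SL(2, ℝ)) (y : Fin 3 → ℂ) :
    pairing (fixedForm A) (deltaT A y) = 0 := by
  rw [deltaT_eq, adT_apply, pairing_apply]
  simp only [fixedForm, Pi.sub_apply, Pi.smul_apply, smul_eq_mul, Matrix.cons_val_zero,
    Matrix.cons_val_one, Matrix.cons_val]
  ring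

/-- The vectors fixed by a nonparabolic element form a line. -/
theorem exists_smul_fixedForm {A : SL(2, ℝ)} (hA : traceDisc A ≠ 0) {w : Fin 3 → ℂ}
    (hw : adT A w = w) : ∃ t : ℂ, w = t • fixedForm A := by
  have h0 : deltaT A w = 0 := by rw [deltaT_apply, hw, sub_self]
  have h1 : ∀ y, det3 (fixedForm A) w y = 0 := by
    intro y
    -- With `w` fixed the left determinant vanishes, and the pairing of the fixed form with itself
    -- is nonzero, so `fixedForm A`, `w`, `y` are dependent for every `y`.
    have h := det3_deltaT A w y (fixedForm A)
    rw [h0, pairing_self, discr_fixedForm] at h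
    have h2 : det3 0 (deltaT A y) (fixedForm A) = 0 := by simp [det3]
    rw [h2, eq_comm, neg_eq_zero, mul_eq_zero] at h
    exact h.resolve_left hA
  have e0 := h1 ![1, 0, 0]
  have e1 := h1 ![0, 1, 0]
  have e2 := h1 ![0, 0, 1]
  rw [← discr_fixedForm] at hA
  refine ⟨pairing (fixedForm A) w / discr (fixedForm A), ?_⟩
  generalize fixedForm A = v at *
  simp [det3] at e0 e1 e2
  ext i
  rw [Pi.smul_apply, smul_eq_mul, div_mul_eq_mul_div, eq_div_iff hA, pairing_apply, discr]
  fin_cases i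
  · simp only [Fin.zero_eta]
    linear_combination (-v 1) * e2 - 2 * v 0 * e1
  · simp only [Fin.mk_one]
    linear_combination (-2 * v 2) * e2 + 2 * v 0 * e0
  · simp only [Fin.reduceFinMk]
    linear_combination 2 * v 2 * e1 + v 1 * e0

/-- Divide the fixed form by a complex square root of its discriminant. -/
theorem exists_invariant_line {A : SL(2, ℝ)} (hA : traceDisc A ≠ 0) :
    ∃ v, adT A v = v ∧ discr v = 1 ∧ ∀ w, adT A w = w → ∃ t : ℂ, w = t • v := by
  obtain ⟨s, hs⟩ := IsAlgClosed.exists_pow_nat_eq (traceDisc A) (n := 2) (by norm_num)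
  have hs0 : s ≠ 0 := by rintro rfl; apply hA; rw [← hs]; norm_num
  refine ⟨s⁻¹ • fixedForm A, by rw [map_smul, adT_fixedForm], ?_, fun w hw => ?_⟩
  · have h := discr_fixedForm A
    rw [← hs] at h
    simp only [discr, Pi.smul_apply, smul_eq_mul] at h ⊢
    field_simp
    linear_combination h
  · obtain ⟨t, rfl⟩ := exists_smul_fixedForm hA hw
    exact ⟨t * s, by rw [smul_smul, mul_assoc, mul_inv_cancel₀ hs0, mul_one]⟩

theorem sq_eq_of_discr {A : SL(2, ℝ)} {t : ℂ} (h : discr (t • fixedForm A) = 1) :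
    t ^ 2 * traceDisc A = 1 := by
  rw [← discr_fixedForm, ← h]
  simp only [discr, Pi.smul_apply, smul_eq_mul]
  ring

/-- The quotient of determinants computing the torsion of a pair of pants. -/
theorem det3_sq {A B : SL(2, ℝ)} (hA : traceDisc A ≠ 0) (hB : traceDisc B ≠ 0)
    (hAB : traceDisc (A * B) ≠ 0) {a b c : Fin 3 → ℂ} (ha : adT A a = a) (hb : adT B b = b)
    (hc : adT (A * B) c = c) (da : discr a = 1) (db : discr b = 1) (dc : discr c = 1)
    (y₁ y₂ y₃ : Fin 3 → ℂ) :
    4 * (traceDisc A * traceDisc B * traceDisc (A * B)) *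
        (det3 a y₁ y₂ * det3 (-adT A c) b y₃) ^ 2 =
      det3 (deltaT A y₁) (deltaT A y₂) (deltaT B y₃) ^ 2 := by
  obtain ⟨r, rfl⟩ := exists_smul_fixedForm hA ha
  obtain ⟨s, rfl⟩ := exists_smul_fixedForm hB hb
  obtain ⟨t, rfl⟩ := exists_smul_fixedForm hAB hc
  have hr := sq_eq_of_discr da
  have hs := sq_eq_of_discr db
  have ht := sq_eq_of_discr dc
  have hp := two_mul_det3_fixedForm A B y₃
  rw [det3_deltaT, ← neg_eq_iff_eq_neg.2 hp, map_smul, adT_fixedForm_mul]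
  have e1 : det3 (r • fixedForm A) y₁ y₂ = r * det3 (fixedForm A) y₁ y₂ := by
    simp only [det3, Pi.smul_apply, smul_eq_mul]; ring
  have e2 : det3 (-(t • fixedForm (B * A))) (s • fixedForm B) y₃ =
      -(t * s) * det3 (fixedForm (B * A)) (fixedForm B) y₃ := by
    simp only [det3, Pi.smul_apply, Pi.neg_apply, smul_eq_mul]; ring
  rw [e1, e2]
  have e3 : (r ^ 2 * traceDisc A) * (s ^ 2 * traceDisc B) * (t ^ 2 * traceDisc (A * B)) = 1 := by
    rw [hr, hs, ht]; norm_num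
  linear_combination (4 * (det3 (fixedForm A) y₁ y₂ *
    det3 (fixedForm (B * A)) (fixedForm B) y₃) ^ 2) * e3

/-- By `det3_deltaT` the determinant is a product of two factors. The first is nonzero by `hB`, the
second for some `y₁`, `y₂` because the fixed form is nonzero. -/
theorem exists_det3_ne {A B : SL(2, ℝ)} (hA : traceDisc A ≠ 0)
    (hB : ∃ y, pairing (fixedForm A) (deltaT B y) ≠ 0) :
    ∃ y₁ y₂ y₃, det3 (deltaT A y₁) (deltaT A y₂) (deltaT B y₃) ≠ 0 := by
  obtain ⟨y₃, h3⟩ := hB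
  by_contra! h
  have h1 : ∀ y₁ y₂, det3 (fixedForm A) y₁ y₂ = 0 := by
    intro y₁ y₂
    have := h y₁ y₂ y₃
    rw [det3_deltaT, neg_eq_zero, mul_eq_zero] at this
    exact this.resolve_left h3
  have e0 := h1 ![0, 1, 0] ![0, 0, 1]
  have e1 := h1 ![0, 0, 1] ![1, 0, 0]
  have e2 := h1 ![1, 0, 0] ![0, 1, 0]
  rw [← discr_fixedForm] at hA
  generalize fixedForm A = v at *
  simp [det3] at e0 e1 e2
  apply hA
  rw [discr, e0, e1]
  ring

/-- The linear map with three given columns. -/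
def span3 (u v w : Fin 3 → ℂ) : (Fin 3 → ℂ) →ₗ[ℂ] (Fin 3 → ℂ) :=
  Matrix.toLin' !![u 0, v 0, w 0; u 1, v 1, w 1; u 2, v 2, w 2]

theorem det_span3 (u v w : Fin 3 → ℂ) : LinearMap.det (span3 u v w) = det3 u v w := by
  rw [span3, LinearMap.det_toLin', Matrix.det_fin_three]
  simp [det3]
  ring

theorem span3_single (u v w : Fin 3 → ℂ) (i : Fin 3) :
    span3 u v w (Pi.single i 1) = (![u, v, w] : Fin 3 → Fin 3 → ℂ) i := by
  rw [span3, Matrix.toLin'_apply, Matrix.mulVec_single_one]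
  ext j
  fin_cases i <;> fin_cases j <;> rfl

end HyperbolicSurface

end PairOfPants

end

noncomputable section

namespace PairOfPants

/-! ### The relation between the three loops, and its nondegeneracy -/

theorem prod_map_filterMap {α β G : Type} [Monoid G] (f : α → G) (p : α → Option β) (g : β → G)
    (h1 : ∀ a b, p a = some b → f a = g b) (h2 : ∀ a, p a = none → f a = 1) (l : List α) :
    (l.map f).prod = ((l.filterMap p).map g).prod := by
  induction l with
  | nil => rfl
  | cons a l ih =>
    rcases hp : p a with _ | b
    · rw [List.filterMap_cons_none hp, List.map_cons, List.prod_cons, h2 a hp, one_mul, ih]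
    · rw [List.filterMap_cons_some hp, List.map_cons, List.prod_cons, List.map_cons,
        List.prod_cons, h1 a b hp, ih]

/-- A relation between three elements, in any order, can be read in one of the two cyclic orders. -/
theorem exists_cyclic_relation {G M : Type} [Group G] [Monoid M] (a : G →* M) (y : Fin 3 → G)
    {l : List (Fin 3)} (hl : l.Nodup) (hm : ∀ k, k ∈ l) (h : (l.map fun k => a (y k)).prod = 1) :
    ∃ i j : Fin 3, (i = 1 ∧ j = 2 ∨ i = 2 ∧ j = 1) ∧ a (y i * y j * y 0) = 1 := by
  have rot : ∀ x z : G, a (x * z) = 1 → a (z * x) = 1 := fun x z hxz => by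
    have : a (z * x) = a (x⁻¹ * (x * z) * x) := by congr 1; group
    rw [this, map_mul, map_mul, hxz, mul_one, ← map_mul, inv_mul_cancel, map_one]
  have hp : l.Perm [0, 1, 2] := by
    rw [List.perm_ext_iff_of_nodup hl (by decide)]
    intro k
    exact ⟨fun _ => by fin_cases k <;> simp, fun _ => hm k⟩
  obtain ⟨k₀, k₁, k₂, rfl⟩ := List.length_eq_three.1 hp.length_eq
  have h6 : ∀ k₀ k₁ k₂ : Fin 3, [k₀, k₁, k₂].Nodup → (k₀, k₁, k₂) ∈ [((0 : Fin 3), (1 : Fin 3),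
      (2 : Fin 3)), (1, 0, 2), (2, 1, 0), (1, 2, 0), (2, 0, 1), (0, 2, 1)] := by decide
  have hmem := h6 _ _ _ hl
  simp only [List.mem_cons, List.not_mem_nil, or_false, Prod.mk.injEq] at hmem
  rcases hmem with ⟨rfl, rfl, rfl⟩ | ⟨rfl, rfl, rfl⟩ | ⟨rfl, rfl, rfl⟩ | ⟨rfl, rfl, rfl⟩ |
    ⟨rfl, rfl, rfl⟩ | ⟨rfl, rfl, rfl⟩ <;>
    simp only [List.map_cons, List.map_nil, List.prod_cons, List.prod_nil, mul_one,
      ← map_mul] at h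
  · exact ⟨1, 2, by simp, rot _ _ h⟩
  · exact ⟨2, 1, by simp, rot _ _ (by rw [← mul_assoc]; exact rot _ _ h)⟩
  · exact ⟨2, 1, by simp, by rwa [mul_assoc]⟩
  · exact ⟨1, 2, by simp, by rwa [mul_assoc]⟩
  · exact ⟨1, 2, by simp, rot _ _ (by rw [← mul_assoc]; exact rot _ _ h)⟩
  · exact ⟨2, 1, by simp, rot _ _ h⟩

namespace HyperbolicSurface

open scoped Classical

variable {F E B R : Type} [Fintype F] [Fintype E] [Fintype B] [Fintype R]
  {S : HyperbolicSurface F E B R}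

theorem symSq_eq_one_of_adT {A : SL(2, ℝ)} (h : ∀ v, adT A v = v) : symSq A = 1 := by
  have h1 : (symSq A).transpose = 1 := by
    apply Matrix.mulVec_injective
    funext v
    rw [Matrix.one_mulVec]
    exact h v
  rw [← Matrix.transpose_transpose (symSq A), h1, Matrix.transpose_one]

theorem boundaryTwo_single (r : R) (v : Fin 3 → ℂ) :
    S.boundaryTwo (Pi.single r v) = (S.loopElt (Sum.inl r)).chain v := by
  rw [boundaryTwo, LinearMap.sum_apply, Finset.sum_eq_single r, loopElt_chain]
  · simp
  · intro r' _ hr'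
    simp [Pi.single_eq_of_ne hr']
  · simp

theorem loopElt_isPath (c : R ⊕ Fin 3) : (S.loopElt c).IsPath S.boundaryOne
    (faceIncl F (S.face (S.base c))) (faceIncl F (S.face (S.base c))) :=
  S.isPath_cycleList (S.base c)

theorem basedLoop_hol (h : R ⊕ Fin 3 → PathElt (E → Fin 3 → ℂ)) (c : R ⊕ Fin 3) :
    (S.basedLoop h c).hol = (h c).hol * (S.loopElt c).hol * (h c).hol⁻¹ := rfl

theorem adT_basedLoop {h : R ⊕ Fin 3 → PathElt (E → Fin 3 → ℂ)} {c : R ⊕ Fin 3} {v : Fin 3 → ℂ}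
    (hv : adT (S.loopElt c).hol v = v) :
    adT (S.basedLoop h c).hol (adT (h c).hol⁻¹ v) = adT (h c).hol⁻¹ v := by
  rw [basedLoop_hol, adT_mul_apply, adT_mul_apply, adT_adT_inv, hv]

theorem basedLoop_chain {h : R ⊕ Fin 3 → PathElt (E → Fin 3 → ℂ)} {c : R ⊕ Fin 3}
    {v : Fin 3 → ℂ} (hv : adT (S.loopElt c).hol v = v) :
    (S.basedLoop h c).chain (adT (h c).hol⁻¹ v) = (S.loopElt c).chain v := by
  rw [basedLoop, PathElt.chain_mul_apply, PathElt.chain_mul_apply, PathElt.chain_inv_apply,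
    PathElt.hol_mul, adT_mul_apply, adT_adT_inv, hv]
  abel

theorem adT_loopElt_inl (hS : S.IsPants) (r : R) (v : Fin 3 → ℂ) :
    adT (S.loopElt (Sum.inl r)).hol v = v := by
  rw [loopElt_hol, adT_congr ((symSq_loop_inl hS r).trans symSq_one.symm), adT_one]
  rfl

theorem traceDisc_basedLoop (h : R ⊕ Fin 3 → PathElt (E → Fin 3 → ℂ))
    (k : Fin 3) : traceDisc (S.basedLoop h (Sum.inr k)).hol = traceDisc (S.loopHolonomy k) := by
  rw [basedLoop_hol, traceDisc_conj, loopElt_hol]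
  rfl

namespace Presentation

variable (P : S.Presentation)

theorem boundaryOne_basedLoop (c : R ⊕ Fin 3) (v : Fin 3 → ℂ) :
    S.boundaryOne ((S.basedLoop P.h c).chain v) =
      faceIncl F P.f₀ (deltaT (S.basedLoop P.h c).hol v) := by
  have h := (((P.isPath c).mul (loopElt_isPath c)).mul (P.isPath c).inv) v
  rw [basedLoop, h, deltaT_apply, map_sub]

/-- Modulo boundaries, the loops around the three distinguished circuits satisfy one relation. -/
theorem exists_relation (hS : S.IsPants) : ∃ i j : Fin 3, (i = 1 ∧ j = 2 ∨ i = 2 ∧ j = 1) ∧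
    symSq ((S.basedLoop P.h (Sum.inr i)).hol * (S.basedLoop P.h (Sum.inr j)).hol *
      (S.basedLoop P.h (Sum.inr 0)).hol) = 1 ∧
    ∀ v, (S.basedLoop P.h (Sum.inr i)).chain v +
      (S.basedLoop P.h (Sum.inr j)).chain (adT (S.basedLoop P.h (Sum.inr i)).hol v) +
      (S.basedLoop P.h (Sum.inr 0)).chain (adT ((S.basedLoop P.h (Sum.inr i)).hol *
        (S.basedLoop P.h (Sum.inr j)).hol) v) ∈ LinearMap.range S.boundaryTwo := by
  let a := PathElt.act (LinearMap.range S.boundaryTwo).mkQ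
  have ha : ∀ (g : PathElt (E → Fin 3 → ℂ)) v w, (a g).unop (v, w) =
      (adT g.hol v, w + (LinearMap.range S.boundaryTwo).mkQ (g.chain v)) := fun g v w => rfl
  -- Around an ordinary vertex the holonomy acts trivially and the chain is the boundary of the
  -- `2`-cell, so these loops drop out of the product relation.
  have h1 : ∀ r, a (S.basedLoop P.h (Sum.inl r)) = 1 := by
    intro r
    apply MulOpposite.unop_injective
    refine LinearMap.ext fun ⟨v, w⟩ => ?_
    have hv := adT_loopElt_inl hS r (adT (P.h (Sum.inl r)).hol v)
    have e1 := adT_basedLoop (h := P.h) hv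
    have e2 := basedLoop_chain (h := P.h) hv
    rw [adT_inv_adT] at e1 e2
    rw [ha, e1, e2, ← boundaryTwo_single, Submodule.mkQ_apply,
      (Submodule.Quotient.mk_eq_zero _).2 (LinearMap.mem_range_self _ _), add_zero]
    rfl
  have h2 := congrArg a P.prod
  rw [map_one, map_list_prod, List.map_map] at h2
  have hl : (P.circuits.filterMap Sum.getRight?).Nodup := by
    refine P.nodup.filterMap ?_
    rintro (r | k) (r' | k') b hb hb' <;> simp_all
  have hm : ∀ k, k ∈ P.circuits.filterMap Sum.getRight? := fun k =>
    List.mem_filterMap.2 ⟨_, P.mem_circuits (Sum.inr k), rfl⟩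
  rw [prod_map_filterMap _ Sum.getRight? (fun k => a (S.basedLoop P.h (Sum.inr k))) ?_ ?_] at h2
  · obtain ⟨i, j, hij, h3⟩ := exists_cyclic_relation a (fun k => S.basedLoop P.h (Sum.inr k)) hl hm h2
    have h4 : ∀ v, ((a (S.basedLoop P.h (Sum.inr i) * S.basedLoop P.h (Sum.inr j) *
        S.basedLoop P.h (Sum.inr 0))).unop (v, 0)) = (v, 0) := fun v => by rw [h3]; rfl
    refine ⟨i, j, hij, symSq_eq_one_of_adT fun v => ?_, fun v => ?_⟩
    · have := congrArg Prod.fst (h4 v)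
      rw [ha] at this
      exact this
    · have := congrArg Prod.snd (h4 v)
      rw [ha, zero_add] at this
      have := (Submodule.Quotient.mk_eq_zero _).1 this
      rwa [PathElt.chain_mul_apply, PathElt.chain_mul_apply] at this
  · rintro (r | k) b hb
    · simp at hb
    · have : k = b := by simpa using hb
      rw [← this]; rfl
  · rintro (r | k) hb
    · exact h1 r
    · simp at hb

theorem treeCol_root : S.treeCol P.f₀ Finset.univ P.t P.f₀ = faceIncl F P.f₀ := by
  rw [treeCol, if_neg (by simp)]

theorem treeCol_of_ne {f : F} (hf : f ≠ P.f₀) : S.treeCol P.f₀ Finset.univ P.t f =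
    S.boundaryOne ∘ₗ LinearMap.single ℂ (fun _ : E => Fin 3 → ℂ) (P.t f) := by
  rw [treeCol, if_pos (by simp [hf])]

theorem mem_treeEdges {e : E} :
    e ∈ treeEdges P.f₀ Finset.univ P.t ↔ ∃ f, f ≠ P.f₀ ∧ P.t f = e := by
  simp [treeEdges]

theorem exists_lab {e : E} (he : e ∉ treeEdges P.f₀ Finset.univ P.t) :
    ∃ c, P.lab c = some e :=
  (P.lab_range (some e)).2 fun _ h => Option.some.inj h ▸ he

theorem not_mem_treeEdges {c : R ⊕ Fin 3} {e : E} (h : P.lab c = some e) :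
    e ∉ treeEdges P.f₀ Finset.univ P.t :=
  (P.lab_range (some e)).1 ⟨c, h⟩ e rfl

theorem exists_lab_eq {c : R ⊕ Fin 3} (hc : c ≠ Sum.inr 0) : ∃ e, P.lab c = some e := by
  rcases h : P.lab c with _ | e
  · exact absurd (P.lab_injective (h.trans P.lab_zero.symm)) hc
  · exact ⟨e, rfl⟩

/-- The holonomies of two of the loops have no common fixed form. -/
theorem exists_pairing_ne (hS : S.IsPants) {i j : Fin 3} (hij : i = 1 ∧ j = 2 ∨ i = 2 ∧ j = 1) :
    ∃ y, pairing (fixedForm (S.basedLoop P.h (Sum.inr i)).hol)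
      (deltaT (S.basedLoop P.h (Sum.inr j)).hol y) ≠ 0 := by
  by_contra! hne
  set A := (S.basedLoop P.h (Sum.inr i)).hol with hA
  have hdet : IsUnit (LinearMap.det (ofCols (S.treeCol P.f₀ Finset.univ P.t))) :=
    IsUnit.of_pow_eq_one P.tree.det_sq two_ne_zero
  have hdet' : IsUnit (LinearMap.det (ofCols P.col)) := IsUnit.of_pow_eq_one P.det_sq two_ne_zero
  let e := LinearMap.equivOfIsUnitDet hdet
  have he : ∀ f v, e.symm (S.treeCol P.f₀ Finset.univ P.t f v) = Pi.single f v := by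
    intro f v
    rw [LinearEquiv.symm_apply_eq, LinearMap.equivOfIsUnitDet_apply, ofCols_single]
  -- The tree columns reduce `0`-chains to the root polygon, where `L` pairs with the fixed form of
  -- `A`. If both loops preserved this pairing, `L` would kill every boundary, although it takes the
  -- nonzero value `traceDisc A` on the fixed form.
  let L : (F → Fin 3 → ℂ) →ₗ[ℂ] ℂ := pairing (fixedForm A) ∘ₗ LinearMap.proj P.f₀ ∘ₗ e.symm.toLinearMap
  have hL0 : ∀ v, L (faceIncl F P.f₀ v) = pairing (fixedForm A) v := by
    intro v
    simp only [L, LinearMap.comp_apply]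
    rw [← P.treeCol_root, LinearEquiv.coe_coe, he]
    simp
  have hcol : ∀ e' v, L (S.boundaryOne (P.col e' v)) = 0 := by
    intro e' v
    by_cases hT : e' ∈ treeEdges P.f₀ Finset.univ P.t
    · rw [P.col_tree e' hT]
      obtain ⟨f, hf, rfl⟩ := P.mem_treeEdges.1 hT
      have := LinearMap.congr_fun (P.treeCol_of_ne hf) v
      rw [LinearMap.comp_apply] at this
      simp only [L, LinearMap.comp_apply]
      rw [← this, LinearEquiv.coe_coe, he]
      simp [Pi.single_eq_of_ne hf.symm]
    · obtain ⟨c, hc⟩ := P.exists_lab hT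
      rw [P.col_lab c e' hc, P.boundaryOne_basedLoop, hL0]
      rcases c with r | k
      · have := adT_basedLoop (h := P.h) (adT_loopElt_inl hS r (adT (P.h (Sum.inl r)).hol v))
        rw [adT_inv_adT] at this
        rw [deltaT_apply, this, sub_self, map_zero]
      · have hk : k = i ∨ k = j := by
          have hk0 : k ≠ 0 := by
            rintro rfl
            rw [P.lab_zero] at hc
            cases hc
          omega
        rcases hk with rfl | rfl
        · exact pairing_fixedForm_deltaT _ _
        · exact hne v
  have hL1 : ∀ x, L (S.boundaryOne x) = 0 := by
    intro x
    obtain ⟨y, rfl⟩ := (LinearMap.equivOfIsUnitDet hdet').surjective x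
    rw [LinearMap.equivOfIsUnitDet_apply, ofCols_apply, map_sum, map_sum]
    exact Finset.sum_eq_zero fun e' _ => hcol e' _
  obtain ⟨x, hx⟩ := boundaryOne_surjective hS (faceIncl F P.f₀ (fixedForm A))
  have h1 := hL1 x
  rw [hx, hL0, pairing_self, discr_fixedForm, hA, traceDisc_basedLoop] at h1
  exact traceDisc_loopHolonomy_ne hS i h1

end Presentation

end HyperbolicSurface

end PairOfPants

end

noncomputable section

namespace PairOfPants

open scoped Classical

/-! ## An adapted basis for a pair of pants -/

theorem AdaptedBasis.exists_of_endomorphisms {C : ℕ → Type} [∀ k, AddCommGroup (C k)]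
    [∀ k, Module ℂ (C k)] {ι : ℕ → Type} [∀ k, Fintype (ι k)]
    {d : ∀ k, C (k + 1) →ₗ[ℂ] C k} {c : ∀ k, Module.Basis (ι k) ℂ (C k)} {z : Fin 3 → C 1}
    (Ψ₁ : C 1 →ₗ[ℂ] C 1) (Ψ₀ : C 0 →ₗ[ℂ] C 0) (h₁ : LinearMap.det Ψ₁ ≠ 0)
    (h₀ : LinearMap.det Ψ₀ ≠ 0) (θ : (ι 2 ⊕ Fin 3) ⊕ ι 0 → ι 1) (hθ : Function.Bijective θ)
    (g_two : ∀ i, Ψ₁ (c 1 (θ (Sum.inl (Sum.inl i)))) = d 1 (c 2 i))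
    (g_cycle : ∀ k, Ψ₁ (c 1 (θ (Sum.inl (Sum.inr k)))) = z k)
    (d_g : ∀ i, d 0 (Ψ₁ (c 1 (θ (Sum.inr i)))) = Ψ₀ (c 0 i)) :
    ∃ G : AdaptedBasis d c z, G.value = LinearMap.det Ψ₁ / LinearMap.det Ψ₀ := by
  have e₁ : ((c 1).reindex (Equiv.ofBijective θ hθ).symm).det (fun p => Ψ₁ (c 1 (θ p))) =
      LinearMap.det Ψ₁ := by
    have : (fun p => Ψ₁ (c 1 (θ p))) ∘ (Equiv.ofBijective θ hθ).symm = Ψ₁ ∘ c 1 := by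
      funext p
      exact congrArg (fun q => Ψ₁ (c 1 q)) ((Equiv.ofBijective θ hθ).apply_symm_apply p)
    rw [Module.Basis.det_reindex, this, Module.Basis.det_comp, Module.Basis.det_self, mul_one]
  have e₀ : (c 0).det (fun p => Ψ₀ (c 0 p)) = LinearMap.det Ψ₀ := by
    have := (c 0).det_comp Ψ₀ (c 0)
    rwa [Module.Basis.det_self, mul_one] at this
  exact ⟨{ g := fun p => Ψ₁ (c 1 (θ p))
           x := fun p => Ψ₀ (c 0 p)
           order := (Equiv.ofBijective θ hθ).symm
           g_two := g_two
           g_cycle := g_cycle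
           d_g := d_g
           det_g := by rw [e₁]; exact h₁
           det_x := by rw [e₀]; exact h₀ }, congrArg₂ (fun a b => a / b) e₁ e₀⟩

theorem discr_adT (A : SL(2, ℝ)) (v : Fin 3 → ℂ) :
    discr (HyperbolicSurface.adT A v) = discr v := by
  have h : discr (HyperbolicSurface.adT A v) =
      ((A 0 0 : ℂ) * A 1 1 - (A 0 1 : ℂ) * A 1 0) ^ 2 * discr v := by
    rw [HyperbolicSurface.adT_apply]
    simp only [discr, Matrix.cons_val_zero, Matrix.cons_val_one, Matrix.cons_val]
    ring
  rw [h, det_complex, one_pow, one_mul]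

namespace HyperbolicSurface

theorem traceDisc_inv (A : SL(2, ℝ)) : traceDisc A⁻¹ = traceDisc A := by
  simp [traceDisc, Matrix.SpecialLinearGroup.SL2_inv_expl, add_comm]

theorem det_ofCols_comp {ι V : Type} [Fintype ι] [AddCommGroup V] [Module ℂ V]
    [Module.Finite ℂ V] (col : ι → V →ₗ[ℂ] (ι → V)) (κ : ι → V →ₗ[ℂ] V) :
    LinearMap.det (ofCols fun i => col i ∘ₗ κ i) =
      LinearMap.det (ofCols col) * ∏ i, LinearMap.det (κ i) := by
  rw [← LinearMap.det_pi, ← LinearMap.det_comp]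
  congr 1
  refine LinearMap.ext fun x => ?_
  simp [ofCols_apply]

variable {F E B R : Type} [Fintype F] [Fintype E] [Fintype B] [Fintype R]
  {S : HyperbolicSurface F E B R}

theorem stdBasis_zero (f : F) (m : Fin 3) :
    stdBasis F E R 0 ⟨f, m⟩ = (Pi.single f (Pi.single m 1) : F → Fin 3 → ℂ) := by
  have h := Pi.basis_apply (η := F) (fun _ => Pi.basisFun ℂ (Fin 3)) ⟨f, m⟩
  rw [Pi.basisFun_apply] at h
  exact h

theorem stdBasis_one (e : E) (m : Fin 3) :
    stdBasis F E R 1 ⟨e, m⟩ = (Pi.single e (Pi.single m 1) : E → Fin 3 → ℂ) := by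
  have h := Pi.basis_apply (η := E) (fun _ => Pi.basisFun ℂ (Fin 3)) ⟨e, m⟩
  rw [Pi.basisFun_apply] at h
  exact h

theorem stdBasis_two (r : R) (m : Fin 3) :
    stdBasis F E R 2 ⟨r, m⟩ = (Pi.single r (Pi.single m 1) : R → Fin 3 → ℂ) := by
  have h := Pi.basis_apply (η := R) (fun _ => Pi.basisFun ℂ (Fin 3)) ⟨r, m⟩
  rw [Pi.basisFun_apply] at h
  exact h

namespace Presentation

variable (P : S.Presentation) (er : R → E) (i j : Fin 3) (ei ej : E)

/-- The correspondence between the cells of dimension two, the three loops, the faces on one side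
and the edges on the other side, after tensoring with the standard basis. -/
def indexMap : ((Σ _ : R, Fin 3) ⊕ Fin 3) ⊕ (Σ _ : F, Fin 3) → Σ _ : E, Fin 3
  | Sum.inl (Sum.inl p) => ⟨er p.1, p.2⟩
  | Sum.inl (Sum.inr k) => if k = i then ⟨ei, 0⟩ else if k = j then ⟨ej, 1⟩ else ⟨ej, 0⟩
  | Sum.inr p => if p.1 = P.f₀ then ![⟨ei, 1⟩, ⟨ei, 2⟩, ⟨ej, 2⟩] p.2 else ⟨P.t p.1, p.2⟩

variable {er i j ei ej}

/-- Surjectivity is read off from the labels; injectivity follows from the Euler relation, which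
equates the cardinalities. -/
theorem indexMap_bijective (her : ∀ r, P.lab (Sum.inl r) = some (er r))
    (hei : P.lab (Sum.inr i) = some ei) (hej : P.lab (Sum.inr j) = some ej)
    (hij : i = 1 ∧ j = 2 ∨ i = 2 ∧ j = 1) :
    Function.Bijective (P.indexMap er i j ei ej) := by
  rw [Fintype.bijective_iff_surjective_and_card]
  constructor
  · rintro ⟨e, m⟩
    by_cases hT : e ∈ treeEdges P.f₀ Finset.univ P.t
    · obtain ⟨f, hf, rfl⟩ := P.mem_treeEdges.1 hT
      exact ⟨Sum.inr ⟨f, m⟩, by simp [indexMap, hf]⟩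
    · obtain ⟨c, hc⟩ := P.exists_lab hT
      rcases c with r | k
      · have : er r = e := Option.some.inj ((her r).symm.trans hc)
        exact ⟨Sum.inl (Sum.inl ⟨r, m⟩), by simp [indexMap, this]⟩
      · have hk0 : k ≠ 0 := by
          rintro rfl
          rw [P.lab_zero] at hc
          cases hc
        have hij' : j ≠ i := by omega
        have hi0 : (0 : Fin 3) ≠ i := by omega
        have hj0 : (0 : Fin 3) ≠ j := by omega
        have hk : k = i ∨ k = j := by omega
        rcases hk with rfl | rfl
        · obtain rfl : ei = e := Option.some.inj (hei.symm.trans hc)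
          fin_cases m
          · exact ⟨Sum.inl (Sum.inr k), by simp [indexMap]⟩
          · exact ⟨Sum.inr ⟨P.f₀, 0⟩, by simp [indexMap]⟩
          · exact ⟨Sum.inr ⟨P.f₀, 1⟩, by simp [indexMap]⟩
        · obtain rfl : ej = e := Option.some.inj (hej.symm.trans hc)
          fin_cases m
          · exact ⟨Sum.inl (Sum.inr 0), by simp [indexMap, hi0, hj0]⟩
          · exact ⟨Sum.inl (Sum.inr k), by simp [indexMap, hij']⟩
          · exact ⟨Sum.inr ⟨P.f₀, 2⟩, by simp [indexMap]⟩
  · have h := S.euler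
    simp only [Fintype.card_sum, Fintype.card_sigma, Fintype.card_fin, Finset.sum_const,
      Finset.card_univ, smul_eq_mul]
    omega

variable (i j ei ej)

/-- The change of coefficients on the columns other than `ei`. -/
def scaling (M : (Fin 3 → ℂ) →ₗ[ℂ] (Fin 3 → ℂ)) (e : E) : (Fin 3 → ℂ) →ₗ[ℂ] (Fin 3 → ℂ) :=
  if e = ej then M
  else if h : ∃ r, P.lab (Sum.inl r) = some e then adT (P.h (Sum.inl h.choose)).hol⁻¹
  else LinearMap.id

/-- The columns obtained from those of the presentation by changing the coefficients. -/
def adaptedCol (M₁ M₂ M₃ : (Fin 3 → ℂ) →ₗ[ℂ] (Fin 3 → ℂ)) (e : E) :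
    (Fin 3 → ℂ) →ₗ[ℂ] (E → Fin 3 → ℂ) :=
  (Function.update (fun e => P.col e ∘ₗ P.scaling ej M₂ e) ej
      (P.col ej ∘ₗ P.scaling ej M₂ ej + (P.col ei ∘ₗ P.scaling ej M₂ ei) ∘ₗ M₃)) e ∘ₗ
    (if e = ei then M₁ else LinearMap.id)

variable {i j ei ej}

theorem scaling_lab {c : R ⊕ Fin 3} {e : E} (hc : P.lab c = some e)
    (M : (Fin 3 → ℂ) →ₗ[ℂ] (Fin 3 → ℂ)) (he : e ≠ ej) :
    P.scaling ej M e = Sum.elim (fun r => adT (P.h (Sum.inl r)).hol⁻¹) (fun _ => LinearMap.id) c := by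
  rw [scaling, if_neg he]
  split_ifs with h
  · have := P.lab_injective (h.choose_spec.trans hc.symm)
    rw [← this]
    rfl
  · rcases c with r | k
    · exact absurd ⟨r, hc⟩ h
    · rfl

theorem scaling_tree {e : E} (hT : e ∈ treeEdges P.f₀ Finset.univ P.t)
    (M : (Fin 3 → ℂ) →ₗ[ℂ] (Fin 3 → ℂ)) (he : e ≠ ej) : P.scaling ej M e = LinearMap.id := by
  rw [scaling, if_neg he, dif_neg]
  rintro ⟨r, hr⟩
  exact P.not_mem_treeEdges hr hT

theorem det_scaling (M : (Fin 3 → ℂ) →ₗ[ℂ] (Fin 3 → ℂ)) (e : E) :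
    LinearMap.det (P.scaling ej M e) = if e = ej then LinearMap.det M else 1 := by
  rw [scaling]
  split_ifs
  · rfl
  · exact det_adT _
  · exact LinearMap.det_id

/-- The term with `M₃` is an elementary column operation, and the holonomies on the columns of
`2`-cells have determinant one. -/
theorem det_adaptedCol (hne : ei ≠ ej) (M₁ M₂ M₃ : (Fin 3 → ℂ) →ₗ[ℂ] (Fin 3 → ℂ)) :
    LinearMap.det (ofCols (P.adaptedCol ei ej M₁ M₂ M₃)) =
      LinearMap.det (ofCols P.col) * (LinearMap.det M₁ * LinearMap.det M₂) := by
  have h1 : ∏ e, LinearMap.det (if e = ei then M₁ else LinearMap.id) = LinearMap.det M₁ := by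
    rw [Finset.prod_eq_single ei]
    · simp
    · intro e _ he; simp [he]
    · simp
  have h2 : ∏ e, LinearMap.det (P.scaling ej M₂ e) = LinearMap.det M₂ := by
    simp only [det_scaling, Finset.prod_ite_eq', Finset.mem_univ, if_true]
  unfold adaptedCol
  rw [det_ofCols_comp, h1,
    det_ofCols_update_add (fun e => P.col e ∘ₗ P.scaling ej M₂ e) hne M₃,
    det_ofCols_comp, h2]
  ring

section columns

variable (M₁ M₂ M₃ : (Fin 3 → ℂ) →ₗ[ℂ] (Fin 3 → ℂ)) (v : Fin 3 → ℂ)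

theorem adaptedCol_left (hei : P.lab (Sum.inr i) = some ei) (hne : ei ≠ ej) :
    P.adaptedCol ei ej M₁ M₂ M₃ ei v = (S.basedLoop P.h (Sum.inr i)).chain (M₁ v) := by
  rw [adaptedCol, Function.update_of_ne hne, if_pos rfl, P.scaling_lab hei M₂ hne,
    P.col_lab _ _ hei]
  rfl

theorem adaptedCol_right (hei : P.lab (Sum.inr i) = some ei) (hej : P.lab (Sum.inr j) = some ej)
    (hne : ei ≠ ej) :
    P.adaptedCol ei ej M₁ M₂ M₃ ej v = (S.basedLoop P.h (Sum.inr j)).chain (M₂ v) +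
      (S.basedLoop P.h (Sum.inr i)).chain (M₃ v) := by
  rw [adaptedCol, Function.update_self, if_neg hne.symm, P.scaling_lab hei M₂ hne,
    P.col_lab _ _ hei, P.col_lab _ _ hej, scaling, if_pos rfl]
  rfl

theorem adaptedCol_two (hS : S.IsPants) {r : R} {e : E} (he : P.lab (Sum.inl r) = some e)
    (hei : P.lab (Sum.inr i) = some ei) (hej : P.lab (Sum.inr j) = some ej) :
    P.adaptedCol ei ej M₁ M₂ M₃ e v = S.boundaryTwo (Pi.single r v) := by
  have h1 : e ≠ ei := by
    rintro rfl
    exact Sum.inl_ne_inr (P.lab_injective (he.trans hei.symm))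
  have h2 : e ≠ ej := by
    rintro rfl
    exact Sum.inl_ne_inr (P.lab_injective (he.trans hej.symm))
  rw [adaptedCol, Function.update_of_ne h2, if_neg h1, P.scaling_lab he M₂ h2,
    P.col_lab _ _ he, boundaryTwo_single, ← basedLoop_chain (h := P.h) (adT_loopElt_inl hS r v)]
  rfl

theorem adaptedCol_tree {f : F} (hf : f ≠ P.f₀) (hei : P.lab (Sum.inr i) = some ei)
    (hej : P.lab (Sum.inr j) = some ej) :
    P.adaptedCol ei ej M₁ M₂ M₃ (P.t f) v = Pi.single (P.t f) v := by
  have hT : P.t f ∈ treeEdges P.f₀ Finset.univ P.t := P.mem_treeEdges.2 ⟨f, hf, rfl⟩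
  have h1 : P.t f ≠ ei := fun h => P.not_mem_treeEdges hei (h ▸ hT)
  have h2 : P.t f ≠ ej := fun h => P.not_mem_treeEdges hej (h ▸ hT)
  rw [adaptedCol, Function.update_of_ne h2, if_neg h1, P.scaling_tree hT M₂ h2, P.col_tree _ hT]
  rfl

end columns

end Presentation

theorem loopChain_mem_cycles {k : Fin 3} {v : Fin 3 → ℂ} (h : S.IsInvariant k v) :
    S.loopChain k v ∈ cycles S.boundary 1 := by
  have h1 : adT (S.loopElt (Sum.inr k)).hol v = v := by rw [loopElt_hol]; exact h
  have h2 := loopElt_isPath (S := S) (Sum.inr k) v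
  rw [h1, sub_self, loopElt_chain] at h2
  exact h2

/-- An adapted basis for the classes of the normalized loops, and the torsion it computes. -/
theorem exists_adaptedBasis (hS : S.IsPants) (I : Fin 3 → Fin 3 → ℂ)
    (hI : ∀ k, S.IsInvariant k (I k) ∧ discr (I k) = 1) :
    ∃ (z : Fin 3 → Chain F E R 1) (G : AdaptedBasis S.boundary (stdBasis F E R) z),
      (∀ k, z k - S.loopChain k (I k) ∈ boundaries S.boundary 1) ∧
      G.value ^ 2 * (4 * (traceDisc (S.loopHolonomy 0) * traceDisc (S.loopHolonomy 1) *
        traceDisc (S.loopHolonomy 2))) = 1 := by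
  obtain ⟨P⟩ := S.nonempty_presentation
  obtain ⟨i, j, hij, hrel, hchain⟩ := P.exists_relation hS
  obtain ⟨y, hy⟩ := P.exists_pairing_ne hS hij
  have hdisc := fun k => traceDisc_basedLoop (S := S) P.h k
  have hdisc0 := fun k => traceDisc_loopHolonomy_ne hS k
  set A := (S.basedLoop P.h (Sum.inr i)).hol with hA
  set B' := (S.basedLoop P.h (Sum.inr j)).hol with hB
  set C := (S.basedLoop P.h (Sum.inr 0)).hol with hC
  have hinv : ∀ k, adT (S.loopElt (Sum.inr k)).hol (I k) = I k := fun k => by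
    rw [loopElt_hol]; exact (hI k).1
  let J : Fin 3 → Fin 3 → ℂ := fun k => adT (P.h (Sum.inr k)).hol⁻¹ (I k)
  have hJ : ∀ k, adT (S.basedLoop P.h (Sum.inr k)).hol (J k) = J k := fun k =>
    adT_basedLoop (hinv k)
  let lc : Fin 3 → E → Fin 3 → ℂ := fun k => S.loopChain k (I k)
  have hJc : ∀ k, (S.basedLoop P.h (Sum.inr k)).chain (J k) = lc k := fun k => by
    rw [basedLoop_chain (hinv k), loopElt_chain]; rfl
  have hJd : ∀ k, discr (J k) = 1 := fun k => by rw [discr_adT]; exact (hI k).2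
  -- The relation makes `A B'` inverse to the third holonomy up to sign, so it fixes the same form.
  have hAB : adT (A * B') (J 0) = J 0 := by
    have h1 : adT (A * B' * C) (J 0) = J 0 := by
      rw [adT_congr (hrel.trans symSq_one.symm), adT_one]; rfl
    rw [adT_mul_apply] at h1
    have h2 := congrArg (adT C⁻¹) (h1.trans (hJ 0).symm)
    rwa [adT_inv_adT, adT_inv_adT] at h2
  have hABd : traceDisc (A * B') = traceDisc C := by
    rw [← traceDisc_inv C]
    apply traceDisc_congr
    have h1 := symSq_mul_congr (A := A * B' * C) (A' := 1) (B := C⁻¹) (hrel.trans symSq_one.symm) rfl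
    rwa [mul_inv_cancel_right, one_mul] at h1
  obtain ⟨y₁, y₂, y₃, hy⟩ := exists_det3_ne (A := A) (B := B') (by rw [hdisc]; exact hdisc0 i)
    ⟨y, hy⟩
  have hsq := det3_sq (A := A) (B := B') (by rw [hdisc]; exact hdisc0 i)
    (by rw [hdisc]; exact hdisc0 j) (by rw [hABd, hdisc]; exact hdisc0 0) (hJ i) (hJ j) hAB
    (hJd i) (hJd j) (hJd 0) y₁ y₂ y₃
  rw [hABd, hdisc, hdisc, hdisc] at hsq
  have hi0 : i ≠ 0 := by omega
  have hj0 : j ≠ 0 := by omega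
  have hji : j ≠ i := by omega
  obtain ⟨ei, hei⟩ := P.exists_lab_eq (c := Sum.inr i) (by simpa using hi0)
  obtain ⟨ej, hej⟩ := P.exists_lab_eq (c := Sum.inr j) (by simpa using hj0)
  choose er her using fun r => P.exists_lab_eq (c := Sum.inl r) Sum.inl_ne_inr
  have hne : ei ≠ ej := by
    rintro rfl
    exact hji (Sum.inr_injective (P.lab_injective (hej.trans hei.symm)))
  -- One coordinate at `ei` and two at `ej` carry the three cycles. The other three carry `y₁`,
  -- `y₂`, `y₃`, whose boundaries form a basis at the root polygon. The third cycle is rewritten by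
  -- the relation through the first two loops, which is why the column of `ej` needs the correction
  -- `M₃` along the loop of `ei`.
  set M₁ := span3 (J i) y₁ y₂ with hM₁
  set M₂ := span3 (-adT A (J 0)) (J j) y₃ with hM₂
  set M₃ := span3 (-J 0) 0 0 with hM₃
  set X := span3 (deltaT A y₁) (deltaT A y₂) (deltaT B' y₃) with hX
  set Ψ₁ := ofCols (P.adaptedCol ei ej M₁ M₂ M₃) with hΨ₁
  set Ψ₀ := ofCols (fun f => S.treeCol P.f₀ Finset.univ P.t f ∘ₗ
    (if f = P.f₀ then X else LinearMap.id)) with hΨ₀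
  have dΨ₁ : LinearMap.det Ψ₁ ^ 2 = (det3 (J i) y₁ y₂ * det3 (-adT A (J 0)) (J j) y₃) ^ 2 := by
    rw [hΨ₁, P.det_adaptedCol hne, mul_pow, P.det_sq, one_mul, hM₁, hM₂, det_span3, det_span3]
  have dΨ₀ : LinearMap.det Ψ₀ ^ 2 = det3 (deltaT A y₁) (deltaT A y₂) (deltaT B' y₃) ^ 2 := by
    rw [hΨ₀, det_ofCols_comp, mul_pow, P.tree.det_sq, one_mul,
      Finset.prod_eq_single P.f₀]
    · rw [if_pos rfl, hX, det_span3]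
    · intro f _ hf; simp [hf]
    · simp
  have hprod : traceDisc (S.loopHolonomy i) * traceDisc (S.loopHolonomy j) *
      traceDisc (S.loopHolonomy 0) = traceDisc (S.loopHolonomy 0) *
      traceDisc (S.loopHolonomy 1) * traceDisc (S.loopHolonomy 2) := by
    rcases hij with ⟨rfl, rfl⟩ | ⟨rfl, rfl⟩ <;> ring
  rw [hprod, ← dΨ₁, ← dΨ₀] at hsq
  have hΨ₀0 : LinearMap.det Ψ₀ ≠ 0 := by
    intro h
    rw [h, eq_comm, zero_pow two_ne_zero] at dΨ₀
    exact hy (pow_eq_zero_iff two_ne_zero |>.1 dΨ₀)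
  have hΨ₁0 : LinearMap.det Ψ₁ ≠ 0 := by
    intro h
    rw [h, zero_pow two_ne_zero, mul_zero, eq_comm] at hsq
    exact hΨ₀0 (pow_eq_zero_iff two_ne_zero |>.1 hsq)
  -- For `k = 0` the loop chain is replaced by the homologous one that the relation `x_i x_j x_0 =
  -- 1` expresses through the other two loops.
  let z : Fin 3 → E → Fin 3 → ℂ := fun k =>
    if k = 0 then -((S.basedLoop P.h (Sum.inr i)).chain (J 0) +
      (S.basedLoop P.h (Sum.inr j)).chain (adT A (J 0)))
    else (S.basedLoop P.h (Sum.inr k)).chain (J k)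
  have hz : ∀ k, z k - lc k ∈ LinearMap.range S.boundaryTwo := by
    intro k
    by_cases hk : k = 0
    · have h1 := hchain (J 0)
      rw [hAB, hJc 0] at h1
      subst hk
      have h2 : z 0 - lc 0 = -((S.basedLoop P.h (Sum.inr i)).chain (J 0) +
          (S.basedLoop P.h (Sum.inr j)).chain (adT A (J 0)) + lc 0) := by
        simp only [z, if_pos rfl]
        abel
      rw [h2]
      exact neg_mem h1
    · simp only [z, if_neg hk, hJc, sub_self]
      exact zero_mem _
  have c1 : ∀ e m, Ψ₁ (Pi.single e (Pi.single m 1)) =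
      P.adaptedCol ei ej M₁ M₂ M₃ e (Pi.single m 1) := fun e m => ofCols_single _ _ _
  have s1 : ∀ m, P.adaptedCol ei ej M₁ M₂ M₃ ei (Pi.single m 1) =
      (S.basedLoop P.h (Sum.inr i)).chain ((![J i, y₁, y₂] : Fin 3 → Fin 3 → ℂ) m) := fun m => by
    rw [P.adaptedCol_left _ _ _ _ hei hne, hM₁, span3_single]
  have s2 : ∀ m, P.adaptedCol ei ej M₁ M₂ M₃ ej (Pi.single m 1) =
      (S.basedLoop P.h (Sum.inr j)).chain
        ((![-adT A (J 0), J j, y₃] : Fin 3 → Fin 3 → ℂ) m) +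
      (S.basedLoop P.h (Sum.inr i)).chain ((![-J 0, 0, 0] : Fin 3 → Fin 3 → ℂ) m) := fun m => by
    rw [P.adaptedCol_right _ _ _ _ hei hej hne, hM₂, hM₃, span3_single, span3_single]
  have hd : ∀ (f : F) (m : Fin 3), ∃ e m',
      P.indexMap er i j ei ej (Sum.inr ⟨f, m⟩) = ⟨e, m'⟩ ∧
      S.boundaryOne (P.adaptedCol ei ej M₁ M₂ M₃ e (Pi.single m' 1)) =
        Ψ₀ (Pi.single f (Pi.single m 1)) := by
    intro f m
    rw [hΨ₀, ofCols_single, LinearMap.comp_apply]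
    by_cases hf : f = P.f₀
    · rw [hf, if_pos rfl, P.treeCol_root, hX, span3_single]
      fin_cases m
      · refine ⟨ei, 1, by simp [Presentation.indexMap], ?_⟩
        rw [s1, P.boundaryOne_basedLoop]
        rfl
      · refine ⟨ei, 2, by simp [Presentation.indexMap], ?_⟩
        rw [s1, P.boundaryOne_basedLoop]
        rfl
      · refine ⟨ej, 2, by simp [Presentation.indexMap], ?_⟩
        have h0 : (![-J 0, 0, 0] : Fin 3 → Fin 3 → ℂ) 2 = 0 := rfl
        rw [s2, h0, map_zero, add_zero, P.boundaryOne_basedLoop]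
        rfl
    · refine ⟨P.t f, m, by simp [Presentation.indexMap, hf], ?_⟩
      rw [P.adaptedCol_tree _ _ _ _ hf hei hej, if_neg hf, P.treeCol_of_ne hf]
      rfl
  obtain ⟨G, hG⟩ := AdaptedBasis.exists_of_endomorphisms (d := S.boundary) (c := stdBasis F E R)
    (z := z) Ψ₁ Ψ₀ hΨ₁0 hΨ₀0 (P.indexMap er i j ei ej) (P.indexMap_bijective her hei hej hij)
    (by
      rintro ⟨r, m⟩
      refine (congrArg Ψ₁ (stdBasis_one (F := F) (R := R) (er r) m)).trans ((c1 _ _).trans ?_)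
      refine (P.adaptedCol_two _ _ _ _ hS (her r) hei hej).trans ?_
      exact congrArg S.boundaryTwo (stdBasis_two (F := F) (E := E) r m).symm)
    (by
      intro k
      have key : ∀ e m, P.indexMap er i j ei ej (Sum.inl (Sum.inr k)) = ⟨e, m⟩ →
          P.adaptedCol ei ej M₁ M₂ M₃ e (Pi.single m 1) = z k →
          Ψ₁ (stdBasis F E R 1 (P.indexMap er i j ei ej (Sum.inl (Sum.inr k)))) = z k := by
        intro e m h1 h2
        rw [h1]
        exact (congrArg Ψ₁ (stdBasis_one (F := F) (R := R) e m)).trans ((c1 _ _).trans h2)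
      by_cases hki : k = i
      · refine key ei 0 (by simp [Presentation.indexMap, hki]) ?_
        rw [s1, hki]
        simp [z, hi0]
      · by_cases hkj : k = j
        · refine key ej 1 (by simp [Presentation.indexMap, hkj, hji]) ?_
          rw [s2, hkj]
          simp [z, hj0]
        · have hk0 : k = 0 := by omega
          refine key ej 0 (by simp [Presentation.indexMap, hki, hkj]) ?_
          rw [s2]
          simp [z, hk0])
    (by
      rintro ⟨f, m⟩
      obtain ⟨e, m', h1, h2⟩ := hd f m
      refine (congrArg (fun q => S.boundaryOne (Ψ₁ (stdBasis F E R 1 q))) h1).trans ?_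
      refine (congrArg (fun w => S.boundaryOne (Ψ₁ w))
        (stdBasis_one (F := F) (R := R) e m')).trans ?_
      refine (congrArg S.boundaryOne (c1 e m')).trans (h2.trans ?_)
      exact congrArg Ψ₀ (stdBasis_zero (E := E) (R := R) f m).symm)
  refine ⟨z, G, hz, ?_⟩
  have hG' : G.value = LinearMap.det Ψ₁ / LinearMap.det Ψ₀ := hG
  rw [hG', div_pow, div_mul_eq_mul_div, div_eq_one_iff_eq (pow_ne_zero _ hΨ₀0), ← hsq]
  ring

end HyperbolicSurface

end PairOfPants

end

noncomputable section

namespace PairOfPants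

/-! ### Homology, invariant vectors and torsion of the surface -/

theorem exists_bases {C : ℕ → Type} [∀ k, AddCommGroup (C k)] [∀ k, Module ℂ (C k)]
    {d : ∀ k, C (k + 1) →ₗ[ℂ] C k} (hd : ∀ k, k ≠ 1 → Subsingleton (Homology d k))
    (b : Module.Basis (Fin 3) ℂ (Homology d 1)) :
    ∃ h : ∀ k, Module.Basis (PantsIndex k) ℂ (Homology d k), ∀ k : Fin 3, h 1 k = b k := by
  have e0 : IsEmpty (PantsIndex 0) := inferInstanceAs (IsEmpty Empty)
  have e2 : ∀ k, IsEmpty (PantsIndex (k + 2)) := fun k => inferInstanceAs (IsEmpty Empty)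
  have s0 := hd 0 (by omega)
  have s2 : ∀ k, Subsingleton (Homology d (k + 2)) := fun k => hd (k + 2) (by omega)
  exact ⟨fun k => match k with
    | 0 => Module.Basis.empty _
    | 1 => b
    | k + 2 => have := e2 k; have := s2 k; Module.Basis.empty _, fun _ => rfl⟩

namespace HyperbolicSurface

open scoped Classical

variable {F E B R : Type} [Fintype F] [Fintype E] [Fintype B] [Fintype R]
  {S : HyperbolicSurface F E B R}

theorem boundary_comp_boundary (hS : S.IsPants) : ∀ k, S.boundary k ∘ₗ S.boundary (k + 1) = 0
  | 0 => boundaryOne_comp_boundaryTwo hS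
  | 1 => LinearMap.comp_zero _
  | _ + 2 => LinearMap.comp_zero _

theorem subsingleton_chain (k : ℕ) : Subsingleton (Chain F E R (k + 3)) :=
  inferInstanceAs (Subsingleton (Empty → Fin 3 → ℂ))

theorem exists_invariant (hS : S.IsPants) (k : Fin 3) : ∃ v, S.IsInvariant k v ∧ discr v = 1 ∧
    ∀ w, S.IsInvariant k w → ∃ a : ℂ, w = a • v :=
  exists_invariant_line (traceDisc_loopHolonomy_ne hS k)

theorem mem_cycles_of_sub_mem (hS : S.IsPants) {z y : Chain F E R 1}
    (hy : y ∈ cycles S.boundary 1) (h : z - y ∈ boundaries S.boundary 1) :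
    z ∈ cycles S.boundary 1 := by
  obtain ⟨x, hx⟩ := h
  have h1 : z = S.boundary 1 x + y := by rw [hx, sub_add_cancel]
  rw [h1]
  refine add_mem ?_ hy
  exact LinearMap.congr_fun (boundary_comp_boundary hS 0) x

theorem homologyClass_congr {z y : Chain F E R 1} (hz : z ∈ cycles S.boundary 1)
    (hy : y ∈ cycles S.boundary 1) (h : z - y ∈ boundaries S.boundary 1) :
    homologyClass S.boundary 1 z hz = homologyClass S.boundary 1 y hy :=
  (Submodule.Quotient.eq _).2 h

theorem subsingleton_homology (hS : S.IsPants) (k : ℕ) (hk : k ≠ 1) :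
    Subsingleton (Homology S.boundary k) := by
  choose I hI using exists_invariant hS
  obtain ⟨z, G, -⟩ := exists_adaptedBasis hS I fun k => ⟨(hI k).1, (hI k).2.1⟩
  exact G.subsingleton_homology subsingleton_chain k hk

/-- Any nonzero invariant vector is a nonzero multiple of a normalized one, so the classes are a
rescaling of the basis given by `exists_adaptedBasis`. -/
theorem exists_loopBasis (hS : S.IsPants) (I : Fin 3 → Fin 3 → ℂ)
    (hI : ∀ k, S.IsInvariant k (I k) ∧ I k ≠ 0) :
    ∃ h : ∀ k, Module.Basis (PantsIndex k) ℂ (Homology S.boundary k), IsLoopBasis S I h := by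
  choose J hJ using exists_invariant hS
  obtain ⟨z, G, hz, -⟩ := exists_adaptedBasis hS J fun k => ⟨(hJ k).1, (hJ k).2.1⟩
  choose a ha using fun k => (hJ k).2.2 (I k) (hI k).1
  have ha0 : ∀ k, a k ≠ 0 := fun k h => (hI k).2 (by rw [ha, h, zero_smul])
  have hzc := fun k => mem_cycles_of_sub_mem hS (loopChain_mem_cycles (hJ k).1) (hz k)
  obtain ⟨b, hb⟩ := G.exists_basis_one (boundary_comp_boundary hS 0) hzc
  obtain ⟨h, hh⟩ := exists_bases (subsingleton_homology hS)
    (b.isUnitSMul (w := a) fun k => isUnit_iff_ne_zero.2 (ha0 k))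
  refine ⟨h, fun k => ⟨loopChain_mem_cycles (hI k).1, ?_⟩⟩
  rw [hh, Module.Basis.isUnitSMul_apply, hb,
    homologyClass_congr (hzc k) (loopChain_mem_cycles (hJ k).1) (hz k)]
  have h1 : S.loopChain k (I k) = a k • S.loopChain k (J k) := by
    rw [ha k]; exact map_smul (S.pathChain (S.loop (Sum.inr k))) _ _
  simp only [h1]
  rfl

/-- Torsion is defined only up to sign, so it suffices to know its square. -/
theorem torsion_eq_of_sq (hS : S.IsPants) {I : Fin 3 → Fin 3 → ℂ}
    (hI : ∀ k, S.IsInvariant k (I k) ∧ discr (I k) = 1)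
    {h : ∀ k, Module.Basis (PantsIndex k) ℂ (Homology S.boundary k)} (hh : IsLoopBasis S I h)
    {t : ℂ} (ht : t ^ 2 * (4 * (traceDisc (S.loopHolonomy 0) * traceDisc (S.loopHolonomy 1) *
      traceDisc (S.loopHolonomy 2))) = 1) :
    torsion 2 S.boundary (stdBasis F E R) h = {t, -t} := by
  obtain ⟨z, G, hz, hG⟩ := exists_adaptedBasis hS I hI
  have hzc := fun k => mem_cycles_of_sub_mem hS (loopChain_mem_cycles (hI k).1) (hz k)
  rw [G.torsion_eq (boundary_comp_boundary hS 0) hzc (fun k => ?_) subsingleton_chain]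
  · have h1 : G.value ^ 2 = t ^ 2 := by
      rw [← hG] at ht
      refine (mul_right_cancel₀ ?_ ht).symm
      intro h0
      rw [h0, mul_zero] at hG
      exact zero_ne_one hG
    rcases sq_eq_sq_iff_eq_or_eq_neg.1 h1 with h2 | h2
    · rw [h2]
    · rw [h2, neg_neg, Set.pair_comm]
  · obtain ⟨hc, h1⟩ := hh k
    rw [h1]
    exact (homologyClass_congr (hzc k) hc (hz k)).symm

end HyperbolicSurface

end PairOfPants

end

theorem proposition3p1 {F E B R : Type} [Fintype F] [Fintype E] [Fintype B] [Fintype R]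
    (S : PairOfPants.HyperbolicSurface F E B R) :
    -- in both cases, for all choices of the nonzero invariant vectors
    (((∃ α : Fin 3 → ℝ, (∀ k, α k < Real.pi) ∧ S.IsConeSphere α) ∨
        ∃ l : Fin 3 → ℝ, S.IsGeodesicPants l) →
      (∀ k, S.boundary k ∘ₗ S.boundary (k + 1) = 0) ∧
      (∀ k, k ≠ 1 → Subsingleton (PairOfPants.Homology S.boundary k)) ∧
      (∀ k, ∃ v, S.IsInvariant k v ∧ PairOfPants.discr v = 1 ∧
        ∀ w, S.IsInvariant k w → ∃ a : ℂ, w = a • v) ∧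
      (∀ I : Fin 3 → Fin 3 → ℂ, (∀ k, S.IsInvariant k (I k) ∧ I k ≠ 0) →
        ∃ h : ∀ k, Module.Basis (PairOfPants.PantsIndex k) ℂ
            (PairOfPants.Homology S.boundary k),
          PairOfPants.IsLoopBasis S I h)) ∧
    -- the torsion of a sphere with three cone points
    (∀ α : Fin 3 → ℝ, (∀ k, α k < Real.pi) → S.IsConeSphere α →
      ∀ I : Fin 3 → Fin 3 → ℂ, (∀ k, S.IsInvariant k (I k) ∧ PairOfPants.discr (I k) = 1) →
      ∀ h : ∀ k, Module.Basis (PairOfPants.PantsIndex k) ℂ (PairOfPants.Homology S.boundary k),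
        PairOfPants.IsLoopBasis S I h →
        PairOfPants.torsion 2 S.boundary
            (PairOfPants.HyperbolicSurface.stdBasis F E R) h =
          {Complex.I / (16 * Complex.sin (α 0) * Complex.sin (α 1) * Complex.sin (α 2)),
           -(Complex.I / (16 * Complex.sin (α 0) * Complex.sin (α 1) * Complex.sin (α 2)))}) ∧
    -- the torsion of a three-holed sphere with geodesic boundary
    (∀ l : Fin 3 → ℝ, S.IsGeodesicPants l →
      ∀ I : Fin 3 → Fin 3 → ℂ, (∀ k, S.IsInvariant k (I k) ∧ PairOfPants.discr (I k) = 1) →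
      ∀ h : ∀ k, Module.Basis (PairOfPants.PantsIndex k) ℂ (PairOfPants.Homology S.boundary k),
        PairOfPants.IsLoopBasis S I h →
        PairOfPants.torsion 2 S.boundary
            (PairOfPants.HyperbolicSurface.stdBasis F E R) h =
          {1 / (16 * Complex.sinh (l 0) * Complex.sinh (l 1) * Complex.sinh (l 2)),
           -(1 / (16 * Complex.sinh (l 0) * Complex.sinh (l 1) * Complex.sinh (l 2)))}) := by
  refine ⟨fun hS => ?_, fun α hα h I hI b hb => ?_, fun l h I hI b hb => ?_⟩
  · have hS' : S.IsPants := hS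
    exact ⟨PairOfPants.HyperbolicSurface.boundary_comp_boundary hS',
      PairOfPants.HyperbolicSurface.subsingleton_homology hS',
      PairOfPants.HyperbolicSurface.exists_invariant hS',
      PairOfPants.HyperbolicSurface.exists_loopBasis hS'⟩
  · refine PairOfPants.HyperbolicSurface.torsion_eq_of_sq (Or.inl ⟨α, hα, h⟩) hI hb ?_
    simp only [PairOfPants.HyperbolicSurface.traceDisc_cone h]
    have h0 := PairOfPants.HyperbolicSurface.sin_cone_ne hα h 0
    have h1 := PairOfPants.HyperbolicSurface.sin_cone_ne hα h 1
    have h2 := PairOfPants.HyperbolicSurface.sin_cone_ne hα h 2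
    -- Here `4 * (-4) ^ 3 = -256 = (16 * I) ^ 2`, which accounts for both the factor `16` and the
    -- `I`; in the geodesic case `4 * 4 ^ 3 = 16 ^ 2`.
    field_simp
    rw [Complex.I_sq]
    norm_num
  · refine PairOfPants.HyperbolicSurface.torsion_eq_of_sq (Or.inr ⟨l, h⟩) hI hb ?_
    simp only [PairOfPants.HyperbolicSurface.traceDisc_geodesic h]
    have h0 := PairOfPants.HyperbolicSurface.sinh_geodesic_ne h 0
    have h1 := PairOfPants.HyperbolicSurface.sinh_geodesic_ne h 1
    have h2 := PairOfPants.HyperbolicSurface.sinh_geodesic_ne h 2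
    field_simp
    norm_num
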